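/- Let $(\mathfrak g,\mathfrak h_+,\mathfrak h_-)$ be a Manin triple: $\mathfrak g$ is a finite-dimensional real Lie algebra with a symmetric, non-degenerate, ad-invariant bilinear form $\langle\cdot,\cdot\rangle$, and $\mathfrak h_\pm\subset\mathfrak g$ are isotropic Lie subalgebras with $\mathfrak g=\mathfrak h_+\oplus\mathfrak h_-$. Let $G,H_\pm$ be the connected and simply connected Lie groups integrating $\mathfrak g,\mathfrak h_\pm$, and let $\varphi_\pm:H_\pm\to G$ be the Lie group morphisms integrating the inclusions. Let $$\Gamma=\{(h_2,a_2,a_1,h_1)\in H_+\times H_-\times H_-\times H_+ \mid \varphi_+(h_2)\varphi_-(a_1)=\varphi_-(a_2)\varphi_+(h_1)\},$$ an embedded submanifold of $H_+\times H_-\times H_-\times H_+$. For $\xi=(h_2,a_2,a_1,h_1)$ put $t^h\xi=h_2$, $s^h\xi=h_1$, $t^v\xi=a_2$, $s^v\xi=a_1$. With the multiplications $m^h(\xi,\xi')=(h_2,a_2a_2',a_1a_1',h_1')$ (for $s^h\xi=t^h\xi'$) and $m^v(\xi,\xi')=(h_2h_2',a_2,a_1',h_1h_1')$ (for $s^v\xi=t^v\xi'$),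 $\Gamma$ is the Lu–Weinstein double group. It carries the 2-form $$\omega=\langle (t^h)^*\theta^l_{H_+},(s^v)^*\theta^r_{H_-}\rangle-\langle (t^v)^*\theta^l_{H_-},(s^h)^*\theta^r_{H_+}\rangle ,$$ where $\theta^l,\theta^r$ are the left and right Maurer–Cartan forms and $\langle\alpha,\beta\rangle(V,W)=\langle\alpha(V),\beta(W)\rangle-\langle\alpha(W),\beta(V)\rangle$. Let $\Gamma_{\bullet,\bullet}$ be the bisimplicial nerve of $\Gamma$ and $\bar\Gamma_\bullet$ its Artin–Mazur codiagonal: an $n$-simplex is a tuple $(x_0,\dots,x_n)$, $x_k\in\Gamma_{k,n-k}$, such that the zeroth horizontal face of $x_k$ is the last vertical face of $x_{k+1}$. Then $\bar\Gamma_\bullet$ is a simplicial manifold (each $\bar\Gamma_n$ being an embedded submanifold of a finite power of $\Gamma$ through its entries) with $\bar\Gamma_0=pt$, $\bar\Gamma_1=H_-\times H_+$, $\bar\Gamma_2=H_-\times\Gamma\times H_+$. Its faces are $$d_0(\lambda)=(a_1,h_1),\quad d_1(\lambda)=(a_3a_2,h_2h_1),\quad d_2(\lambda)=(a_3,h_3)$$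 for $\lambda=(a_3,(h_3,a_2,a_1,h_2),h_1)\in\bar\Gamma_2$, and its degeneracies are $s_0(a,h)=(e,(e,a,a,e),h)$ and $s_1(a,h)=(a,(h,e,e,h),e)$ for $(a,h)\in\bar\Gamma_1$. With the 2-form $\bar\omega=\mathrm{pr}_\Gamma^*\omega\in\Omega^2(\bar\Gamma_2)$ it is a 2-shifted symplectic local Lie 2-group, that is: 1. (Local Lie 2-group.) For all $l\ge 1$ and $0\le j\le l$ the horn projection $p_{l,j}:\bar\Gamma_l\to\mathrm{Hom}(\Lambda[l,j],\bar\Gamma_\bullet)$ is a submersion of manifolds, and for $l>2$ it is moreover injective and étale (a local diffeomorphism). 2. ($\bar\omega$ is normalized and closed.) $s_0^*\bar\omega=s_1^*\bar\omega=0$, $d\bar\omega=0$ and $\delta\bar\omega=\sum_{i=0}^3(-1)^id_i^*\bar\omega=0$. 3. ($\bar\omega$ is non-degenerate.) Let $\mathcal T_l=\bigcap_{i<l}\ker T_ed_i\subset T_e\bar\Gamma_l$ with $\partial=(-1)^lT_ed_l$ be the tangent complex. Its IM-form is $$\lambda(v,w)=\sum_{\sigma}(-1)^\sigma\,\bar\omega_e\big(T(s_{\sigma(1)}\cdots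 s_{\sigma(l)})v,\;T(s_{\sigma(l-1)}\cdots s_{\sigma(0)})w\big),\qquad v\in\mathcal T_l,\ w\in\mathcal T_{2-l},$$ where the sum is over $(l,2-l)$-shuffles $\sigma$ of $\{0,1\}$. It induces a non-degenerate pairing $H_l(\mathcal T)\times H_{2-l}(\mathcal T)\to\mathbb R$ for all $l$. In particular $\mathcal T_1=\mathfrak h_-\oplus\mathfrak h_+$, and $\lambda(v,w)=\bar\omega_e(Ts_1v,Ts_0w)-\bar\omega_e(Ts_0v,Ts_1w)$ is a non-degenerate bilinear form on $\mathfrak h_-\oplus\mathfrak h_+$. -/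

import Mathlib

open CategoryTheory Opposite Simplicial Manifold
open scoped ContDiff

universe u v

noncomputable section

namespace ManinCodiagonal



/-! ### Manifold structures on a type, differential forms -/

/-- A (Hausdorff, Banach, boundaryless) smooth manifold structure on the type `M`. -/
structure ManifoldStr (M : Type u) : Type (max u (v + 1)) where
  E : Type v
  [normed : NormedAddCommGroup E]
  [space : NormedSpace ℝ E]
  [complete : CompleteSpace E]
  [top : TopologicalSpace M]
  [t2 : T2Space M]
  [charted : ChartedSpace E M]
  [smooth : IsManifold 𝓘(ℝ, E) ∞ M]

/-- The type `M` endowed with the manifold structure `S`. -/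
def ManifoldStr.Carrier {M : Type u} (_ : ManifoldStr.{u, v} M) : Type u := M

section
variable {M : Type u} (S : ManifoldStr.{u, v} M)

instance : NormedAddCommGroup S.E := S.normed
instance : NormedSpace ℝ S.E := S.space
instance : CompleteSpace S.E := S.complete
instance : TopologicalSpace S.Carrier := S.top
instance : T2Space S.Carrier := S.t2
instance : ChartedSpace S.E S.Carrier := S.charted
instance : IsManifold 𝓘(ℝ, S.E) ∞ S.Carrier := S.smooth

end

/-- A map of types, regarded as a map between manifolds. -/
def ManifoldStr.mapOf {M N : Type*} (S : ManifoldStr M) (R : ManifoldStr N) (f : M → N) :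
    S.Carrier → R.Carrier := f

/-- A map from a type to a manifold, regarded as a map between manifolds. -/
def ManifoldStr.mapTo {M N : Type*} (S : ManifoldStr M) (f : M → N) : S.Carrier → N := f

/-- The differential at `x` of a map to a manifold `N` modelled on `E'`. -/
def ManifoldStr.dTo {M : Type*} (S : ManifoldStr M) (E' : Type*) [NormedAddCommGroup E']
    [NormedSpace ℝ E'] {N : Type*} [TopologicalSpace N] [ChartedSpace E' N] (f : M → N)
    (x : S.Carrier) : S.E →L[ℝ] E' :=
  mfderiv 𝓘(ℝ, S.E) 𝓘(ℝ, E') (S.mapTo f) x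

/-- The finite family of maps `f i : N → M` is jointly a smooth embedding of `N` into the product
manifold `M ^ ι`: all components are smooth, the map into the product is a topological embedding,
and its differential at every point is a split injection. -/
structure IsJointSmoothEmbedding {N : Type*} {M : Type*} (S : ManifoldStr N) (R : ManifoldStr M)
    {ι : Type*} [Finite ι] (f : ι → S.Carrier → R.Carrier) : Prop where
  smooth : ∀ i, ContMDiff 𝓘(ℝ, S.E) 𝓘(ℝ, R.E) ∞ (f i)
  embedding : Topology.IsEmbedding (fun (x : S.Carrier) (i : ι) => f i x)
  immersion : ∀ x : S.Carrier, ∃ L : (ι → R.E) →L[ℝ] S.E, ∀ w : S.E,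
    L (fun i => mfderiv 𝓘(ℝ, S.E) 𝓘(ℝ, R.E) (f i) x w) = w

/-- Differential `k`-forms, not necessarily smooth. -/
abbrev DForm {M : Type u} (S : ManifoldStr.{u, v} M) (k : ℕ) : Type (max u v) :=
  ∀ x : S.Carrier, (TangentSpace 𝓘(ℝ, S.E) x) [⋀^Fin k]→L[ℝ] ℝ

namespace DForm

variable {M : Type*} {S : ManifoldStr M} {N : Type*} {R : ManifoldStr N} {k : ℕ}

/-- The form `η` read in the preferred chart at `x`. -/
def inChart (η : DForm S k) (x : S.Carrier) (y : S.E) : S.E [⋀^Fin k]→L[ℝ] ℝ :=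
  (η ((chartAt S.E x).symm y)).compContinuousLinearMap
    (mfderiv 𝓘(ℝ, S.E) 𝓘(ℝ, S.E) (chartAt S.E x).symm y)

/-- Smoothness of a form, in charts. -/
def IsSmooth (η : DForm S k) : Prop :=
  ∀ x : S.Carrier, ContDiffOn ℝ ∞ (η.inChart x) (chartAt S.E x).target

/-- The exterior derivative: at `x`, differentiate in the chart at `x` and pull back. -/
def d (η : DForm S k) : DForm S (k + 1) := fun x =>
  (extDeriv (η.inChart x) (chartAt S.E x x)).compContinuousLinearMap
    (mfderiv 𝓘(ℝ, S.E) 𝓘(ℝ, S.E) (chartAt S.E x) x)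

/-- The pullback of a form along a (smooth) map. -/
def pullback (f : S.Carrier → R.Carrier) (η : DForm R k) : DForm S k := fun x =>
  (η (f x)).compContinuousLinearMap (mfderiv 𝓘(ℝ, S.E) 𝓘(ℝ, R.E) f x)

end DForm

/-! ### Simplicial manifolds, local Lie `n`-groupoids -/

/-- A simplicial manifold with underlying simplicial set `X`. -/
structure SimplicialManifold (X : SSet.{u}) : Type (max u (v + 1)) where
  lvl : ∀ n : ℕ, ManifoldStr.{u, v} (X.obj (op ⦋n⦌))
  smooth_map : ∀ {m n : ℕ} (f : ⦋m⦌ ⟶ ⦋n⦌),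
    ContMDiff 𝓘(ℝ, (lvl n).E) 𝓘(ℝ, (lvl m).E) ∞
      ((lvl n).mapOf (lvl m) (X.map f.op))

/-- The horn space `Hom(Λ[l, j], X)`. -/
abbrev HornSpace (X : SSet.{u}) (l : ℕ) (j : Fin (l + 1)) : Type u :=
  (SSet.horn.{u} l j : SSet.{u}) ⟶ X

/-- The horn projection `X_l = Hom(Δ[l], X) → Hom(Λ[l, j], X)`. -/
def hornProj (X : SSet.{u}) (l : ℕ) (j : Fin (l + 1)) (x : X.obj (op ⦋l⦌)) : HornSpace X l j :=
  (SSet.horn.{u} l j).ι ≫ SSet.yonedaEquiv.symm x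

/-- The value of a horn `Λ[l + 1, j] → X` on the `i`-th face, `i ≠ j`. -/
def hornFace (X : SSet.{u}) (l : ℕ) (j : Fin (l + 2)) (i : {i : Fin (l + 2) // i ≠ j})
    (h : HornSpace X (l + 1) j) : X.obj (op ⦋l⦌) :=
  h.app (op ⦋l⦌) (SSet.horn.face j i.1 i.2)

namespace SimplicialManifold

variable {X : SSet.{u}} (S : SimplicialManifold.{u, v} X)

/-- Local Lie `n`-groupoids: for `l ≥ 1` the horn spaces are manifolds (submanifolds of the product
of the spaces of faces), the horn projections are submersions, and for `l > n` they are injective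
and étale. -/
def IsLocalLieGroupoid (n : ℕ) : Prop :=
  ∀ (l : ℕ) (j : Fin (l + 2)), ∃ R : ManifoldStr.{u, v} (HornSpace X (l + 1) j),
    IsJointSmoothEmbedding R (S.lvl l) (fun i => R.mapOf (S.lvl l) (hornFace X l j i)) ∧
    (∀ x, IsSubmersionAt 𝓘(ℝ, (S.lvl (l + 1)).E) 𝓘(ℝ, R.E) ∞
      ((S.lvl (l + 1)).mapOf R (hornProj X (l + 1) j)) x) ∧
    (n < l + 1 →
      Function.Injective (hornProj X (l + 1) j) ∧
      IsLocalDiffeomorph 𝓘(ℝ, (S.lvl (l + 1)).E) 𝓘(ℝ, R.E) ∞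
        ((S.lvl (l + 1)).mapOf R (hornProj X (l + 1) j)))

/-- Local Lie `n`-groups: local Lie `n`-groupoids with `X_0` a point. -/
def IsLocalLieGroup (n : ℕ) : Prop :=
  S.IsLocalLieGroupoid n ∧ Nonempty (Unique (X.obj (op ⦋0⦌)))

/-! ### The de Rham double complex and shifted forms -/

/-- Families of forms `α p q ∈ Ω^q(X_p)`. -/
abbrev BiForm : Type (max u v) := ∀ p q : ℕ, DForm (S.lvl p) q

/-- The simplicial differential `δ = ∑ (-1)^i d_i^* : Ω^q(X_p) → Ω^q(X_{p+1})`. -/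
def simplicialDiff {p q : ℕ} (α : DForm (S.lvl p) q) : DForm (S.lvl (p + 1)) q :=
  ∑ i : Fin (p + 2), (-1 : ℝ) ^ (i : ℕ) •
    DForm.pullback ((S.lvl (p + 1)).mapOf (S.lvl p) (X.δ i)) α

/-- The component in `Ω^q(X_p)` of `δ α`. -/
def deltaPart (α : S.BiForm) : S.BiForm := fun p q =>
  match p with
  | 0 => 0
  | p + 1 => S.simplicialDiff (α p q)

/-- The component in `Ω^q(X_p)` of `d α`. -/
def dPart (α : S.BiForm) : S.BiForm := fun p q =>
  match q with
  | 0 => 0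
  | q + 1 => (α p q).d

/-- The total differential `D = δ + (-1)^p d`. -/
def totalDiff (α : S.BiForm) : S.BiForm := fun p q =>
  S.deltaPart α p q + (-1 : ℝ) ^ p • S.dPart α p q

/-- `m`-shifted `k`-forms `∑_{p ≤ m} α_p`, with `α_p ∈ Ω^{k+m-p}(X_p)` smooth and normalized. -/
structure IsShiftedForm (m k : ℕ) (α : S.BiForm) : Prop where
  smooth : ∀ p q, (α p q).IsSmooth
  support : ∀ p q, ¬(p ≤ m ∧ p + q = m + k) → α p q = 0
  normalized : ∀ p q (i : Fin (p + 1)),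
    DForm.pullback ((S.lvl p).mapOf (S.lvl (p + 1)) (X.σ i)) (α (p + 1) q) = 0

/-- Closedness `D α = 0`. -/
def IsClosedForm (α : S.BiForm) : Prop := ∀ p q, S.totalDiff α p q = 0

/-! ### The tangent complex and the IM-form

Tangent spaces at propositionally equal points are all literally the model space `E`; this is used
to read the differential of a simplicial operator at the degenerate simplex on `x ∈ X_0` as a map
between tangent spaces at degenerate simplices on `x`. -/

/-- The totally degenerate `l`-simplex on `x ∈ X_0`. -/
def basePt (X : SSet.{u}) (l : ℕ) (x : X.obj (op ⦋0⦌)) : X.obj (op ⦋l⦌) :=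
  X.map (SimplexCategory.const ⦋l⦌ ⦋0⦌ 0).op x

/-- The tangent map, at the degenerate simplex on `x`, of the simplicial operator of `f`. -/
def tangentMap {m n : ℕ} (f : ⦋m⦌ ⟶ ⦋n⦌) (x : X.obj (op ⦋0⦌)) :
    (S.lvl n).E →L[ℝ] (S.lvl m).E :=
  mfderiv 𝓘(ℝ, (S.lvl n).E) 𝓘(ℝ, (S.lvl m).E)
    ((S.lvl n).mapOf (S.lvl m) (X.map f.op)) (basePt X n x)

/-- The term `𝒯_l = ⋂_{i < l} ker T d_i` of the tangent complex at `x ∈ X_0`. -/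
def tangentCx (x : X.obj (op ⦋0⦌)) (l : ℕ) : Submodule ℝ (S.lvl l).E :=
  match l with
  | 0 => ⊤
  | l + 1 => ⨅ i : Fin (l + 1),
      LinearMap.ker (S.tangentMap (SimplexCategory.δ i.castSucc) x).toLinearMap

/-- The differential `∂ = (-1)^{l+1} T d_{l+1} : 𝒯_{l+1} → 𝒯_l`. -/
def boundary (x : X.obj (op ⦋0⦌)) (l : ℕ) : (S.lvl (l + 1)).E →ₗ[ℝ] (S.lvl l).E :=
  (-1 : ℝ) ^ (l + 1) •
    (S.tangentMap (SimplexCategory.δ (Fin.last (l + 1))) x).toLinearMap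

/-- The cycles of the tangent complex. -/
def cycles (x : X.obj (op ⦋0⦌)) (l : ℕ) : Submodule ℝ (S.lvl l).E :=
  match l with
  | 0 => S.tangentCx x 0
  | l + 1 => S.tangentCx x (l + 1) ⊓ LinearMap.ker (S.boundary x l)

/-- The boundaries of the tangent complex. -/
def boundaries (x : X.obj (op ⦋0⦌)) (l : ℕ) : Submodule ℝ (S.lvl l).E :=
  (S.tangentCx x (l + 1)).map (S.boundary x l)

/-- `(a, b)`-shuffles, as permutations increasing on the first `a` and on the last `b` indices. -/
def IsShuffle (a b : ℕ) (σ : Equiv.Perm (Fin (a + b))) : Prop :=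
  StrictMono (fun r : Fin a => σ (Fin.castAdd b r)) ∧
    StrictMono (fun r : Fin b => σ (Fin.natAdd a r))

/-- The monotone map `[m] → [c]`, `i ↦ #{r | g r < i}`. For injective `g` it is the surjection that
collapses `j` with `j + 1` for exactly those `j < m` which are not in the range of `g`; so its
simplicial operator is the composite `s_{j_k} ⋯ s_{j_1}` over these `j_1 < ⋯ < j_k`. -/
def countMap {m c : ℕ} (g : Fin c → Fin m) : ⦋m⦌ ⟶ ⦋c⦌ :=
  SimplexCategory.mkHom
    { toFun := fun i => ⟨(Finset.univ.filter fun r => (g r : ℕ) < (i : ℕ)).card,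
        Nat.lt_succ_of_le ((Finset.card_filter_le _ _).trans (by simp))⟩
      monotone' := fun i j hij => by
        refine Fin.mk_le_mk.2 (Finset.card_le_card fun r hr => ?_)
        simp only [Finset.mem_filter, Finset.mem_univ, true_and] at hr ⊢
        exact lt_of_lt_of_le hr hij }

open scoped Classical in
/-- The IM-form `λ(v, w) = ∑_σ (-1)^σ α_m(T(s_{σ(m-1)} ⋯ s_{σ(a)}) v, T(s_{σ(a-1)} ⋯ s_{σ(0)}) w)`,
the sum being over `(a, b)`-shuffles, where `m = a + b`. -/
def imForm (α : S.BiForm) (x : X.obj (op ⦋0⦌)) (a b : ℕ) (v : (S.lvl a).E) (w : (S.lvl b).E) : ℝ :=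
  ∑ σ : Equiv.Perm (Fin (a + b)), if IsShuffle a b σ then
    ((Equiv.Perm.sign σ : ℤ) : ℝ) * α (a + b) 2 (basePt X (a + b) x)
      ![S.tangentMap (countMap fun r => σ (Fin.castAdd b r)) x v,
        S.tangentMap (countMap fun r => σ (Fin.natAdd a r)) x w]
    else 0

/-- The IM-form of an `m`-shifted `2`-form descends to a pairing `H_l × H_{m-l} → ℝ` of the homology
of the tangent complex for every `l`, and this pairing is non-degenerate. (For `l > m` the second
factor is zero, so that the first one has to vanish.) -/
structure IsNondegenerate (m : ℕ) (α : S.BiForm) : Prop where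
  descends_left : ∀ x a b, a + b = m → ∀ v ∈ S.boundaries x a, ∀ w ∈ S.cycles x b,
    S.imForm α x a b v w = 0
  descends_right : ∀ x a b, a + b = m → ∀ v ∈ S.cycles x a, ∀ w ∈ S.boundaries x b,
    S.imForm α x a b v w = 0
  left : ∀ x a b, a + b = m → ∀ v ∈ S.cycles x a,
    (∀ w ∈ S.cycles x b, S.imForm α x a b v w = 0) → v ∈ S.boundaries x a
  right : ∀ x a b, a + b = m → ∀ w ∈ S.cycles x b,
    (∀ v ∈ S.cycles x a, S.imForm α x a b v w = 0) → w ∈ S.boundaries x b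
  above : ∀ x l, m < l → S.cycles x l ≤ S.boundaries x l

/-- `m`-shifted symplectic local Lie `n`-groups. -/
structure IsShiftedSymplecticLocalLieGroup (m n : ℕ) (α : S.BiForm) : Prop where
  localLieGroup : S.IsLocalLieGroup n
  shiftedForm : S.IsShiftedForm m 2 α
  closed : S.IsClosedForm α
  nondegenerate : S.IsNondegenerate m α

/-- The family of forms with the single component `η ∈ Ω²(X_2)`. -/
def single22 (η : DForm (S.lvl 2) 2) : S.BiForm := fun p q =>
  match p, q with
  | 2, 2 => η
  | _, _ => 0

end SimplicialManifold

/-! ### The Artin–Mazur codiagonal of a bisimplicial set -/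

section Codiagonal

variable (X : SimplexCategoryᵒᵖ × SimplexCategoryᵒᵖ ⥤ Type u)

/-- The operator of a bisimplicial set given by a pair of monotone maps. -/
def biMap {a b c d : SimplexCategory} (f : a ⟶ c) (g : b ⟶ d) (x : X.obj (op c, op d)) :
    X.obj (op a, op b) :=
  X.map (X := (op c, op d)) (Y := (op a, op b)) (f.op, g.op) x

theorem biMap_id {a b : SimplexCategory} (x : X.obj (op a, op b)) :
    biMap X (𝟙 a) (𝟙 b) x = x := by
  have := X.map_id (op a, op b)
  exact ConcreteCategory.congr_hom this x

theorem biMap_biMap {a b c d e k : SimplexCategory} (f : a ⟶ c) (g : b ⟶ d) (f' : c ⟶ e)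
    (g' : d ⟶ k) (x : X.obj (op e, op k)) :
    biMap X f g (biMap X f' g' x) = biMap X (f ≫ f') (g ≫ g') x := by
  have := X.map_comp (X := (op e, op k)) (Y := (op c, op d)) (Z := (op a, op b))
    (f'.op, g'.op) (f.op, g.op)
  exact (ConcreteCategory.congr_hom this x).symm

/-- The inclusion `[k] → [k']` of an initial segment. -/
def initIncl {k k' : ℕ} (h : k ≤ k') : ⦋k⦌ ⟶ ⦋k'⦌ :=
  SimplexCategory.mkHom
    { toFun := fun i => ⟨(i : ℕ), lt_of_lt_of_le i.2 (Nat.succ_le_succ h)⟩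
      monotone' := fun _ _ hij => hij }

/-- The inclusion `[n - k'] → [n - k]` of a final segment, where `k ≤ k' ≤ n`. -/
def finalIncl {n k k' : ℕ} (h : k ≤ k') (h' : k' ≤ n) : ⦋n - k'⦌ ⟶ ⦋n - k⦌ :=
  SimplexCategory.mkHom
    { toFun := fun i => ⟨(i : ℕ) + (k' - k), by
        have : (i : ℕ) < n - k' + 1 := i.2
        omega⟩
      monotone' := fun _ _ hij => Nat.add_le_add_right (Fin.le_def.1 hij) _ }

theorem lt_of_initial {m : ℕ} (l : Fin (m + 1)) (i : Fin ((l : ℕ) + 1)) : (i : ℕ) < m + 1 :=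
  lt_of_lt_of_le i.2 (Nat.succ_le_of_lt l.2)

theorem lt_of_final {m : ℕ} (l : Fin (m + 1)) (i : Fin (m - (l : ℕ) + 1)) :
    (l : ℕ) + i < m + 1 := by
  have := i.2
  have := l.2
  omega

/-- The restriction `[l] → [f l]` of a monotone map `f : [m] → [n]`. -/
def initRestr {m n : ℕ} (f : ⦋m⦌ ⟶ ⦋n⦌) (l : Fin (m + 1)) :
    ⦋(l : ℕ)⦌ ⟶ ⦋(f.toOrderHom l : ℕ)⦌ :=
  SimplexCategory.mkHom
    { toFun := fun i => ⟨(f.toOrderHom ⟨(i : ℕ), lt_of_initial l i⟩ : ℕ),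
        Nat.lt_succ_of_le (f.toOrderHom.monotone (Fin.le_def.2 (Nat.le_of_lt_succ i.2)))⟩
      monotone' := fun _ _ hij => f.toOrderHom.monotone hij }

/-- The restriction `[m - l] ≅ {l, …, m} → {f l, …, n} ≅ [n - f l]` of a monotone map
`f : [m] → [n]`. -/
def finalRestr {m n : ℕ} (f : ⦋m⦌ ⟶ ⦋n⦌) (l : Fin (m + 1)) :
    ⦋m - (l : ℕ)⦌ ⟶ ⦋n - (f.toOrderHom l : ℕ)⦌ :=
  SimplexCategory.mkHom
    { toFun := fun i =>
        ⟨(f.toOrderHom ⟨(l : ℕ) + i, lt_of_final l i⟩ : ℕ) - (f.toOrderHom l : ℕ),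
          Nat.lt_succ_of_le (Nat.sub_le_sub_right
            (Nat.le_of_lt_succ (f.toOrderHom ⟨(l : ℕ) + i, lt_of_final l i⟩).2) _)⟩
      monotone' := fun _ _ hij => Nat.sub_le_sub_right
        (f.toOrderHom.monotone (Fin.le_def.2 (Nat.add_le_add_left (Fin.le_def.1 hij) _))) _ }

theorem hom_ext_val {a b : ℕ} {f g : ⦋a⦌ ⟶ ⦋b⦌}
    (h : ∀ i : Fin (a + 1), (f.toOrderHom i : ℕ) = (g.toOrderHom i : ℕ)) : f = g :=
  SimplexCategory.Hom.ext _ _ (OrderHom.ext _ _ (funext fun i => Fin.ext (h i)))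

/-- The `n`-simplices of the codiagonal: tuples `(x_0, …, x_n)` with `x_k ∈ X_{k, n-k}` such that
the face `d_0` of `x_k` in the second direction is the last face `d_{k+1}` of `x_{k+1}` in the first
direction. -/
def CodiagonalObj (n : ℕ) : Type u :=
  { x : ∀ k : Fin (n + 1), X.obj (op ⦋(k : ℕ)⦌, op ⦋n - (k : ℕ)⦌) //
    ∀ (k : ℕ) (hk : k < n),
      biMap X (𝟙 ⦋k⦌) (finalIncl (Nat.le_succ k) hk) (x ⟨k, Nat.lt_succ_of_lt hk⟩) =
      biMap X (initIncl (Nat.le_succ k)) (𝟙 ⦋n - (k + 1)⦌) (x ⟨k + 1, Nat.succ_lt_succ hk⟩) }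

variable {X}

theorem CodiagonalObj.compat {n : ℕ} (x : CodiagonalObj X n) (k k' : ℕ) (h : k ≤ k')
    (h' : k' < n + 1) :
    biMap X (𝟙 ⦋k⦌) (finalIncl h (Nat.le_of_lt_succ h')) (x.1 ⟨k, lt_of_le_of_lt h h'⟩) =
      biMap X (initIncl h) (𝟙 ⦋n - k'⦌) (x.1 ⟨k', h'⟩) := by
  induction k', h using Nat.le_induction with
  | base =>
    have e1 : finalIncl (le_refl k) (Nat.le_of_lt_succ h') = 𝟙 _ :=
      hom_ext_val fun i => show (i : ℕ) + (k - k) = i by omega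
    have e2 : initIncl (le_refl k) = 𝟙 _ := hom_ext_val fun i => rfl
    rw [e1, e2]
  | succ k' hk ih =>
    have hk' : k' < n + 1 := by omega
    have hkn : k' < n := by omega
    have ih := ih hk'
    have e1 : finalIncl (hk.trans (Nat.le_succ k')) (Nat.le_of_lt_succ h') =
        finalIncl (Nat.le_succ k') hkn ≫ finalIncl hk (Nat.le_of_lt_succ hk') :=
      hom_ext_val fun i =>
        show (i : ℕ) + (k' + 1 - k) = (i : ℕ) + (k' + 1 - k') + (k' - k) by omega
    have e2 : initIncl (hk.trans (Nat.le_succ k')) =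
        initIncl hk ≫ initIncl (Nat.le_succ k') := hom_ext_val fun i => rfl
    have s1 := biMap_biMap X (𝟙 ⦋k⦌) (finalIncl (Nat.le_succ k') hkn) (𝟙 ⦋k⦌)
      (finalIncl hk (Nat.le_of_lt_succ hk')) (x.1 ⟨k, by omega⟩)
    have s2 := biMap_biMap X (initIncl hk) (𝟙 ⦋n - (k' + 1)⦌) (𝟙 ⦋k'⦌)
      (finalIncl (Nat.le_succ k') hkn) (x.1 ⟨k', hk'⟩)
    have s3 := biMap_biMap X (𝟙 ⦋k⦌) (finalIncl (Nat.le_succ k') hkn) (initIncl hk)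
      (𝟙 ⦋n - k'⦌) (x.1 ⟨k', hk'⟩)
    have s4 := biMap_biMap X (initIncl hk) (𝟙 ⦋n - (k' + 1)⦌) (initIncl (Nat.le_succ k'))
      (𝟙 ⦋n - (k' + 1)⦌) (x.1 ⟨k' + 1, h'⟩)
    rw [Category.comp_id] at s1 s4
    rw [Category.comp_id, Category.id_comp] at s2
    rw [Category.comp_id, Category.id_comp] at s3
    rw [e1, e2, ← s1, ih, s3, ← s2, x.2 k' hkn, s4]

theorem finalRestr_comm {m n : ℕ} (f : ⦋m⦌ ⟶ ⦋n⦌) (l : ℕ) (hl : l < m) (h0 : l < m + 1)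
    (h1 : l + 1 < m + 1)
    (hle : (f.toOrderHom ⟨l, h0⟩ : ℕ) ≤ (f.toOrderHom ⟨l + 1, h1⟩ : ℕ))
    (hn : (f.toOrderHom ⟨l + 1, h1⟩ : ℕ) ≤ n) :
    finalIncl (Nat.le_succ l) hl ≫ finalRestr f ⟨l, h0⟩ =
      finalRestr f ⟨l + 1, h1⟩ ≫ finalIncl hle hn := by
  refine hom_ext_val fun i => ?_
  have hi2 : l + 1 + (i : ℕ) < m + 1 := by
    have : (i : ℕ) < m - (l + 1) + 1 := i.2
    omega
  have hi1 : l + ((i : ℕ) + (l + 1 - l)) < m + 1 := by omega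
  have h3 : (f.toOrderHom ⟨l + 1, h1⟩ : ℕ) ≤ (f.toOrderHom ⟨l + 1 + i, hi2⟩ : ℕ) :=
    f.toOrderHom.monotone (Fin.le_def.2 (by simp))
  have h4 : (f.toOrderHom ⟨l + ((i : ℕ) + (l + 1 - l)), hi1⟩ : ℕ) =
      (f.toOrderHom ⟨l + 1 + i, hi2⟩ : ℕ) := by
    congr 2
    exact Fin.ext (by simp; omega)
  change (f.toOrderHom ⟨l + ((i : ℕ) + (l + 1 - l)), hi1⟩ : ℕ) - (f.toOrderHom ⟨l, h0⟩ : ℕ) =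
    (f.toOrderHom ⟨l + 1 + i, hi2⟩ : ℕ) - (f.toOrderHom ⟨l + 1, h1⟩ : ℕ) +
      ((f.toOrderHom ⟨l + 1, h1⟩ : ℕ) - (f.toOrderHom ⟨l, h0⟩ : ℕ))
  omega

/-- The simplicial operators of the codiagonal: `(f^* x)_l` is the restriction of `x_{f l}` along
`[l] → [f l]` and `[m - l] → [n - f l]`. -/
def CodiagonalObj.map {m n : ℕ} (f : ⦋m⦌ ⟶ ⦋n⦌) (x : CodiagonalObj X n) : CodiagonalObj X m :=
  ⟨fun l => biMap X (initRestr f l) (finalRestr f l) (x.1 (f.toOrderHom l)), fun l hl => by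
    have h0 : l < m + 1 := Nat.lt_succ_of_lt hl
    have h1 : l + 1 < m + 1 := Nat.succ_lt_succ hl
    have hle : (f.toOrderHom ⟨l, h0⟩ : ℕ) ≤ (f.toOrderHom ⟨l + 1, h1⟩ : ℕ) :=
      f.toOrderHom.monotone (Fin.le_def.2 (Nat.le_succ l))
    have hn := (f.toOrderHom ⟨l + 1, h1⟩).2
    have c := x.compat _ _ hle hn
    have e1 := finalRestr_comm f l hl h0 h1 hle (Nat.le_of_lt_succ hn)
    have e2 : initIncl (Nat.le_succ l) ≫ initRestr f ⟨l + 1, h1⟩ =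
        initRestr f ⟨l, h0⟩ ≫ initIncl hle := hom_ext_val fun i => rfl
    have s1 := biMap_biMap X (𝟙 ⦋l⦌) (finalIncl (Nat.le_succ l) hl) (initRestr f ⟨l, h0⟩)
      (finalRestr f ⟨l, h0⟩) (x.1 (f.toOrderHom ⟨l, h0⟩))
    have s2 := biMap_biMap X (initRestr f ⟨l, h0⟩) (finalRestr f ⟨l + 1, h1⟩) (𝟙 _)
      (finalIncl hle (Nat.le_of_lt_succ hn)) (x.1 (f.toOrderHom ⟨l, h0⟩))
    have s3 := biMap_biMap X (initRestr f ⟨l, h0⟩) (finalRestr f ⟨l + 1, h1⟩) (initIncl hle)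
      (𝟙 _) (x.1 (f.toOrderHom ⟨l + 1, h1⟩))
    have s4 := biMap_biMap X (initIncl (Nat.le_succ l)) (𝟙 ⦋m - (l + 1)⦌)
      (initRestr f ⟨l + 1, h1⟩) (finalRestr f ⟨l + 1, h1⟩) (x.1 (f.toOrderHom ⟨l + 1, h1⟩))
    rw [Category.id_comp, e1] at s1
    rw [Category.comp_id] at s2
    rw [Category.comp_id] at s3
    rw [Category.id_comp, e2] at s4
    exact s1.trans (s2.symm.trans ((congrArg _ c).trans (s3.trans s4.symm)))⟩

theorem CodiagonalObj.map_id {n : ℕ} (x : CodiagonalObj X n) :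
    CodiagonalObj.map (𝟙 ⦋n⦌) x = x := by
  refine Subtype.ext (funext fun l => ?_)
  have e1 : initRestr (𝟙 ⦋n⦌) l = 𝟙 _ := hom_ext_val fun i => rfl
  have e2 : finalRestr (𝟙 ⦋n⦌) l = 𝟙 _ :=
    hom_ext_val fun i => show (l : ℕ) + (i : ℕ) - l = i by omega
  change biMap X (initRestr (𝟙 ⦋n⦌) l) (finalRestr (𝟙 ⦋n⦌) l) (x.1 l) = x.1 l
  exact (congrArg₂ (fun f g => biMap X f g (x.1 l)) e1 e2).trans (biMap_id X _)

theorem CodiagonalObj.map_comp {k m n : ℕ} (f : ⦋k⦌ ⟶ ⦋m⦌) (g : ⦋m⦌ ⟶ ⦋n⦌)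
    (x : CodiagonalObj X n) :
    CodiagonalObj.map (f ≫ g) x = CodiagonalObj.map f (CodiagonalObj.map g x) := by
  refine Subtype.ext (funext fun l => ?_)
  have e1 : initRestr (f ≫ g) l = initRestr f l ≫ initRestr g (f.toOrderHom l) :=
    hom_ext_val fun i => rfl
  have e2 : finalRestr (f ≫ g) l = finalRestr f l ≫ finalRestr g (f.toOrderHom l) := by
    refine hom_ext_val fun i => ?_
    have hi : (l : ℕ) + (i : ℕ) < k + 1 := lt_of_final l i
    have h1 : (f.toOrderHom l : ℕ) ≤ (f.toOrderHom ⟨(l : ℕ) + i, hi⟩ : ℕ) :=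
      f.toOrderHom.monotone (Fin.le_def.2 (Nat.le_add_right _ _))
    have h2 : (f.toOrderHom l : ℕ) +
        ((f.toOrderHom ⟨(l : ℕ) + i, hi⟩ : ℕ) - (f.toOrderHom l : ℕ)) < m + 1 := by
      have := (f.toOrderHom ⟨(l : ℕ) + i, hi⟩).2
      simp only [SimplexCategory.len_mk] at this
      omega
    have h3 : (⟨(f.toOrderHom l : ℕ) +
        ((f.toOrderHom ⟨(l : ℕ) + i, hi⟩ : ℕ) - (f.toOrderHom l : ℕ)), h2⟩ : Fin (m + 1)) =
        f.toOrderHom ⟨(l : ℕ) + i, hi⟩ := Fin.ext (by simp only; omega)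
    change (g.toOrderHom (f.toOrderHom ⟨(l : ℕ) + i, hi⟩) : ℕ) -
      (g.toOrderHom (f.toOrderHom l) : ℕ) = (g.toOrderHom ⟨(f.toOrderHom l : ℕ) +
        ((f.toOrderHom ⟨(l : ℕ) + i, hi⟩ : ℕ) - (f.toOrderHom l : ℕ)), h2⟩ : ℕ) -
      (g.toOrderHom (f.toOrderHom l) : ℕ)
    rw [h3]
  have s := biMap_biMap X (initRestr f l) (finalRestr f l) (initRestr g (f.toOrderHom l))
    (finalRestr g (f.toOrderHom l)) (x.1 (g.toOrderHom (f.toOrderHom l)))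
  exact (congrArg₂ (fun p q => biMap X p q (x.1 (g.toOrderHom (f.toOrderHom l)))) e1 e2).trans
    s.symm

variable (X)

/-- The Artin–Mazur codiagonal of a bisimplicial set. -/
def codiagonal : SSet.{u} where
  obj n := CodiagonalObj X n.unop.len
  map f := TypeCat.ofHom (CodiagonalObj.map f.unop)
  map_id _ := by
    ext x
    exact CodiagonalObj.map_id x
  map_comp f g := by
    ext x
    exact CodiagonalObj.map_comp g.unop f.unop x

end Codiagonal

/-! ### Manin triples and their integration -/

/-- A Manin triple: a quadratic Lie algebra `𝔤` with two isotropic Lie subalgebras `𝔥₊` (`plus`) and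
`𝔥₋` (`minus`) such that `𝔤 = 𝔥₊ ⊕ 𝔥₋`. -/
structure ManinTriple (𝔤 : Type*) [LieRing 𝔤] [LieAlgebra ℝ 𝔤] where
  pairing : LinearMap.BilinForm ℝ 𝔤
  symm : ∀ x y, pairing x y = pairing y x
  nondegenerate : pairing.Nondegenerate
  invariant : ∀ x y z : 𝔤, pairing ⁅x, y⁆ z + pairing y ⁅x, z⁆ = 0
  plus : LieSubalgebra ℝ 𝔤
  minus : LieSubalgebra ℝ 𝔤
  plus_isotropic : ∀ x ∈ plus, ∀ y ∈ plus, pairing x y = 0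
  minus_isotropic : ∀ x ∈ minus, ∀ y ∈ minus, pairing x y = 0
  isCompl : IsCompl plus.toSubmodule minus.toSubmodule

/-- A smooth real Lie group is smooth enough for its Lie algebra to be defined. -/
instance lieGroup_minSmoothness {E G : Type*} [NormedAddCommGroup E] [NormedSpace ℝ E]
    [TopologicalSpace G] [ChartedSpace E G] [Group G] [LieGroup 𝓘(ℝ, E) ∞ G] :
    LieGroup 𝓘(ℝ, E) (minSmoothness ℝ 3) G :=
  LieGroup.of_le (m := minSmoothness ℝ 3) (n := ∞) (by
    rw [minSmoothness_of_isRCLikeNormedField]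
    exact WithTop.coe_le_coe.2 (le_top : (3 : ℕ∞) ≤ ⊤))

/-- The Lie groups `G`, `H₊`, `H₋` integrate `𝔤`, `𝔥₊`, `𝔥₋` (their Lie algebras are identified with
these), and the morphisms `φ₊ : H₊ → G` and `φ₋ : H₋ → G` integrate the inclusions. -/
structure Integration {𝔤 : Type*} [LieRing 𝔤] [LieAlgebra ℝ 𝔤] (T : ManinTriple 𝔤)
    (EG G Ep Hp Em Hm : Type*)
    [NormedAddCommGroup EG] [NormedSpace ℝ EG] [CompleteSpace EG]
    [TopologicalSpace G] [ChartedSpace EG G] [Group G] [LieGroup 𝓘(ℝ, EG) ∞ G]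
    [NormedAddCommGroup Ep] [NormedSpace ℝ Ep] [CompleteSpace Ep]
    [TopologicalSpace Hp] [ChartedSpace Ep Hp] [Group Hp] [LieGroup 𝓘(ℝ, Ep) ∞ Hp]
    [NormedAddCommGroup Em] [NormedSpace ℝ Em] [CompleteSpace Em]
    [TopologicalSpace Hm] [ChartedSpace Em Hm] [Group Hm] [LieGroup 𝓘(ℝ, Em) ∞ Hm] where
  lieG : GroupLieAlgebra 𝓘(ℝ, EG) G ≃ₗ⁅ℝ⁆ 𝔤
  lieP : GroupLieAlgebra 𝓘(ℝ, Ep) Hp ≃ₗ⁅ℝ⁆ T.plus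
  lieM : GroupLieAlgebra 𝓘(ℝ, Em) Hm ≃ₗ⁅ℝ⁆ T.minus
  φp : Hp →* G
  φm : Hm →* G
  smooth_φp : ContMDiff 𝓘(ℝ, Ep) 𝓘(ℝ, EG) ∞ φp
  smooth_φm : ContMDiff 𝓘(ℝ, Em) 𝓘(ℝ, EG) ∞ φm
  d_φp : ∀ w : GroupLieAlgebra 𝓘(ℝ, Ep) Hp,
    lieG (mfderiv 𝓘(ℝ, Ep) 𝓘(ℝ, EG) φp 1 w : EG) = (lieP w : 𝔤)
  d_φm : ∀ w : GroupLieAlgebra 𝓘(ℝ, Em) Hm,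
    lieG (mfderiv 𝓘(ℝ, Em) 𝓘(ℝ, EG) φm 1 w : EG) = (lieM w : 𝔤)

/-! ### The Lu–Weinstein double group `Γ` -/

/-- The elements `(h₂, a₂, a₁, h₁) = (left, top, bottom, right)` of `Γ`, with
`φ₊(h₂) φ₋(a₁) = φ₋(a₂) φ₊(h₁)`. -/
@[ext]
structure LWSquare {G Hp Hm : Type*} [Group G] [Group Hp] [Group Hm]
    (φp : Hp →* G) (φm : Hm →* G) where
  left : Hp
  top : Hm
  bottom : Hm
  right : Hp
  comm : φp left * φm bottom = φm top * φp right

namespace LWSquare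

variable {G : Type*} {Hp Hm : Type u} [Group G] [Group Hp] [Group Hm]
  {φp : Hp →* G} {φm : Hm →* G}

/-- The inclusion of `Γ` in `H₊ × H₋ × H₋ × H₊`. -/
def toProd (ξ : LWSquare φp φm) : Hp × Hm × Hm × Hp := (ξ.left, ξ.top, ξ.bottom, ξ.right)

/-- Horizontal multiplication, for `s^h ξ = t^h ξ'`. -/
def hMul (ξ ξ' : LWSquare φp φm) (h : ξ.right = ξ'.left) : LWSquare φp φm where
  left := ξ.left
  top := ξ.top * ξ'.top
  bottom := ξ.bottom * ξ'.bottom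
  right := ξ'.right
  comm := by
    rw [map_mul, map_mul, ← mul_assoc, ξ.comm, mul_assoc, mul_assoc, h, ξ'.comm]

/-- Vertical multiplication, for `s^v ξ = t^v ξ'`. -/
def vMul (ξ ξ' : LWSquare φp φm) (h : ξ.bottom = ξ'.top) : LWSquare φp φm where
  left := ξ.left * ξ'.left
  top := ξ.top
  bottom := ξ'.bottom
  right := ξ.right * ξ'.right
  comm := by
    rw [map_mul, map_mul, mul_assoc, ξ'.comm, ← h, ← mul_assoc, ξ.comm, mul_assoc]

variable (φp φm) in
/-- The unit of the horizontal groupoid at `h`. -/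
def hUnit (h : Hp) : LWSquare φp φm := ⟨h, 1, 1, h, by simp⟩

variable (φp φm) in
/-- The unit of the vertical groupoid at `a`. -/
def vUnit (a : Hm) : LWSquare φp φm := ⟨1, a, a, 1, by simp⟩

end LWSquare

/-- The pairs `p ≤ p'` of elements of `P`. -/
abbrev Ivl (P : Type) [Preorder P] : Type := { r : P × P // r.1 ≤ r.2 }

/-- The image of a pair under a monotone map. -/
def Ivl.map {P Q : Type} [Preorder P] [Preorder Q] (f : P →o Q) (r : Ivl P) : Ivl Q :=
  ⟨(f r.1.1, f r.1.2), f.monotone r.2⟩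

/-- Grids in the double group `Γ` with rows of vertices indexed by `P` and columns indexed by `Q`:
for all `q ≤ q'` in `P` and `p ≤ p'` in `Q` an element `cell (q, q') (p, p')` of `Γ`, multiplicative
under horizontal and vertical subdivision, and a unit on degenerate intervals.

For `P = {0, …, j}` and `Q = {0, …, i}` with `i, j ≥ 1` this is the same as the composable matrix of
the elements `g_{qp} = cell (q-1, q) (p-1, p)`, `1 ≤ q ≤ j`, `1 ≤ p ≤ i`; for `j = 0` it is the same
as an element of `H₋ ^ i`, and for `i = 0` the same as an element of `H₊ ^ j`. -/
@[ext]
structure Grid {G : Type*} {Hp Hm : Type u} [Group G] [Group Hp] [Group Hm]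
    (φp : Hp →* G) (φm : Hm →* G) (P Q : Type) [Preorder P] [Preorder Q] : Type u where
  cell : Ivl P → Ivl Q → LWSquare φp φm
  horizontal : ∀ (r : Ivl P) (p p' p'' : Q) (h : p ≤ p') (h' : p' ≤ p''),
    ∃ hc : (cell r ⟨(p, p'), h⟩).right = (cell r ⟨(p', p''), h'⟩).left,
      (cell r ⟨(p, p'), h⟩).hMul (cell r ⟨(p', p''), h'⟩) hc = cell r ⟨(p, p''), h.trans h'⟩
  vertical : ∀ (c : Ivl Q) (q q' q'' : P) (h : q ≤ q') (h' : q' ≤ q''),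
    ∃ hc : (cell ⟨(q, q'), h⟩ c).bottom = (cell ⟨(q', q''), h'⟩ c).top,
      (cell ⟨(q, q'), h⟩ c).vMul (cell ⟨(q', q''), h'⟩ c) hc = cell ⟨(q, q''), h.trans h'⟩ c
  horizontal_unit : ∀ (r : Ivl P) (p : Q),
    cell r ⟨(p, p), le_rfl⟩ = LWSquare.hUnit φp φm (cell r ⟨(p, p), le_rfl⟩).left
  vertical_unit : ∀ (c : Ivl Q) (q : P),
    cell ⟨(q, q), le_rfl⟩ c = LWSquare.vUnit φp φm (cell ⟨(q, q), le_rfl⟩ c).top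

section Nerve

variable {G : Type*} {Hp Hm : Type u} [Group G] [Group Hp] [Group Hm]
  (φp : Hp →* G) (φm : Hm →* G)

/-- Restriction of grids along monotone maps. -/
def Grid.comap {φp : Hp →* G} {φm : Hm →* G} {P Q P' Q' : Type} [Preorder P] [Preorder Q]
    [Preorder P'] [Preorder Q'] (f : P' →o P) (g : Q' →o Q) (x : Grid φp φm P Q) :
    Grid φp φm P' Q' where
  cell r c := x.cell (r.map f) (c.map g)
  horizontal r _ _ _ h h' := x.horizontal (r.map f) _ _ _ (g.monotone h) (g.monotone h')
  vertical c _ _ _ h h' := x.vertical (c.map g) _ _ _ (f.monotone h) (f.monotone h')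
  horizontal_unit r p := x.horizontal_unit (r.map f) (g p)
  vertical_unit c q := x.vertical_unit (c.map g) (f q)

/-- The bisimplicial nerve `Γ_{j,i}` of the double group `Γ` (`j` the vertical direction). -/
def doubleNerve : SimplexCategoryᵒᵖ × SimplexCategoryᵒᵖ ⥤ Type u where
  obj n := Grid φp φm (Fin (n.1.unop.len + 1)) (Fin (n.2.unop.len + 1))
  map f := TypeCat.ofHom (Grid.comap f.1.unop.toOrderHom f.2.unop.toOrderHom)

/-- The Artin–Mazur codiagonal `Γ̄` of the double group `Γ`. -/
abbrev GammaBar : SSet.{u} := codiagonal (doubleNerve φp φm)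

variable {φp φm}

/-- The index set of the entries of an `n`-simplex of `Γ̄`. -/
abbrev EntryIdx (n : ℕ) : Type :=
  Σ k : Fin (n + 1), Ivl (Fin ((k : ℕ) + 1)) × Ivl (Fin (n - (k : ℕ) + 1))

/-- The entries, elements of `Γ`, of an `n`-simplex `(x_0, …, x_n)` of `Γ̄`. -/
def entry (n : ℕ) (i : EntryIdx n) (x : (GammaBar φp φm).obj (op ⦋n⦌)) : LWSquare φp φm :=
  Grid.cell (φp := φp) (φm := φm) (x.1 i.1) i.2.1 i.2.2

/-- The identification `Γ̄_1 = Γ_{0,1} × Γ_{1,0} → H₋ × H₊`. -/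
def level1 (x : (GammaBar φp φm).obj (op ⦋1⦌)) : Hm × Hp :=
  ((entry 1 ⟨0, ⟨(0, 0), le_rfl⟩, ⟨((0 : Fin 2), (1 : Fin 2)), by decide⟩⟩ x).top,
    (entry 1 ⟨1, ⟨((0 : Fin 2), (1 : Fin 2)), by decide⟩, ⟨(0, 0), le_rfl⟩⟩ x).left)

/-- The identification `Γ̄_2 → H₋ × Γ × H₊`: a `2`-simplex `(x_0, x_1, x_2)` with
`x_0 = (a₃, a₂) ∈ Γ_{0,2} = H₋ × H₋`, `x_1 = ξ ∈ Γ_{1,1} = Γ` and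
`x_2 = (h₂, h₁) ∈ Γ_{2,0} = H₊ × H₊` is sent to `(a₃, ξ, h₁)`. -/
def level2 (x : (GammaBar φp φm).obj (op ⦋2⦌)) : Hm × LWSquare φp φm × Hp :=
  ((entry 2 ⟨0, ⟨(0, 0), le_rfl⟩, ⟨((0 : Fin 3), (1 : Fin 3)), by decide⟩⟩ x).top,
    entry 2 ⟨1, ⟨((0 : Fin 2), (1 : Fin 2)), by decide⟩,
      ⟨((0 : Fin 2), (1 : Fin 2)), by decide⟩⟩ x,
    (entry 2 ⟨2, ⟨((1 : Fin 3), (2 : Fin 3)), by decide⟩, ⟨(0, 0), le_rfl⟩⟩ x).left)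

end Nerve

/-! ### The symplectic form of `Γ` -/

section MaurerCartan

variable {E H : Type*} [NormedAddCommGroup E] [NormedSpace ℝ E]
  [TopologicalSpace H] [ChartedSpace E H] [Group H]

/-- The left Maurer–Cartan form `θ^l_g(w) = T L_{g⁻¹} w`. -/
def thetaL (g : H) : TangentSpace 𝓘(ℝ, E) g →L[ℝ] GroupLieAlgebra 𝓘(ℝ, E) H :=
  (mfderiv 𝓘(ℝ, E) 𝓘(ℝ, E) (fun x : H => g⁻¹ * x) g : E →L[ℝ] E)

/-- The right Maurer–Cartan form `θ^r_g(w) = T R_{g⁻¹} w`. -/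
def thetaR (g : H) : TangentSpace 𝓘(ℝ, E) g →L[ℝ] GroupLieAlgebra 𝓘(ℝ, E) H :=
  (mfderiv 𝓘(ℝ, E) 𝓘(ℝ, E) (fun x : H => x * g⁻¹) g : E →L[ℝ] E)

end MaurerCartan

/-- The `2`-form `(v, w) ↦ β(a v, b w) - β(a w, b v)`. -/
def wedge {V A B : Type*} [NormedAddCommGroup V] [NormedSpace ℝ V] [NormedAddCommGroup A]
    [NormedSpace ℝ A] [NormedAddCommGroup B] [NormedSpace ℝ B] (β : A →L[ℝ] B →L[ℝ] ℝ)
    (a : V →L[ℝ] A) (b : V →L[ℝ] B) : V [⋀^Fin 2]→L[ℝ] ℝ where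
  toFun m := β (a (m 0)) (b (m 1)) - β (a (m 1)) (b (m 0))
  map_update_add' m i x y := by
    fin_cases i <;> simp [Function.update] <;> ring
  map_update_smul' m i c x := by
    fin_cases i <;> simp [Function.update] <;> ring
  cont := by fun_prop
  map_eq_zero_of_eq' m i j h hij := by
    fin_cases i <;> fin_cases j <;> simp_all

section Omega

variable {𝔤 : Type*} [LieRing 𝔤] [LieAlgebra ℝ 𝔤] {T : ManinTriple 𝔤}
  {EG G : Type*} [NormedAddCommGroup EG] [NormedSpace ℝ EG] [CompleteSpace EG]
  [TopologicalSpace G] [ChartedSpace EG G] [Group G] [LieGroup 𝓘(ℝ, EG) ∞ G]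
  {Ep Em : Type v} {Hp Hm : Type u}
  [NormedAddCommGroup Ep] [NormedSpace ℝ Ep] [FiniteDimensional ℝ Ep] [CompleteSpace Ep]
  [TopologicalSpace Hp] [ChartedSpace Ep Hp] [Group Hp] [LieGroup 𝓘(ℝ, Ep) ∞ Hp]
  [NormedAddCommGroup Em] [NormedSpace ℝ Em] [FiniteDimensional ℝ Em] [CompleteSpace Em]
  [TopologicalSpace Hm] [ChartedSpace Em Hm] [Group Hm] [LieGroup 𝓘(ℝ, Em) ∞ Hm]
  (D : Integration T EG G Ep Hp Em Hm)

/-- The pairing of `𝔤` restricted to `𝔥₊ × 𝔥₋`, on the Lie algebras of `H₊` and `H₋`. -/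
def Integration.pairLie :
    GroupLieAlgebra 𝓘(ℝ, Ep) Hp →ₗ[ℝ] GroupLieAlgebra 𝓘(ℝ, Em) Hm →ₗ[ℝ] ℝ :=
  LinearMap.mk₂ ℝ (fun x y => T.pairing (D.lieP x : 𝔤) (D.lieM y : 𝔤))
    (by intros; simp) (by intros; simp) (by intros; simp) (by intros; simp)

/-- The same pairing, as a continuous bilinear map. -/
def Integration.pair : Ep →L[ℝ] Em →L[ℝ] ℝ :=
  LinearMap.toContinuousLinearMap
    ((LinearMap.toContinuousLinearMap : (Em →ₗ[ℝ] ℝ) ≃ₗ[ℝ] (Em →L[ℝ] ℝ)).toLinearMap ∘ₗ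
      (D.pairLie : Ep →ₗ[ℝ] Em →ₗ[ℝ] ℝ))

/-- The form `⟨(t^h)^*θ^l_{H₊}, (s^v)^*θ^r_{H₋}⟩ - ⟨(t^v)^*θ^l_{H₋}, (s^h)^*θ^r_{H₊}⟩` on `Γ`. -/
def omegaGamma (MΓ : ManifoldStr (LWSquare D.φp D.φm)) : DForm MΓ 2 := fun ξ =>
  wedge (V := MΓ.E) D.pair
      ((thetaL (E := Ep) (MΓ.mapTo LWSquare.left ξ)).comp (MΓ.dTo Ep LWSquare.left ξ))
      ((thetaR (E := Em) (MΓ.mapTo LWSquare.bottom ξ)).comp (MΓ.dTo Em LWSquare.bottom ξ)) -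
    wedge (V := MΓ.E) D.pair.flip
      ((thetaL (E := Em) (MΓ.mapTo LWSquare.top ξ)).comp (MΓ.dTo Em LWSquare.top ξ))
      ((thetaR (E := Ep) (MΓ.mapTo LWSquare.right ξ)).comp (MΓ.dTo Ep LWSquare.right ξ))

/-- The form `ω̄ = pr_Γ^* ω` on `Γ̄_2 = H₋ × Γ × H₊`, as a form on the simplicial manifold `Γ̄` with
a single component. -/
def omegaBar (MΓ : ManifoldStr (LWSquare D.φp D.φm))
    (S : SimplicialManifold (GammaBar D.φp D.φm)) : S.BiForm :=
  S.single22 (DForm.pullback ((S.lvl 2).mapOf MΓ fun x => (level2 x).2.1) (omegaGamma D MΓ))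

/-- An element of `𝔥₋ ⊕ 𝔥₊` as a tangent vector of `H₋ × H₊` at the identity. -/
def Integration.toTangent (w : T.minus × T.plus) : Em × Ep :=
  ((D.lieM.symm w.1 : GroupLieAlgebra 𝓘(ℝ, Em) Hm), (D.lieP.symm w.2 : GroupLieAlgebra 𝓘(ℝ, Ep) Hp))

end Omega

end ManinCodiagonal

end

open ManinCodiagonal

/-!
Read an `n`-simplex of `Γ̄` through its edges `y i j ∈ H₋ × H₊`, `i ≤ j`, and let
`g i j = φ₋(y i j) φ₊(y i j)` be their images under the multiplication map `mulMap : H₋ × H₊ → G`.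
The defining relation of `Γ` says precisely that `g i j * g j k = g i k`. So `Γ̄_n` is the set of
families `y` which the multiplication map sends to a `G`-valued cocycle (`edge_isCocycle`,
`edge_injective`, `exists_edge_eq`), the simplicial operators reindex the vertices (`edge_map`), and
the entries of the simplex are recovered from differences of edges (`cell_eq_square`).

*Manifolds.* As `𝔤 = 𝔥₋ ⊕ 𝔥₊`, the multiplication map is a local diffeomorphism
(`IsLocalDouble`, `Integration.isLocalDouble`). The `n` edges ending at the last vertex are free and
determine the remaining `g i j`, so that `Γ̄_n` is the space of lifts through the multiplication map
of a smooth map on `(H₋ × H₊) ^ n`. Such a space is étale over its base (`IsLiftSpace`), which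
gives the manifold structure and reduces smoothness of maps and vanishing of tangent vectors to
statements about edges; similarly for `Γ` over `H₊ × H₋`.

*Horns.* In dimension at least three a horn contains all edges, and those at its vertex `j` trivialize
the cocycle, so that there is a unique filler (`hornProj_bijective`). In dimension two the
horn prescribes two edges of a triangle, and the third `g i j` is determined; the horn projection is
a local diffeomorphism by the inverse function theorem (`isSubmersionAt_hornProj_one`). In dimension
one its target is a point.

*The form.* For maps `f, g` to `G` let `pwForm f g = ⟨f^* θ^l, g^* θ^r⟩`. By `Ad`-invariance of the
pairing, which follows from `ad`-invariance as `G` is connected (`pairing_adj`), it is a cocycle on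
the group of maps to `G` (`pwForm_cocycle`, the Polyakov–Wiegmann identity). On the triangle
`i < j < k`, the pullback of `ω` is `pwForm (g i j) (g j k)` up to the coboundary of
`⟨m^* θ^l, p^* θ^r⟩`, for `y = (m, p)` (`Integration.squareForm_eq`), whence `δ ω̄ = 0`. The
Maurer–Cartan equation expresses the exterior derivative of `pwForm f g` by the pullbacks of the
Cartan `3`-form along `f`, `g` and `f g`. The Cartan form vanishes on the isotropic subgroups `H₊`
and `H₋`, and the two summands of `ω` are the forms of two factorizations of the same map; so their
derivatives agree (`extDeriv_pwForm_sub`) and `d ω̄ = 0`. On a degenerate triangle, in each summand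
one of the two sides is constant, so that `ω̄` is normalized.

*Non-degeneracy.* All edges of a simplex of dimension at least two ending at the last vertex lie in
a face other than the last one, so the tangent complex is concentrated in degree one
(`tangentCx_add_two`). There the IM-form is twice the pairing of `𝔤 = 𝔥₋ ⊕ 𝔥₊`
(`Integration.imForm_one_one`), which is non-degenerate.
-/


open CategoryTheory Opposite Simplicial Manifold
open scoped ContDiff Topology

noncomputable section

namespace ManinCodiagonal

set_option linter.unusedSectionVars false

/-! ### Logarithmic derivatives of maps into a Lie group -/

section TangentMap

variable {EX X EY Y EZ Z : Type*}
  [NormedAddCommGroup EX] [NormedSpace ℝ EX] [TopologicalSpace X] [ChartedSpace EX X]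
  [NormedAddCommGroup EY] [NormedSpace ℝ EY] [TopologicalSpace Y] [ChartedSpace EY Y]
  [NormedAddCommGroup EZ] [NormedSpace ℝ EZ] [TopologicalSpace Z] [ChartedSpace EZ Z]

variable (EX EY) in
/-- The differential of `f : X → Y` at `x`, as a map between the model spaces. -/
def tder (f : X → Y) (x : X) : EX →L[ℝ] EY := mfderiv 𝓘(ℝ, EX) 𝓘(ℝ, EY) f x

theorem tder_comp {g : Y → Z} {f : X → Y} {x : X} {y : Y} (hy : f x = y)
    (hg : MDifferentiableAt 𝓘(ℝ, EY) 𝓘(ℝ, EZ) g y)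
    (hf : MDifferentiableAt 𝓘(ℝ, EX) 𝓘(ℝ, EY) f x) :
    tder EX EZ (fun z => g (f z)) x = (tder EY EZ g y).comp (tder EX EY f x) := by
  subst hy
  exact mfderiv_comp x hg hf

theorem tder_const (c : Y) (x : X) : tder EX EY (fun _ : X => c) x = 0 := mfderiv_const

theorem tder_id (x : X) : tder EX EX (fun z : X => z) x = ContinuousLinearMap.id ℝ EX :=
  mfderiv_id

theorem tder_congr {f g : X → Y} {x : X} (h : f =ᶠ[𝓝 x] g) :
    tder EX EY f x = tder EX EY g x :=
  h.mfderiv_eq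

theorem tder_eq_fderiv (f : EX → EY) (x : EX) : tder EX EY f x = fderiv ℝ f x := mfderiv_eq_fderiv

/-- The differential is computed in the preferred charts. -/
theorem tder_eq_fderiv_extChartAt {f : EX → Y} {x : EX} {y : Y} (hy : f x = y)
    (hf : MDifferentiableAt 𝓘(ℝ, EX) 𝓘(ℝ, EY) f x) :
    tder EX EY f x = fderiv ℝ (fun z => extChartAt 𝓘(ℝ, EY) y (f z)) x := by
  subst hy
  rw [tder, hf.mfderiv]
  simp only [writtenInExtChartAt, extChartAt_model_space_eq_id, PartialEquiv.refl_symm,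
    PartialEquiv.refl_coe, modelWithCornersSelf_coe, Set.range_id, fderivWithin_univ, id]
  rfl

end TangentMap

section LieGroup

variable {EX X EY Y EG G EH H : Type*}
  [NormedAddCommGroup EX] [NormedSpace ℝ EX] [TopologicalSpace X] [ChartedSpace EX X]
  [NormedAddCommGroup EY] [NormedSpace ℝ EY] [TopologicalSpace Y] [ChartedSpace EY Y]
  [NormedAddCommGroup EG] [NormedSpace ℝ EG] [TopologicalSpace G] [ChartedSpace EG G]
  [Group G] [LieGroup 𝓘(ℝ, EG) ∞ G]
  [NormedAddCommGroup EH] [NormedSpace ℝ EH] [TopologicalSpace H] [ChartedSpace EH H]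
  [Group H] [LieGroup 𝓘(ℝ, EH) ∞ H]

variable (EX EG) in
/-- The pullback `f^* θ^l` of the left Maurer–Cartan form: the differential at `x` of
`z ↦ f(x)⁻¹ f(z)`. -/
def lLog (f : X → G) (x : X) : EX →L[ℝ] EG := tder EX EG (fun z => (f x)⁻¹ * f z) x

variable (EX EG) in
/-- The pullback `f^* θ^r` of the right Maurer–Cartan form: the differential at `x` of
`z ↦ f(z) f(x)⁻¹`. -/
def rLog (f : X → G) (x : X) : EX →L[ℝ] EG := tder EX EG (fun z => f z * (f x)⁻¹) x

variable (EG) in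
/-- The adjoint action on the model space of `G`, regarded as the tangent space at `1`. -/
def adj (g : G) : EG →L[ℝ] EG := tder EG EG (fun x : G => g * x * g⁻¹) 1

variable {f g : X → G} {x : X}

theorem mdiffAt_mul_left (a x : G) :
    MDifferentiableAt 𝓘(ℝ, EG) 𝓘(ℝ, EG) (fun y : G => a * y) x :=
  (contMDiff_mul_left (I := 𝓘(ℝ, EG)) (n := ∞)).contMDiffAt.mdifferentiableAt (by simp)

theorem mdiffAt_mul_right (a x : G) :
    MDifferentiableAt 𝓘(ℝ, EG) 𝓘(ℝ, EG) (fun y : G => y * a) x :=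
  (contMDiff_mul_right (I := 𝓘(ℝ, EG)) (n := ∞)).contMDiffAt.mdifferentiableAt (by simp)

theorem mdiffAt_conj (a x : G) :
    MDifferentiableAt 𝓘(ℝ, EG) 𝓘(ℝ, EG) (fun y : G => a * y * a⁻¹) x :=
  MDifferentiableAt.comp (g := fun y : G => y * a⁻¹) x
    (mdiffAt_mul_right _ _) (mdiffAt_mul_left a x)

theorem mdiffAt_mul (hf : MDifferentiableAt 𝓘(ℝ, EX) 𝓘(ℝ, EG) f x)
    (hg : MDifferentiableAt 𝓘(ℝ, EX) 𝓘(ℝ, EG) g x) :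
    MDifferentiableAt 𝓘(ℝ, EX) 𝓘(ℝ, EG) (fun z => f z * g z) x :=
  MDifferentiableAt.comp (g := fun p : G × G => p.1 * p.2) x
    ((contMDiff_mul 𝓘(ℝ, EG) ∞).contMDiffAt.mdifferentiableAt (by simp)) (hf.prodMk hg)

theorem mdiffAt_inv (hf : MDifferentiableAt 𝓘(ℝ, EX) 𝓘(ℝ, EG) f x) :
    MDifferentiableAt 𝓘(ℝ, EX) 𝓘(ℝ, EG) (fun z => (f z)⁻¹) x :=
  MDifferentiableAt.comp (g := fun p : G => p⁻¹) x
    ((contMDiff_inv 𝓘(ℝ, EG) ∞).contMDiffAt.mdifferentiableAt (by simp)) hf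

/-- The Leibniz rule at a point where both factors are `1`, the case to which all others are reduced
by translation. -/
theorem tder_mul_of_eq_one (hf : MDifferentiableAt 𝓘(ℝ, EX) 𝓘(ℝ, EG) f x)
    (hg : MDifferentiableAt 𝓘(ℝ, EX) 𝓘(ℝ, EG) g x) (hfx : f x = 1) (hgx : g x = 1) :
    tder EX EG (fun z => f z * g z) x = tder EX EG f x + tder EX EG g x := by
  have hm : MDifferentiableAt (𝓘(ℝ, EG).prod 𝓘(ℝ, EG)) 𝓘(ℝ, EG)
      (fun p : G × G => p.1 * p.2) (f x, g x) :=
    (contMDiff_mul 𝓘(ℝ, EG) ∞).contMDiffAt.mdifferentiableAt (by simp)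
  have h1 := mfderiv_comp (g := fun p : G × G => p.1 * p.2) x hm (hf.prodMk hg)
  have h2 := hf.mfderiv_prod hg
  ext v
  have h3 := congrArg (fun L => L v) h1
  have h4 : mfderiv 𝓘(ℝ, EX) (𝓘(ℝ, EG).prod 𝓘(ℝ, EG)) (fun z => (f z, g z)) x v =
    (mfderiv 𝓘(ℝ, EX) 𝓘(ℝ, EG) f x v, mfderiv 𝓘(ℝ, EX) 𝓘(ℝ, EG) g x v) := by
      rw [h2]; rfl
  refine h3.trans ?_
  change mfderiv (𝓘(ℝ, EG).prod 𝓘(ℝ, EG)) 𝓘(ℝ, EG) (fun p : G × G => p.1 * p.2) (f x, g x)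
    (mfderiv 𝓘(ℝ, EX) (𝓘(ℝ, EG).prod 𝓘(ℝ, EG)) (fun z => (f z, g z)) x v) = _
  rw [h4]
  refine (mfderiv_prod_eq_add_apply hm).trans ?_
  have e1 : (fun z : G => z * g x) = id := by ext z; simp [hgx]
  have e2 : (fun z : G => f x * z) = id := by ext z; simp [hfx]
  change mfderiv 𝓘(ℝ, EG) 𝓘(ℝ, EG) (fun z : G => z * g x) (f x) _ +
    mfderiv 𝓘(ℝ, EG) 𝓘(ℝ, EG) (fun z : G => f x * z) (g x) _ = _
  rw [e1, e2, mfderiv_id, mfderiv_id]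
  rfl

theorem thetaL_comp_tder (hf : MDifferentiableAt 𝓘(ℝ, EX) 𝓘(ℝ, EG) f x) :
    (thetaL (E := EG) (f x)).comp (tder EX EG f x) = lLog EX EG f x :=
  (tder_comp (g := fun y => (f x)⁻¹ * y) rfl (mdiffAt_mul_left _ _) hf).symm

theorem thetaR_comp_tder (hf : MDifferentiableAt 𝓘(ℝ, EX) 𝓘(ℝ, EG) f x) :
    (thetaR (E := EG) (f x)).comp (tder EX EG f x) = rLog EX EG f x :=
  (tder_comp (g := fun y => y * (f x)⁻¹) rfl (mdiffAt_mul_right _ _) hf).symm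

theorem lLog_apply (hf : MDifferentiableAt 𝓘(ℝ, EX) 𝓘(ℝ, EG) f x) (v : EX) :
    lLog EX EG f x v = tder EG EG (fun y => (f x)⁻¹ * y) (f x) (tder EX EG f x v) :=
  congrArg (fun L : EX →L[ℝ] EG => L v) (thetaL_comp_tder hf).symm

theorem lLog_eq_zero_iff (hf : MDifferentiableAt 𝓘(ℝ, EX) 𝓘(ℝ, EG) f x) {v : EX} :
    lLog EX EG f x v = 0 ↔ tder EX EG f x v = 0 := by
  have h1 : tder EX EG f x v = tder EG EG (fun y => f x * y) 1 (lLog EX EG f x v) := by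
    have h2 := tder_comp (EX := EX) (EY := EG) (EZ := EG) (g := fun y => f x * y)
      (f := fun z => (f x)⁻¹ * f z) (inv_mul_cancel (f x)) (mdiffAt_mul_left _ _)
      (mdiffAt_mul mdifferentiableAt_const hf)
    simp only [mul_inv_cancel_left] at h2
    exact congrArg (fun L : EX →L[ℝ] EG => L v) h2
  refine ⟨fun h => ?_, fun h => ?_⟩
  · rw [h1, h]
    exact ContinuousLinearMap.map_zero _
  · rw [lLog_apply hf, h]
    exact ContinuousLinearMap.map_zero _

/-- The pullback of the left Maurer–Cartan form along a product: `(f g)^* θ^l = Ad(g⁻¹) f^* θ^l +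
g^* θ^l`. -/
theorem lLog_mul (hf : MDifferentiableAt 𝓘(ℝ, EX) 𝓘(ℝ, EG) f x)
    (hg : MDifferentiableAt 𝓘(ℝ, EX) 𝓘(ℝ, EG) g x) :
    lLog EX EG (fun z => f z * g z) x =
      (adj EG (g x)⁻¹).comp (lLog EX EG f x) + lLog EX EG g x := by
  have h1 : MDifferentiableAt 𝓘(ℝ, EX) 𝓘(ℝ, EG) (fun z => (f x)⁻¹ * f z) x :=
    mdiffAt_mul mdifferentiableAt_const hf
  have h2 : MDifferentiableAt 𝓘(ℝ, EX) 𝓘(ℝ, EG) (fun z => (g x)⁻¹ * g z) x :=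
    mdiffAt_mul mdifferentiableAt_const hg
  have h3 := tder_comp (EX := EX) (EY := EG) (EZ := EG) (g := fun y => (g x)⁻¹ * y * (g x)⁻¹⁻¹)
    (f := fun z => (f x)⁻¹ * f z) (inv_mul_cancel (f x)) (mdiffAt_conj _ _) h1
  rw [lLog, lLog, lLog, adj, ← h3, ← tder_mul_of_eq_one _ h2 (by simp) (by simp)]
  · congr 1
    ext z
    group
  · exact MDifferentiableAt.comp (g := fun y => (g x)⁻¹ * y * (g x)⁻¹⁻¹) x (mdiffAt_conj _ _) h1

theorem rLog_eq_adj_lLog (hf : MDifferentiableAt 𝓘(ℝ, EX) 𝓘(ℝ, EG) f x) :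
    rLog EX EG f x = (adj EG (f x)).comp (lLog EX EG f x) := by
  have h1 : MDifferentiableAt 𝓘(ℝ, EX) 𝓘(ℝ, EG) (fun z => (f x)⁻¹ * f z) x :=
    mdiffAt_mul mdifferentiableAt_const hf
  have h3 := tder_comp (EX := EX) (EY := EG) (EZ := EG) (g := fun y => f x * y * (f x)⁻¹)
    (f := fun z => (f x)⁻¹ * f z) (inv_mul_cancel (f x)) (mdiffAt_conj _ _) h1
  rw [lLog, rLog, adj, ← h3]
  congr 1
  ext z
  group

theorem rLog_mul (hf : MDifferentiableAt 𝓘(ℝ, EX) 𝓘(ℝ, EG) f x)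
    (hg : MDifferentiableAt 𝓘(ℝ, EX) 𝓘(ℝ, EG) g x) :
    rLog EX EG (fun z => f z * g z) x =
      rLog EX EG f x + (adj EG (f x)).comp (rLog EX EG g x) := by
  have h1 : MDifferentiableAt 𝓘(ℝ, EX) 𝓘(ℝ, EG) (fun z => f z * (f x)⁻¹) x :=
    mdiffAt_mul hf mdifferentiableAt_const
  have h2 : MDifferentiableAt 𝓘(ℝ, EX) 𝓘(ℝ, EG) (fun z => g z * (g x)⁻¹) x :=
    mdiffAt_mul hg mdifferentiableAt_const
  have h3 := tder_comp (EX := EX) (EY := EG) (EZ := EG) (g := fun y => f x * y * (f x)⁻¹)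
    (f := fun z => g z * (g x)⁻¹) (mul_inv_cancel (g x)) (mdiffAt_conj _ _) h2
  rw [rLog, rLog, rLog, adj, ← h3, ← tder_mul_of_eq_one h1 _ (by simp) (by simp)]
  · congr 1
    ext z
    group
  · exact MDifferentiableAt.comp (g := fun y => f x * y * (f x)⁻¹) x (mdiffAt_conj _ _) h2

theorem adj_one : adj EG (1 : G) = ContinuousLinearMap.id ℝ EG := by
  rw [adj, ← tder_id (1 : G)]
  congr 1
  ext z
  simp

theorem adj_mul (a b : G) : adj EG (a * b) = (adj EG a).comp (adj EG b) := by
  rw [adj, adj, adj, ← tder_comp (g := fun y => a * y * a⁻¹) (by simp)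
    (mdiffAt_conj _ _) (mdiffAt_conj _ _)]
  congr 1
  ext z
  group

theorem adj_inv_adj (a : G) (v : EG) : adj EG a⁻¹ (adj EG a v) = v := by
  rw [← ContinuousLinearMap.comp_apply, ← adj_mul, inv_mul_cancel, adj_one]
  rfl

theorem adj_adj_inv (a : G) (v : EG) : adj EG a (adj EG a⁻¹ v) = v := by
  rw [← ContinuousLinearMap.comp_apply, ← adj_mul, mul_inv_cancel, adj_one]
  rfl

theorem lLog_const (c : G) : lLog EX EG (fun _ : X => c) x = 0 := tder_const _ _

theorem rLog_const (c : G) : rLog EX EG (fun _ : X => c) x = 0 := tder_const _ _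

theorem lLog_const_mul (c : G) : lLog EX EG (fun z => c * f z) x = lLog EX EG f x := by
  simp only [lLog, mul_inv_rev, mul_assoc, inv_mul_cancel_left]

theorem lLog_congr (h : f =ᶠ[𝓝 x] g) : lLog EX EG f x = lLog EX EG g x := by
  rw [lLog, lLog, h.eq_of_nhds]
  exact tder_congr (h.mono fun z hz => by simp only [hz])

theorem rLog_eq_neg_lLog_inv (hf : MDifferentiableAt 𝓘(ℝ, EX) 𝓘(ℝ, EG) f x) :
    rLog EX EG f x = -lLog EX EG (fun z => (f z)⁻¹) x := by
  rw [eq_neg_iff_add_eq_zero, rLog, lLog, ← tder_mul_of_eq_one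
    (mdiffAt_mul hf mdifferentiableAt_const)
    (mdiffAt_mul mdifferentiableAt_const (mdiffAt_inv hf)) (by simp) (by simp)]
  rw [← tder_const (EX := EX) (EY := EG) (1 : G) x]
  congr 1
  ext z
  simp

theorem lLog_comp {k : Y → G} {f : X → Y} {x : X} {y : Y} (hy : f x = y)
    (hk : MDifferentiableAt 𝓘(ℝ, EY) 𝓘(ℝ, EG) k y)
    (hf : MDifferentiableAt 𝓘(ℝ, EX) 𝓘(ℝ, EY) f x) :
    lLog EX EG (fun z => k (f z)) x = (lLog EY EG k y).comp (tder EX EY f x) := by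
  rw [lLog, lLog, ← tder_comp (g := fun z => (k y)⁻¹ * k z) hy
    (mdiffAt_mul mdifferentiableAt_const hk) hf, hy]

theorem rLog_comp {k : Y → G} {f : X → Y} {x : X} {y : Y} (hy : f x = y)
    (hk : MDifferentiableAt 𝓘(ℝ, EY) 𝓘(ℝ, EG) k y)
    (hf : MDifferentiableAt 𝓘(ℝ, EX) 𝓘(ℝ, EY) f x) :
    rLog EX EG (fun z => k (f z)) x = (rLog EY EG k y).comp (tder EX EY f x) := by
  rw [rLog, rLog, ← tder_comp (g := fun z => k z * (k y)⁻¹) hy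
    (mdiffAt_mul hk mdifferentiableAt_const) hf, hy]

theorem lLog_hom (φ : H →* G) (hφ : MDifferentiableAt 𝓘(ℝ, EH) 𝓘(ℝ, EG) φ 1) {f : X → H}
    (hf : MDifferentiableAt 𝓘(ℝ, EX) 𝓘(ℝ, EH) f x) :
    lLog EX EG (fun z => φ (f z)) x = (tder EH EG φ 1).comp (lLog EX EH f x) := by
  rw [lLog, lLog, ← tder_comp (g := φ) (by simp) hφ (mdiffAt_mul mdifferentiableAt_const hf)]
  simp only [map_mul, map_inv]

theorem rLog_hom (φ : H →* G) (hφ : MDifferentiableAt 𝓘(ℝ, EH) 𝓘(ℝ, EG) φ 1) {f : X → H}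
    (hf : MDifferentiableAt 𝓘(ℝ, EX) 𝓘(ℝ, EH) f x) :
    rLog EX EG (fun z => φ (f z)) x = (tder EH EG φ 1).comp (rLog EX EH f x) := by
  rw [rLog, rLog, ← tder_comp (g := φ) (by simp) hφ (mdiffAt_mul hf mdifferentiableAt_const)]
  simp only [map_mul, map_inv]

/-- The differential of a map to `G` at a point sent to `1` is its logarithmic derivative. -/
theorem lLog_of_eq_one (h : f x = 1) : lLog EX EG f x = tder EX EG f x := by
  simp [lLog, h]

theorem rLog_of_eq_one (h : f x = 1) : rLog EX EG f x = tder EX EG f x := by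
  simp [rLog, h]

end LieGroup

/-! ### The Maurer–Cartan equation -/

section MaurerCartanEquation

variable {E EG G : Type*} [NormedAddCommGroup E] [NormedSpace ℝ E]
  [NormedAddCommGroup EG] [NormedSpace ℝ EG] [TopologicalSpace G] [ChartedSpace EG G]
  [Group G] [LieGroup 𝓘(ℝ, EG) ∞ G]

/-- Being smooth near `z₀`: for `C^∞` this is stronger than `ContMDiffAt` at `z₀`, which only gives
neighbourhoods that depend on the order of differentiability. -/
def SmoothNear (f : E → G) (z₀ : E) : Prop := ∀ᶠ z in 𝓝 z₀, ContMDiffAt 𝓘(ℝ, E) 𝓘(ℝ, EG) ∞ f z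

theorem SmoothNear.mdiffAt {f : E → G} {z₀ : E} (h : SmoothNear (EG := EG) f z₀) :
    MDifferentiableAt 𝓘(ℝ, E) 𝓘(ℝ, EG) f z₀ :=
  h.self_of_nhds.mdifferentiableAt (by simp)

theorem SmoothNear.eventually_mdiffAt {f : E → G} {z₀ : E} (h : SmoothNear (EG := EG) f z₀) :
    ∀ᶠ z in 𝓝 z₀, MDifferentiableAt 𝓘(ℝ, E) 𝓘(ℝ, EG) f z :=
  h.mono fun _ hz => hz.mdifferentiableAt (by simp)

theorem SmoothNear.mul {f g : E → G} {z₀ : E} (hf : SmoothNear (EG := EG) f z₀)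
    (hg : SmoothNear (EG := EG) g z₀) : SmoothNear (EG := EG) (fun z => f z * g z) z₀ := by
  filter_upwards [hf, hg] with z h1 h2 using h1.mul h2

theorem SmoothNear.inv {f : E → G} {z₀ : E} (hf : SmoothNear (EG := EG) f z₀) :
    SmoothNear (EG := EG) (fun z => (f z)⁻¹) z₀ := by
  filter_upwards [hf] with z h1 using h1.inv

theorem smoothNear_const (c : G) (z₀ : E) : SmoothNear (EG := EG) (fun _ => c) z₀ :=
  Filter.Eventually.of_forall fun _ => contMDiffAt_const

/-- In the chart at `1`, the form `f^* θ^l` at `z` is the partial derivative at `z' = z` of the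
smooth map `(z, z') ↦ (f z)⁻¹ f z'`. -/
theorem contDiffAt_lLog {f : E → G} {z₀ : E} (hf : SmoothNear (EG := EG) f z₀) :
    ContDiffAt ℝ ∞ (lLog E EG f) z₀ := by
  have hF : ContDiffAt ℝ ∞ (Function.uncurry fun z z' : E =>
      extChartAt 𝓘(ℝ, EG) (1 : G) ((f z)⁻¹ * f z')) (z₀, z₀) := by
    rw [← contMDiffAt_iff_contDiffAt]
    have h1 : ContMDiffAt 𝓘(ℝ, E × E) 𝓘(ℝ, EG) ∞ (fun p : E × E => f p.1) (z₀, z₀) :=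
      ContMDiffAt.comp (g := f) (f := Prod.fst) (z₀, z₀) hf.self_of_nhds contDiffAt_fst.contMDiffAt
    have h2 : ContMDiffAt 𝓘(ℝ, E × E) 𝓘(ℝ, EG) ∞ (fun p : E × E => f p.2) (z₀, z₀) :=
      ContMDiffAt.comp (g := f) (f := Prod.snd) (z₀, z₀) hf.self_of_nhds contDiffAt_snd.contMDiffAt
    have h3 : ContMDiffAt 𝓘(ℝ, E × E) 𝓘(ℝ, EG) ∞
        (fun p : E × E => (f p.1)⁻¹ * f p.2) (z₀, z₀) := h1.inv.mul h2
    refine ContMDiffAt.comp (g := extChartAt 𝓘(ℝ, EG) (1 : G)) (z₀, z₀) ?_ h3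
    simp only [inv_mul_cancel]
    exact contMDiffAt_extChartAt
  refine (ContDiffAt.fderiv (m := ∞) hF contDiffAt_id (by simp)).congr_of_eventuallyEq ?_
  filter_upwards [hf.eventually_mdiffAt] with z hz
  exact tder_eq_fderiv_extChartAt (by simp)
    (mdiffAt_mul mdifferentiableAt_const hz)

theorem contDiffAt_rLog {f : E → G} {z₀ : E} (hf : SmoothNear (EG := EG) f z₀) :
    ContDiffAt ℝ ∞ (rLog E EG f) z₀ := by
  refine (contDiffAt_lLog hf.inv).neg.congr_of_eventuallyEq ?_
  filter_upwards [hf.eventually_mdiffAt] with z hz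
  exact rLog_eq_neg_lLog_inv hz

variable (G) in
/-- The bracket of the Lie algebra of `G`, on the model space. -/
def brk (v w : EG) : EG :=
  Bracket.bracket (L := GroupLieAlgebra 𝓘(ℝ, EG) G) (M := GroupLieAlgebra 𝓘(ℝ, EG) G) v w

variable (EG G) in
/-- The inverse of the preferred chart at `1`, a parametrization of `G` near `1`. -/
def param : EG → G := (extChartAt 𝓘(ℝ, EG) (1 : G)).symm

variable (EG G) in
/-- The coordinates of `1` in the preferred chart at `1`. -/
def origin : EG := extChartAt 𝓘(ℝ, EG) (1 : G) 1

theorem param_origin : param EG G (origin EG G) = 1 := extChartAt_to_inv (I := 𝓘(ℝ, EG)) (1 : G)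

theorem smoothNear_param : SmoothNear (EG := EG) (param EG G) (origin EG G) := by
  filter_upwards [extChartAt_target_mem_nhds (I := 𝓘(ℝ, EG)) (1 : G)] with z hz
  exact (contMDiffOn_extChartAt_symm (n := ∞) (1 : G)).contMDiffAt
    ((isOpen_extChartAt_target (I := 𝓘(ℝ, EG)) (1 : G)).mem_nhds hz)

theorem eventually_extChartAt_param : ∀ᶠ z in 𝓝 (origin EG G),
    extChartAt 𝓘(ℝ, EG) (1 : G) (param EG G z) = z := by
  filter_upwards [extChartAt_target_mem_nhds (I := 𝓘(ℝ, EG)) (1 : G)] with z hz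
  exact (extChartAt 𝓘(ℝ, EG) (1 : G)).right_inv hz

theorem lLog_param_origin :
    lLog EG EG (param EG G) (origin EG G) = ContinuousLinearMap.id ℝ EG := by
  rw [lLog_of_eq_one param_origin, tder_eq_fderiv_extChartAt param_origin smoothNear_param.mdiffAt]
  rw [Filter.EventuallyEq.fderiv_eq (eventually_extChartAt_param (EG := EG) (G := G))]
  exact fderiv_fun_id

/-- The invariant vector field of `w`, in the chart at `1`. -/
theorem eventually_mpullback_invariant [CompleteSpace EG] (w : EG) :
    VectorField.mpullbackWithin 𝓘(ℝ, EG) 𝓘(ℝ, EG) (extChartAt 𝓘(ℝ, EG) (1 : G)).symm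
        (mulInvariantVectorField (I := 𝓘(ℝ, EG)) (G := G) w) (Set.range 𝓘(ℝ, EG))
      =ᶠ[𝓝 (origin EG G)] fun z => (lLog EG EG (param EG G) z).inverse w := by
  have h0 : ∀ᶠ z in 𝓝 (origin EG G), lLog EG EG (param EG G) z ∈
      Set.range ((↑) : (EG ≃L[ℝ] EG) → EG →L[ℝ] EG) := by
    refine (contDiffAt_lLog smoothNear_param).continuousAt.eventually ?_
    rw [lLog_param_origin]
    exact ContinuousLinearEquiv.nhds (ContinuousLinearEquiv.refl ℝ EG)
  filter_upwards [h0, smoothNear_param.eventually_mdiffAt,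
    extChartAt_target_mem_nhds (I := 𝓘(ℝ, EG)) (1 : G)] with z ⟨e, he⟩ hz hz'
  have h2 : mfderiv[Set.range 𝓘(ℝ, EG)] (extChartAt 𝓘(ℝ, EG) (1 : G)).symm z =
      tder EG EG (param EG G) z := by
    simp only [modelWithCornersSelf_coe, Set.range_id, mfderivWithin_univ]
    rfl
  obtain ⟨e', h3⟩ : ∃ e' : EG ≃L[ℝ] EG, tder EG EG (param EG G) z = (e' : EG →L[ℝ] EG) := by
    obtain ⟨e', he'⟩ := isInvertible_mfderivWithin_extChartAt_symm (I := 𝓘(ℝ, EG)) hz'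
    exact ⟨e', h2.symm.trans he'.symm⟩
  have h4 : VectorField.mpullbackWithin 𝓘(ℝ, EG) 𝓘(ℝ, EG) (extChartAt 𝓘(ℝ, EG) (1 : G)).symm
        (mulInvariantVectorField (I := 𝓘(ℝ, EG)) (G := G) w) (Set.range 𝓘(ℝ, EG)) z =
      e'.symm (tder EG EG (fun x : G => param EG G z * x) 1 w) := by
    rw [← ContinuousLinearEquiv.coe_coe e'.symm, ← ContinuousLinearMap.inverse_equiv, ← h3, ← h2]
    rfl
  rw [h4, ← he, ContinuousLinearMap.inverse_equiv, ContinuousLinearEquiv.coe_coe,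
    ContinuousLinearEquiv.eq_symm_apply, ← ContinuousLinearEquiv.coe_coe e, he,
    lLog_apply hz, h3, ContinuousLinearEquiv.coe_coe, ContinuousLinearEquiv.apply_symm_apply]
  have h5 := tder_comp (EX := EG) (EY := EG) (EZ := EG) (g := fun x => (param EG G z)⁻¹ * x)
    (f := fun x : G => param EG G z * x) (mul_one (param EG G z))
    (mdiffAt_mul_left _ _) (mdiffAt_mul_left _ _)
  simp only [inv_mul_cancel_left, tder_id] at h5
  exact (congrArg (fun L : EG →L[ℝ] EG => L w) h5).symm

/-- The Maurer–Cartan equation for the parametrization of `G` at `1`: the invariant vector field of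
`w` is `z ↦ (θ^l_z)⁻¹ w` in the chart, which gives the bracket in terms of the derivative of `θ^l`
at `1`, where `θ^l` is the identity. -/
theorem maurerCartan_param [CompleteSpace EG] (v w : EG) :
    fderiv ℝ (lLog EG EG (param EG G)) (origin EG G) v w -
      fderiv ℝ (lLog EG EG (param EG G)) (origin EG G) w v = -brk G v w := by
  set Θ := lLog EG EG (param EG G) with hΘ
  set c := origin EG G with hc
  have hΘc : ContDiffAt ℝ ∞ Θ c := contDiffAt_lLog smoothNear_param
  have hid : Θ c = ContinuousLinearMap.id ℝ EG := lLog_param_origin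
  have hinv : ContDiffAt ℝ ∞ (fun z => (Θ z).inverse) c := by
    refine ContDiffAt.comp (g := ContinuousLinearMap.inverse) c ?_ hΘc
    rw [hid]
    exact contDiffAt_map_inverse (ContinuousLinearEquiv.refl ℝ EG)
  have hinvc : (Θ c).inverse = ContinuousLinearMap.id ℝ EG := by
    rw [hid]
    exact ContinuousLinearMap.inverse_equiv (ContinuousLinearEquiv.refl ℝ EG)
  have hd (w : EG) : DifferentiableAt ℝ (fun z => (Θ z).inverse w) c :=
    (hinv.differentiableAt (by simp)).clm_apply (differentiableAt_const w)
  have h0 : ∀ᶠ z in 𝓝 c, Θ z ∈ Set.range ((↑) : (EG ≃L[ℝ] EG) → EG →L[ℝ] EG) := by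
    refine hΘc.continuousAt.eventually ?_
    rw [hid]
    exact ContinuousLinearEquiv.nhds (ContinuousLinearEquiv.refl ℝ EG)
  -- differentiate `θ^l (V_w) = w`
  have hder (v w : EG) : fderiv ℝ (fun z => (Θ z).inverse w) c v = -fderiv ℝ Θ c v w := by
    have h1 : (fun z => Θ z ((Θ z).inverse w)) =ᶠ[𝓝 c] fun _ => w := by
      filter_upwards [h0] with z ⟨e, he⟩
      rw [← he, ContinuousLinearMap.inverse_equiv]
      simp
    have h2 := h1.fderiv_eq (𝕜 := ℝ)
    rw [fderiv_clm_apply (hΘc.differentiableAt (by simp)) (hd w), fderiv_const_apply] at h2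
    have h3 := congrArg (fun L : EG →L[ℝ] EG => L v) h2
    simp [hid] at h3
    exact eq_neg_of_add_eq_zero_left h3
  have hbr : brk G v w = VectorField.lieBracket ℝ (fun z => (Θ z).inverse v)
      (fun z => (Θ z).inverse w) c := by
    have e1 : tder EG EG (extChartAt 𝓘(ℝ, EG) (1 : G)) 1 = ContinuousLinearMap.id ℝ EG :=
      mfderiv_extChartAt_self
    have e2 : (ContinuousLinearMap.id ℝ EG).inverse = ContinuousLinearMap.id ℝ EG :=
      ContinuousLinearMap.inverse_equiv (ContinuousLinearEquiv.refl ℝ EG)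
    have e3 : ((extChartAt 𝓘(ℝ, EG) (1 : G)).symm ⁻¹' Set.univ ∩ Set.range 𝓘(ℝ, EG)) =
      Set.univ := by simp
    change (tder EG EG (extChartAt 𝓘(ℝ, EG) (1 : G)) 1).inverse
      (VectorField.lieBracketWithin ℝ _ _
        ((extChartAt 𝓘(ℝ, EG) (1 : G)).symm ⁻¹' Set.univ ∩ Set.range 𝓘(ℝ, EG)) c) = _
    rw [e1, e2, e3]
    exact (congrFun VectorField.lieBracketWithin_univ c).trans
      ((eventually_mpullback_invariant v).lieBracket_vectorField_eq
      (eventually_mpullback_invariant w))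
  rw [hbr, VectorField.lieBracket, hder, hder, hinvc]
  simp only [ContinuousLinearMap.id_apply]
  abel

/-- The Maurer–Cartan equation `d(f^* θ^l)(v, w) = -[f^* θ^l v, f^* θ^l w]`. -/
theorem maurerCartan [CompleteSpace EG] {f : E → G} {z₀ : E} (hf : SmoothNear (EG := EG) f z₀)
    (v w : E) :
    fderiv ℝ (lLog E EG f) z₀ v w - fderiv ℝ (lLog E EG f) z₀ w v =
      -brk G (lLog E EG f z₀ v) (lLog E EG f z₀ w) := by
  -- by invariance of `θ^l` one may assume that `f z₀ = 1`
  wlog h1 : f z₀ = 1 generalizing f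
  · have h2 := this (f := fun z => (f z₀)⁻¹ * f z) ((smoothNear_const _ _).mul hf)
      (inv_mul_cancel _)
    have h3 : lLog E EG (fun z => (f z₀)⁻¹ * f z) = lLog E EG f :=
      funext fun z => lLog_const_mul _
    rwa [h3] at h2
  set Θ := lLog EG EG (param EG G) with hΘ
  set k : E → EG := fun z => extChartAt 𝓘(ℝ, EG) (1 : G) (f z) with hk
  have hk0 : k z₀ = origin EG G := by simp [hk, h1, origin]
  have hsrc : ∀ᶠ z in 𝓝 z₀, f z ∈ (chartAt EG (1 : G)).source := by
    have := hf.self_of_nhds.continuousAt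
    refine this.eventually ?_
    rw [h1]
    exact (chartAt EG (1 : G)).open_source.mem_nhds (mem_chart_source EG (1 : G))
  have hks : ∀ᶠ z in 𝓝 z₀, ContDiffAt ℝ ∞ k z := by
    filter_upwards [hf, hsrc] with z hz hz'
    rw [← contMDiffAt_iff_contDiffAt]
    exact ContMDiffAt.comp (g := extChartAt 𝓘(ℝ, EG) (1 : G)) z (contMDiffAt_extChartAt' hz') hz
  have hkc : Filter.Tendsto k (𝓝 z₀) (𝓝 (origin EG G)) := by
    rw [← hk0]
    exact hks.self_of_nhds.continuousAt
  have heq : lLog E EG f =ᶠ[𝓝 z₀] fun z => (Θ (k z)).comp (fderiv ℝ k z) := by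
    filter_upwards [hsrc.eventually_nhds, hks, hkc.eventually smoothNear_param] with z hz hz' hz''
    have h3 : f =ᶠ[𝓝 z] fun z' => param EG G (k z') := by
      filter_upwards [hz] with z' hz'
      exact ((extChartAt 𝓘(ℝ, EG) (1 : G)).left_inv (by simpa using hz')).symm
    rw [lLog_congr h3, lLog_comp rfl (hz''.mdifferentiableAt (by decide))
      (hz'.differentiableAt (by simp)).mdifferentiableAt, tder_eq_fderiv]
  have hΘd : DifferentiableAt ℝ Θ (k z₀) := by
    rw [hk0]
    exact (contDiffAt_lLog smoothNear_param).differentiableAt (by simp)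
  have hkd : DifferentiableAt ℝ k z₀ := hks.self_of_nhds.differentiableAt (by simp)
  have hkdd : DifferentiableAt ℝ (fderiv ℝ k) z₀ :=
    (hks.self_of_nhds.fderiv_right (m := ∞) (by simp)).differentiableAt (by simp)
  have hder (v w : E) : fderiv ℝ (lLog E EG f) z₀ v w =
      fderiv ℝ Θ (origin EG G) (fderiv ℝ k z₀ v) (fderiv ℝ k z₀ w) +
        fderiv ℝ (fderiv ℝ k) z₀ v w := by
    have h5 := (hΘd.hasFDerivAt.comp z₀ hkd.hasFDerivAt).clm_comp hkdd.hasFDerivAt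
    rw [heq.fderiv_eq, show fderiv ℝ (fun z => (Θ (k z)).comp (fderiv ℝ k z)) z₀ = _ from h5.fderiv]
    simp [hk0, hΘ, lLog_param_origin, add_comm]
  have hl : lLog E EG f z₀ = fderiv ℝ k z₀ := by
    rw [heq.self_of_nhds]
    simp only [hk0, hΘ, lLog_param_origin]
    rfl
  have hsymm : fderiv ℝ (fderiv ℝ k) z₀ v w = fderiv ℝ (fderiv ℝ k) z₀ w v :=
    (hks.self_of_nhds.isSymmSndFDerivAt
      (by rw [minSmoothness_of_isRCLikeNormedField]; exact WithTop.coe_le_coe.2 le_top)) v w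
  rw [hder, hder, hl, ← maurerCartan_param, hsymm]
  abel

end MaurerCartanEquation

/-! ### Invariance under the adjoint action -/

section Adjoint

variable {E EG G : Type*} [NormedAddCommGroup E] [NormedSpace ℝ E]
  [NormedAddCommGroup EG] [NormedSpace ℝ EG] [CompleteSpace EG]
  [TopologicalSpace G] [ChartedSpace EG G]
  [Group G] [LieGroup 𝓘(ℝ, EG) ∞ G]

/-- The adjoint action preserves the bracket: compare the Maurer–Cartan equations of
`f` and `a f a⁻¹`. -/
theorem brk_adj (a : G) (v w : EG) : brk G (adj EG a v) (adj EG a w) = adj EG a (brk G v w) := by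
  have hs : SmoothNear (EG := EG) (param EG G) (origin EG G) := smoothNear_param
  have h1 : lLog EG EG (fun z => a * param EG G z * a⁻¹) =ᶠ[𝓝 (origin EG G)]
      fun z => (adj EG a).comp (lLog EG EG (param EG G) z) := by
    filter_upwards [hs.eventually_mdiffAt] with z hz
    rw [lLog_mul (mdiffAt_mul mdifferentiableAt_const hz) mdifferentiableAt_const, lLog_const,
      lLog_const_mul, inv_inv, add_zero]
  have hd : DifferentiableAt ℝ (lLog EG EG (param EG G)) (origin EG G) :=
    (contDiffAt_lLog hs).differentiableAt (by simp)
  have h2 := maurerCartan (((smoothNear_const a _).mul hs).mul (smoothNear_const a⁻¹ _)) v w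
  have h3 : HasFDerivAt (fun z => (adj EG a).comp (lLog EG EG (param EG G) z))
      ((ContinuousLinearMap.compL ℝ EG EG EG (adj EG a)).comp
        (fderiv ℝ (lLog EG EG (param EG G)) (origin EG G))) (origin EG G) :=
    (ContinuousLinearMap.compL ℝ EG EG EG (adj EG a)).hasFDerivAt.comp _ hd.hasFDerivAt
  rw [h1.fderiv_eq, h3.fderiv, h1.self_of_nhds] at h2
  simp only [lLog_param_origin] at h2
  have h4 := congrArg (adj EG a) (maurerCartan_param (G := G) v w)
  simp only [ContinuousLinearMap.comp_apply, ContinuousLinearMap.compL_apply,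
    ContinuousLinearMap.id_apply, map_sub, map_neg] at h2 h4
  exact neg_injective (h2.symm.trans h4)

/-- For `c : E → G` the family `Ad(c(z)⁻¹)` has derivative `v ↦ (y ↦ [Ad(c(z)⁻¹) y, θ^l(c) v])`:
this is the Maurer–Cartan equation of `(s, z) ↦ p(s) c(z)`, where `p` parametrizes `G` near `1`. -/
theorem hasFDerivAt_adj_inv {c : E → G} {z₀ : E} (hc : SmoothNear (EG := EG) c z₀) (y : EG) :
    ∃ L : E →L[ℝ] EG, HasFDerivAt (fun z => adj EG (c z)⁻¹ y) L z₀ ∧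
      ∀ v, L v = brk G (adj EG (c z₀)⁻¹ y) (lLog E EG c z₀ v) := by
  set o := origin EG G
  let F : EG × E → G := fun q => param EG G q.1 * c q.2
  have hp1 : ∀ᶠ q : EG × E in 𝓝 (o, z₀),
      ContMDiffAt 𝓘(ℝ, EG × E) 𝓘(ℝ, EG) ∞ (fun q : EG × E => param EG G q.1) q := by
    have := (continuous_fst.tendsto (o, z₀)).eventually (smoothNear_param (EG := EG) (G := G))
    filter_upwards [this] with q hq
    exact ContMDiffAt.comp (g := param EG G) (f := Prod.fst) q hq contDiffAt_fst.contMDiffAt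
  have hp2 : SmoothNear (EG := EG) (fun q : EG × E => c q.2) (o, z₀) := by
    have := (continuous_snd.tendsto (o, z₀)).eventually hc
    filter_upwards [this] with q hq
    exact ContMDiffAt.comp (g := c) (f := Prod.snd) q hq contDiffAt_snd.contMDiffAt
  have hp1' : SmoothNear (EG := EG) (fun q : EG × E => param EG G q.1) (o, z₀) := hp1
  have hF : SmoothNear (EG := EG) F (o, z₀) := hp1'.mul hp2
  have hFl : ∀ᶠ q : EG × E in 𝓝 (o, z₀), lLog (EG × E) EG F q =
      (adj EG (c q.2)⁻¹).comp ((lLog EG EG (param EG G) q.1).comp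
        (ContinuousLinearMap.fst ℝ EG E)) +
      (lLog E EG c q.2).comp (ContinuousLinearMap.snd ℝ EG E) := by
    have e1 := (continuous_fst.tendsto (o, z₀)).eventually (smoothNear_param (EG := EG) (G := G))
    have e2 := (continuous_snd.tendsto (o, z₀)).eventually hc
    filter_upwards [hp1'.eventually_mdiffAt, hp2.eventually_mdiffAt, e1, e2] with q h1 h2 h3 h4
    rw [lLog_mul h1 h2, lLog_comp (k := param EG G) (f := Prod.fst) rfl
      (h3.mdifferentiableAt (by simp)) differentiableAt_fst.mdifferentiableAt,
      lLog_comp (k := c) (f := Prod.snd) rfl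
      (h4.mdifferentiableAt (by simp)) differentiableAt_snd.mdifferentiableAt,
      tder_eq_fderiv, tder_eq_fderiv, fderiv_fst, fderiv_snd]
  have hd : DifferentiableAt ℝ (lLog (EG × E) EG F) (o, z₀) :=
    (contDiffAt_lLog hF).differentiableAt (by simp)
  -- the two mixed derivatives of `θ^l (F)`
  have hA : (fun z => lLog (EG × E) EG F (o, z) (y, 0)) =ᶠ[𝓝 z₀] fun z => adj EG (c z)⁻¹ y := by
    have : Filter.Tendsto (fun z : E => (o, z)) (𝓝 z₀) (𝓝 (o, z₀)) :=
      (continuous_const.prodMk continuous_id).tendsto z₀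
    filter_upwards [this.eventually hFl] with z hz
    rw [hz, lLog_param_origin]
    simp
  have hB (v : E) : (fun s => lLog (EG × E) EG F (s, z₀) (0, v)) =ᶠ[𝓝 o]
      fun _ => lLog E EG c z₀ v := by
    have : Filter.Tendsto (fun s : EG => (s, z₀)) (𝓝 o) (𝓝 (o, z₀)) :=
      (continuous_id.prodMk continuous_const).tendsto o
    filter_upwards [this.eventually hFl] with s hs
    rw [hs]
    simp
  have hA' : HasFDerivAt (fun z => lLog (EG × E) EG F (o, z) (y, 0))
      (((ContinuousLinearMap.apply ℝ EG ((y, 0) : EG × E)).comp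
        (fderiv ℝ (lLog (EG × E) EG F) (o, z₀))).comp (ContinuousLinearMap.inr ℝ EG E)) z₀ :=
    ((ContinuousLinearMap.apply ℝ EG ((y, 0) : EG × E)).hasFDerivAt.comp _ hd.hasFDerivAt).comp
      (f := fun z : E => (o, z)) z₀ (hasFDerivAt_prodMk_right o z₀)
  have hB' (v : E) : HasFDerivAt (fun s => lLog (EG × E) EG F (s, z₀) (0, v))
      (((ContinuousLinearMap.apply ℝ EG ((0, v) : EG × E)).comp
        (fderiv ℝ (lLog (EG × E) EG F) (o, z₀))).comp (ContinuousLinearMap.inl ℝ EG E)) o :=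
    ((ContinuousLinearMap.apply ℝ EG ((0, v) : EG × E)).hasFDerivAt.comp _ hd.hasFDerivAt).comp
      (f := fun s : EG => (s, z₀)) o (hasFDerivAt_prodMk_left o z₀)
  refine ⟨_, hA'.congr_of_eventuallyEq hA.symm, fun v => ?_⟩
  have h1 := maurerCartan hF ((0, v) : EG × E) (y, 0)
  have h2 : fderiv ℝ (lLog (EG × E) EG F) (o, z₀) (y, 0) (0, v) = 0 := by
    have h3 := ((hB' v).congr_of_eventuallyEq (hB v).symm).unique (hasFDerivAt_const _ _)
    exact congrArg (fun L : EG →L[ℝ] EG => L y) h3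
  have h4 : brk G (lLog E EG c z₀ v) (adj EG (c z₀)⁻¹ y) =
      -brk G (adj EG (c z₀)⁻¹ y) (lLog E EG c z₀ v) := by
    have := maurerCartan_param (G := G) (lLog E EG c z₀ v) (adj EG (c z₀)⁻¹ y)
    have h5 := maurerCartan_param (G := G) (adj EG (c z₀)⁻¹ y) (lLog E EG c z₀ v)
    rw [← neg_eq_iff_eq_neg.2 h5, ← neg_eq_iff_eq_neg.2 this]
    abel
  rw [h2, hFl.self_of_nhds, lLog_param_origin, sub_zero] at h1
  simp only [add_apply, ContinuousLinearMap.comp_apply,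
    ContinuousLinearMap.coe_fst', ContinuousLinearMap.coe_snd', ContinuousLinearMap.id_apply,
    map_zero, add_zero, zero_add] at h1
  rw [h4, neg_neg] at h1
  exact h1

/-- A map on a connected Lie group with vanishing differential is constant. -/
theorem eq_of_locally_hasFDerivAt_zero {F : Type*} [NormedAddCommGroup F] [NormedSpace ℝ F]
    [PreconnectedSpace G] (u : G → F)
    (h : ∀ g : G, ∀ᶠ z in 𝓝 (extChartAt 𝓘(ℝ, EG) g g),
      HasFDerivAt (fun z => u ((extChartAt 𝓘(ℝ, EG) g).symm z)) (0 : EG →L[ℝ] F) z) (a b : G) :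
    u a = u b := by
  have hl : IsLocallyConstant u := by
    rw [IsLocallyConstant.iff_eventually_eq]
    intro g
    obtain ⟨r, hr, hb⟩ := Metric.eventually_nhds_iff_ball.1 (h g)
    have h1 : ∀ᶠ x in 𝓝 g, extChartAt 𝓘(ℝ, EG) g x ∈ Metric.ball (extChartAt 𝓘(ℝ, EG) g g) r :=
      (continuousAt_extChartAt (I := 𝓘(ℝ, EG)) g).eventually (Metric.ball_mem_nhds _ hr)
    filter_upwards [h1, extChartAt_source_mem_nhds (I := 𝓘(ℝ, EG)) g] with x hx hx'
    have h2 := (convex_ball (extChartAt 𝓘(ℝ, EG) g g) r).is_const_of_fderivWithin_eq_zero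
      (𝕜 := ℝ) (f := fun z => u ((extChartAt 𝓘(ℝ, EG) g).symm z))
      (fun z hz => (hb z hz).differentiableAt.differentiableWithinAt)
      (fun z hz => ((hb z hz).hasFDerivWithinAt.fderivWithin
        (Metric.isOpen_ball.uniqueDiffWithinAt hz))) hx (Metric.mem_ball_self hr)
    simpa only [(extChartAt 𝓘(ℝ, EG) g).left_inv hx', extChartAt_to_inv] using h2
  exact hl.apply_eq_of_preconnectedSpace a b

/-- On a connected Lie group, infinitesimal invariance implies invariance: by
`hasFDerivAt_adj_inv`, the map `g ↦ κ(Ad(g⁻¹) v, Ad(g⁻¹) w)` has vanishing differential. -/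
theorem pairing_adj [PreconnectedSpace G] (κ : EG →L[ℝ] EG →L[ℝ] ℝ)
    (hκ : ∀ x y z : EG, κ (brk G y x) z + κ y (brk G z x) = 0) (a : G) (v w : EG) :
    κ (adj EG a v) (adj EG a w) = κ v w := by
  have key : ∀ b : G, κ (adj EG b⁻¹ v) (adj EG b⁻¹ w) = κ v w := by
    intro b
    have h := eq_of_locally_hasFDerivAt_zero (EG := EG)
      (fun g : G => κ (adj EG g⁻¹ v) (adj EG g⁻¹ w)) (fun g => ?_) b 1
    · simpa [adj_one] using h
    have hs : ∀ᶠ z in 𝓝 (extChartAt 𝓘(ℝ, EG) g g),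
        SmoothNear (EG := EG) (extChartAt 𝓘(ℝ, EG) g).symm z := by
      refine Filter.Eventually.eventually_nhds ?_
      filter_upwards [extChartAt_target_mem_nhds (I := 𝓘(ℝ, EG)) g] with z hz
      exact (contMDiffOn_extChartAt_symm (n := ∞) g).contMDiffAt
        ((isOpen_extChartAt_target (I := 𝓘(ℝ, EG)) g).mem_nhds hz)
    filter_upwards [hs] with z hz
    obtain ⟨L, hL, hL'⟩ := hasFDerivAt_adj_inv hz v
    obtain ⟨L', hL1, hL1'⟩ := hasFDerivAt_adj_inv hz w
    have h2 := (κ.hasFDerivAt_of_bilinear hL hL1)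
    convert h2 using 1
    ext x
    have h3 := hκ (lLog EG EG (extChartAt 𝓘(ℝ, EG) g).symm z x)
      (adj EG ((extChartAt 𝓘(ℝ, EG) g).symm z)⁻¹ v) (adj EG ((extChartAt 𝓘(ℝ, EG) g).symm z)⁻¹ w)
    rw [add_comm] at h3
    simpa [hL', hL1'] using h3.symm
  simpa using key a⁻¹

end Adjoint

/-! ### The Polyakov–Wiegmann form -/

section Wedge

variable {V V' A B : Type*} [NormedAddCommGroup V] [NormedSpace ℝ V]
  [NormedAddCommGroup V'] [NormedSpace ℝ V'] [NormedAddCommGroup A]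
  [NormedSpace ℝ A] [NormedAddCommGroup B] [NormedSpace ℝ B] (β : A →L[ℝ] B →L[ℝ] ℝ)

theorem wedge_apply (a : V →L[ℝ] A) (b : V →L[ℝ] B) (m : Fin 2 → V) :
    wedge β a b m = β (a (m 0)) (b (m 1)) - β (a (m 1)) (b (m 0)) := rfl

theorem wedge_comp (a : V →L[ℝ] A) (b : V →L[ℝ] B) (L : V' →L[ℝ] V) :
    (wedge β a b).compContinuousLinearMap L = wedge β (a.comp L) (b.comp L) := rfl

/-- `wedge` as a continuous bilinear map. -/
def wedgeL : (V →L[ℝ] A) →L[ℝ] (V →L[ℝ] B) →L[ℝ] V [⋀^Fin 2]→L[ℝ] ℝ :=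
  LinearMap.mkContinuous₂
    (LinearMap.mk₂ ℝ (fun a b => wedge β a b)
      (fun a a' b => by ext m; simp [wedge_apply]; ring)
      (fun c a b => by ext m; simp [wedge_apply]; ring)
      (fun a b b' => by ext m; simp [wedge_apply]; ring)
      (fun c a b => by ext m; simp [wedge_apply]; ring))
    (2 * ‖β‖) (fun a b => by
      refine ContinuousAlternatingMap.opNorm_le_bound _ (by positivity) fun m => ?_
      have h1 (x y : V) : ‖β (a x) (b y)‖ ≤ ‖β‖ * (‖a‖ * ‖x‖) * (‖b‖ * ‖y‖) :=
        (β.le_opNorm₂ _ _).trans (by gcongr <;> exact ContinuousLinearMap.le_opNorm _ _)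
      change ‖β (a (m 0)) (b (m 1)) - β (a (m 1)) (b (m 0))‖ ≤ _
      refine (norm_sub_le _ _).trans ((add_le_add (h1 _ _) (h1 _ _)).trans (le_of_eq ?_))
      rw [Fin.prod_univ_two]
      ring)

end Wedge

section PolyakovWiegmann

variable {EX X EY Y EG G : Type*}
  [NormedAddCommGroup EX] [NormedSpace ℝ EX] [TopologicalSpace X] [ChartedSpace EX X]
  [NormedAddCommGroup EY] [NormedSpace ℝ EY] [TopologicalSpace Y] [ChartedSpace EY Y]
  [NormedAddCommGroup EG] [NormedSpace ℝ EG] [CompleteSpace EG]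
  [TopologicalSpace G] [ChartedSpace EG G] [Group G] [LieGroup 𝓘(ℝ, EG) ∞ G]
  (κ : EG →L[ℝ] EG →L[ℝ] ℝ)

variable (EX) in
/-- The `2`-form `⟨f^* θ^l, g^* θ^r⟩` of two maps `f, g : X → G`. -/
def pwForm (f g : X → G) (x : X) : EX [⋀^Fin 2]→L[ℝ] ℝ :=
  wedge κ (lLog EX EG f x) (rLog EX EG g x)

variable {f g h : X → G} {x : X}

/-- The Polyakov–Wiegmann identity: `⟨f^* θ^l, g^* θ^r⟩` is a `2`-cocycle on the group of maps. -/
theorem pwForm_cocycle (hκ : ∀ (a : G) (v w : EG), κ (adj EG a v) (adj EG a w) = κ v w)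
    (hf : MDifferentiableAt 𝓘(ℝ, EX) 𝓘(ℝ, EG) f x) (hg : MDifferentiableAt 𝓘(ℝ, EX) 𝓘(ℝ, EG) g x)
    (hh : MDifferentiableAt 𝓘(ℝ, EX) 𝓘(ℝ, EG) h x) :
    pwForm EX κ f g x + pwForm EX κ (fun z => f z * g z) h x =
      pwForm EX κ f (fun z => g z * h z) x + pwForm EX κ g h x := by
  have h1 (v w : EG) : κ (adj EG (g x)⁻¹ v) w = κ v (adj EG (g x) w) := by
    rw [← hκ (g x), adj_adj_inv]
  ext m
  simp only [pwForm, wedge_apply, ContinuousAlternatingMap.add_apply, lLog_mul hf hg,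
    rLog_mul hg hh, add_apply, ContinuousLinearMap.comp_apply, map_add, h1]
  ring

theorem pwForm_const_left (c : G) : pwForm EX κ (fun _ => c) g x = 0 := by
  ext m
  simp [pwForm, wedge_apply, lLog_const]

theorem pwForm_const_right (c : G) : pwForm EX κ f (fun _ => c) x = 0 := by
  ext m
  simp [pwForm, wedge_apply, rLog_const]

theorem pwForm_comp {f g : Y → G} {k : X → Y} {x : X} {y : Y} (hy : k x = y)
    (hf : MDifferentiableAt 𝓘(ℝ, EY) 𝓘(ℝ, EG) f y) (hg : MDifferentiableAt 𝓘(ℝ, EY) 𝓘(ℝ, EG) g y)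
    (hk : MDifferentiableAt 𝓘(ℝ, EX) 𝓘(ℝ, EY) k x) :
    pwForm EX κ (fun z => f (k z)) (fun z => g (k z)) x =
      (pwForm EY κ f g y).compContinuousLinearMap (tder EX EY k x) := by
  rw [pwForm, lLog_comp hy hf hk, rLog_comp hy hg hk, pwForm, wedge_comp]

end PolyakovWiegmann

section ExteriorDerivative

variable {E EG G : Type*} [NormedAddCommGroup E] [NormedSpace ℝ E]
  [NormedAddCommGroup EG] [NormedSpace ℝ EG] [CompleteSpace EG]
  [TopologicalSpace G] [ChartedSpace EG G] [Group G] [LieGroup 𝓘(ℝ, EG) ∞ G]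
  (κ : EG →L[ℝ] EG →L[ℝ] ℝ)

theorem brk_eq (v w : EG) : brk G v w =
    fderiv ℝ (lLog EG EG (param EG G)) (origin EG G) w v -
      fderiv ℝ (lLog EG EG (param EG G)) (origin EG G) v w := by
  rw [← neg_eq_iff_eq_neg.2 (maurerCartan_param v w), neg_sub]

theorem brk_neg_swap (v w : EG) : brk G v w = -brk G w v := by
  rw [brk_eq, brk_eq]; abel

theorem brk_add_left (u v w : EG) : brk G (u + v) w = brk G u w + brk G v w := by
  simp only [brk_eq, map_add, add_apply]; abel

theorem brk_add_right (u v w : EG) : brk G u (v + w) = brk G u v + brk G u w := by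
  simp only [brk_eq, map_add, add_apply]; abel

theorem brk_neg_left (v w : EG) : brk G (-v) w = -brk G v w := by
  simp only [brk_eq, map_neg, neg_apply]; abel

theorem brk_neg_right (v w : EG) : brk G v (-w) = -brk G v w := by
  simp only [brk_eq, map_neg, neg_apply]; abel

/-- The Maurer–Cartan equation for the right form, obtained from the left one by inversion. -/
theorem maurerCartan_right {f : E → G} {z₀ : E} (hf : SmoothNear (EG := EG) f z₀) (v w : E) :
    fderiv ℝ (rLog E EG f) z₀ v w - fderiv ℝ (rLog E EG f) z₀ w v =
      brk G (rLog E EG f z₀ v) (rLog E EG f z₀ w) := by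
  have h1 : rLog E EG f =ᶠ[𝓝 z₀] -lLog E EG (fun z => (f z)⁻¹) := by
    filter_upwards [hf.eventually_mdiffAt] with z hz using rLog_eq_neg_lLog_inv hz
  have h2 := maurerCartan hf.inv v w
  rw [h1.fderiv_eq, fderiv_neg, h1.self_of_nhds]
  simp only [Pi.neg_apply, neg_apply, brk_neg_left, brk_neg_right, neg_neg]
  rw [← neg_eq_iff_eq_neg.2 h2]
  abel

theorem contDiffAt_pwForm {f g : E → G} {z₀ : E} (hf : SmoothNear (EG := EG) f z₀)
    (hg : SmoothNear (EG := EG) g z₀) : ContDiffAt ℝ ∞ (pwForm E κ f g) z₀ :=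
  ((wedgeL (V := E) κ).isBoundedBilinearMap.contDiff.contDiffAt).comp z₀
    ((contDiffAt_lLog hf).prodMk (contDiffAt_rLog hg))

variable (hsymm : ∀ x y : EG, κ x y = κ y x)
  (hκ : ∀ x y z : EG, κ (brk G y x) z + κ y (brk G z x) = 0)
include hsymm hκ

theorem pairing_brk_cyclic (x y z : EG) : κ (brk G x y) z = κ (brk G y z) x := by
  have h1 := hκ y x z
  rw [brk_neg_swap z y, map_neg, hsymm x] at h1
  linarith

/-- The exterior derivative of `⟨f^* θ^l, g^* θ^r⟩` is, up to sign, the difference of the pullbacks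
of the Cartan `3`-form `⟨[x, y], z⟩` along `f g`, `f` and `g`. -/
theorem extDeriv_pwForm {f g : E → G} {z₀ : E} (hf : SmoothNear (EG := EG) f z₀)
    (hg : SmoothNear (EG := EG) g z₀) (v : Fin 3 → E) :
    extDeriv (pwForm E κ f g) z₀ v =
      κ (brk G (lLog E EG f z₀ (v 0)) (lLog E EG f z₀ (v 1))) (lLog E EG f z₀ (v 2)) +
      κ (brk G (rLog E EG g z₀ (v 0)) (rLog E EG g z₀ (v 1))) (rLog E EG g z₀ (v 2)) -
      κ (brk G (lLog E EG f z₀ (v 0) + rLog E EG g z₀ (v 0))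
        (lLog E EG f z₀ (v 1) + rLog E EG g z₀ (v 1)))
        (lLog E EG f z₀ (v 2) + rLog E EG g z₀ (v 2)) := by
  have hcyc := pairing_brk_cyclic κ hsymm hκ
  have hl : DifferentiableAt ℝ (lLog E EG f) z₀ := (contDiffAt_lLog hf).differentiableAt (by simp)
  have hr : DifferentiableAt ℝ (rLog E EG g) z₀ := (contDiffAt_rLog hg).differentiableAt (by simp)
  have hd (u : E) : fderiv ℝ (pwForm E κ f g) z₀ u =
      wedge κ (lLog E EG f z₀) (fderiv ℝ (rLog E EG g) z₀ u) +
        wedge κ (fderiv ℝ (lLog E EG f) z₀ u) (rLog E EG g z₀) := by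
    have h1 := (wedgeL κ).hasFDerivAt_of_bilinear hl.hasFDerivAt hr.hasFDerivAt
    have h2 : fderiv ℝ (pwForm E κ f g) z₀ = _ := h1.fderiv
    rw [h2]
    rfl
  rw [extDeriv, ContinuousAlternatingMap.alternatizeUncurryFin_apply, Fin.sum_univ_three]
  simp only [hd, ContinuousAlternatingMap.add_apply, wedge_apply, Fin.removeNth]
  have e1 : (1 : Fin 3).succAbove (0 : Fin 2) = 0 := rfl
  have e2 : (1 : Fin 3).succAbove (1 : Fin 2) = 2 := rfl
  have e3 : (2 : Fin 3).succAbove (0 : Fin 2) = 0 := rfl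
  have e4 : (2 : Fin 3).succAbove (1 : Fin 2) = 1 := rfl
  have e5 : (0 : Fin 3).succAbove (0 : Fin 2) = 1 := rfl
  have e6 : (0 : Fin 3).succAbove (1 : Fin 2) = 2 := rfl
  rw [e1, e2, e3, e4, e5, e6]
  have m (i j : Fin 3) := eq_add_of_sub_eq (maurerCartan hf (v i) (v j))
  have m' (i j : Fin 3) := eq_add_of_sub_eq (maurerCartan_right hg (v i) (v j))
  rw [m 0 1, m 0 2, m 1 2, m' 0 1, m' 0 2, m' 1 2]
  generalize lLog E EG f z₀ (v 0) = a0
  generalize lLog E EG f z₀ (v 1) = a1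
  generalize lLog E EG f z₀ (v 2) = a2
  generalize rLog E EG g z₀ (v 0) = b0
  generalize rLog E EG g z₀ (v 1) = b1
  generalize rLog E EG g z₀ (v 2) = b2
  simp only [map_add, add_apply, map_neg, neg_apply, brk_add_left, brk_add_right]
  have n1 := hcyc a0 b1 a2
  have n2 := hcyc b1 a2 a0
  have n3 := hcyc b0 a1 a2
  have n4 := hcyc a0 b1 b2
  have n5 := hcyc b0 a1 b2
  have n6 := hcyc a1 b2 b0
  have n7 : κ (brk G a2 a0) b1 = -κ (brk G a0 a2) b1 := by
    rw [brk_neg_swap, map_neg, neg_apply]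
  have n8 : κ (brk G b2 b0) a1 = -κ (brk G b0 b2) a1 := by
    rw [brk_neg_swap, map_neg, neg_apply]
  rw [hsymm a1 (brk G b0 b2), hsymm a2 (brk G b0 b1), hsymm a0 (brk G b1 b2)]
  simp only [Fin.val_zero, Fin.val_one, Fin.val_two, pow_zero, pow_one, even_two, Even.neg_pow,
    one_pow, one_smul, neg_smul]
  linarith

/-- If the Cartan `3`-form vanishes on `f` and `g`, then only its pullback along `f g` contributes
to the exterior derivative of `⟨f^* θ^l, g^* θ^r⟩`. -/
theorem extDeriv_pwForm_of_isotropic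
    (hA : ∀ (a : G) (v w : EG), κ (adj EG a v) (adj EG a w) = κ v w)
    {f g : E → G} {z₀ : E} (hf : SmoothNear (EG := EG) f z₀)
    (hg : SmoothNear (EG := EG) g z₀)
    (hf₀ : ∀ u v w, κ (brk G (lLog E EG f z₀ u) (lLog E EG f z₀ v)) (lLog E EG f z₀ w) = 0)
    (hg₀ : ∀ u v w, κ (brk G (rLog E EG g z₀ u) (rLog E EG g z₀ v)) (rLog E EG g z₀ w) = 0)
    (v : Fin 3 → E) :
    extDeriv (pwForm E κ f g) z₀ v =
      -κ (brk G (lLog E EG (fun z => f z * g z) z₀ (v 0))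
          (lLog E EG (fun z => f z * g z) z₀ (v 1)))
        (lLog E EG (fun z => f z * g z) z₀ (v 2)) := by
  have h1 (u : E) : lLog E EG f z₀ u + rLog E EG g z₀ u =
      adj EG (g z₀) (lLog E EG (fun z => f z * g z) z₀ u) := by
    rw [lLog_mul hf.mdiffAt hg.mdiffAt, rLog_eq_adj_lLog hg.mdiffAt]
    simp [adj_adj_inv]
  rw [extDeriv_pwForm κ hsymm hκ hf hg, hf₀, hg₀, h1, h1, h1, brk_adj, hA]
  ring

/-- For two factorizations `f g = f' g'` into maps on which the Cartan `3`-form vanishes, the forms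
`⟨f^* θ^l, g^* θ^r⟩` and `⟨f'^* θ^l, g'^* θ^r⟩` have the same exterior derivative. -/
theorem extDeriv_pwForm_sub (hA : ∀ (a : G) (v w : EG), κ (adj EG a v) (adj EG a w) = κ v w)
    {f g f' g' : E → G} {z₀ : E} (hf : SmoothNear (EG := EG) f z₀)
    (hg : SmoothNear (EG := EG) g z₀) (hf' : SmoothNear (EG := EG) f' z₀)
    (hg' : SmoothNear (EG := EG) g' z₀)
    (hf₀ : ∀ u v w, κ (brk G (lLog E EG f z₀ u) (lLog E EG f z₀ v)) (lLog E EG f z₀ w) = 0)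
    (hg₀ : ∀ u v w, κ (brk G (rLog E EG g z₀ u) (rLog E EG g z₀ v)) (rLog E EG g z₀ w) = 0)
    (hf₀' : ∀ u v w, κ (brk G (lLog E EG f' z₀ u) (lLog E EG f' z₀ v)) (lLog E EG f' z₀ w) = 0)
    (hg₀' : ∀ u v w, κ (brk G (rLog E EG g' z₀ u) (rLog E EG g' z₀ v)) (rLog E EG g' z₀ w) = 0)
    (h : (fun z => f z * g z) =ᶠ[𝓝 z₀] fun z => f' z * g' z) :
    extDeriv (pwForm E κ f g - pwForm E κ f' g') z₀ = 0 := by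
  rw [show pwForm E κ f g - pwForm E κ f' g' = pwForm E κ f g + (-1 : ℝ) • pwForm E κ f' g' by
      rw [sub_eq_add_neg]; congr 1; ext z m; simp,
    extDeriv_add ((contDiffAt_pwForm κ hf hg).differentiableAt (by simp))
      (((contDiffAt_pwForm κ hf' hg').differentiableAt (by simp)).const_smul _),
    extDeriv_smul]
  ext v
  simp only [ContinuousAlternatingMap.add_apply, ContinuousAlternatingMap.smul_apply,
    extDeriv_pwForm_of_isotropic κ hsymm hκ hA hf hg hf₀ hg₀,
    extDeriv_pwForm_of_isotropic κ hsymm hκ hA hf' hg' hf₀' hg₀', lLog_congr h]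
  simp

end ExteriorDerivative

/-! ### The inverse function theorem, submersions and immersions -/

section InverseFunction

variable {E F : Type*} [NormedAddCommGroup E] [NormedSpace ℝ E] [FiniteDimensional ℝ E]
  [NormedAddCommGroup F] [NormedSpace ℝ F] [FiniteDimensional ℝ F]

/-- The inverse function theorem for smooth maps, with a domain contained in a given
neighbourhood. -/
theorem exists_openPartialHomeomorph_of_bijective {f : E → F} {x : E}
    (hf : ∀ᶠ z in 𝓝 x, ContDiffAt ℝ ∞ f z) (hbij : Function.Bijective (fderiv ℝ f x))
    {P : E → Prop} (hP : ∀ᶠ z in 𝓝 x, P z) :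
    ∃ e : OpenPartialHomeomorph E F, x ∈ e.source ∧ (e : E → F) = f ∧ (∀ z ∈ e.source, P z) ∧
      ContDiffOn ℝ ∞ e e.source ∧ ContDiffOn ℝ ∞ e.symm e.target := by
  have : CompleteSpace E := FiniteDimensional.complete ℝ E
  have : CompleteSpace F := FiniteDimensional.complete ℝ F
  let A : E ≃L[ℝ] F :=
    (LinearEquiv.ofBijective (fderiv ℝ f x : E →ₗ[ℝ] F) hbij).toContinuousLinearEquiv
  have hx := hf.self_of_nhds
  have hA : HasFDerivAt f (A : E →L[ℝ] F) x := (hx.differentiableAt (by simp)).hasFDerivAt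
  let e₀ := hx.toOpenPartialHomeomorph f hA (by simp)
  have hev : ∀ᶠ z in 𝓝 x, ContDiffAt ℝ ∞ f z ∧ P z ∧
      fderiv ℝ f z ∈ Set.range ((↑) : (E ≃L[ℝ] F) → E →L[ℝ] F) := by
    refine hf.and (hP.and ?_)
    have hc : ContinuousAt (fderiv ℝ f) x := (hx.fderiv_right (m := ∞) (by simp)).continuousAt
    refine hc.preimage_mem_nhds (ContinuousLinearEquiv.isOpen.mem_nhds ⟨A, ?_⟩)
    exact hA.fderiv.symm
  obtain ⟨U, hU, hUo, hxU⟩ := eventually_nhds_iff.1 hev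
  refine ⟨e₀.restr U, ?_, rfl, ?_, ?_, ?_⟩
  · rw [OpenPartialHomeomorph.restr_source, hUo.interior_eq]
    exact ⟨ContDiffAt.mem_toOpenPartialHomeomorph_source hx hA _, hxU⟩
  · intro z hz
    rw [OpenPartialHomeomorph.restr_source, hUo.interior_eq] at hz
    exact (hU z hz.2).2.1
  · intro z hz
    rw [OpenPartialHomeomorph.restr_source, hUo.interior_eq] at hz
    exact (hU z hz.2).1.contDiffWithinAt
  · intro y hy
    have hz := (e₀.restr U).map_target hy
    rw [OpenPartialHomeomorph.restr_source, hUo.interior_eq] at hz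
    obtain ⟨B, hB⟩ := (hU _ hz.2).2.2
    refine ((e₀.restr U).contDiffAt_symm (f₀' := B) hy ?_ (hU _ hz.2).1).contDiffWithinAt
    rw [hB]
    exact ((hU _ hz.2).1.differentiableAt (by simp)).hasFDerivAt

variable {M N : Type*} [TopologicalSpace M] [ChartedSpace E M] [IsManifold 𝓘(ℝ, E) ∞ M]
  [TopologicalSpace N] [ChartedSpace F N] [IsManifold 𝓘(ℝ, F) ∞ N]

theorem tder_eq_fderiv_charts {f : M → N} {x : M}
    (hf : MDifferentiableAt 𝓘(ℝ, E) 𝓘(ℝ, F) f x) :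
    tder E F f x =
      fderiv ℝ (fun z => chartAt F (f x) (f ((chartAt E x).symm z))) (chartAt E x x) := by
  rw [tder, hf.mfderiv]
  simp only [writtenInExtChartAt, modelWithCornersSelf_coe, Set.range_id, fderivWithin_univ]
  rfl

/-- The inverse function theorem on manifolds. -/
theorem isLocalDiffeomorphAt_of_bijective {f : M → N} (hf : ContMDiff 𝓘(ℝ, E) 𝓘(ℝ, F) ∞ f) {x : M}
    (hbij : Function.Bijective (tder E F f x)) :
    IsLocalDiffeomorphAt 𝓘(ℝ, E) 𝓘(ℝ, F) ∞ f x := by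
  set φ := chartAt E x
  set ψ := chartAt F (f x)
  have hφ : φ ∈ IsManifold.maximalAtlas 𝓘(ℝ, E) ∞ M := IsManifold.chart_mem_maximalAtlas x
  have hψ : ψ ∈ IsManifold.maximalAtlas 𝓘(ℝ, F) ∞ N := IsManifold.chart_mem_maximalAtlas _
  have hxs : x ∈ φ.source := mem_chart_source E x
  have hfs : f x ∈ ψ.source := mem_chart_source F (f x)
  have hP : ∀ᶠ z in 𝓝 (φ x), z ∈ φ.target ∧ f (φ.symm z) ∈ ψ.source := by
    refine Filter.Eventually.and (φ.open_target.mem_nhds (φ.map_source hxs)) ?_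
    have h1 : ContinuousAt (fun z => f (φ.symm z)) (φ x) :=
      hf.continuous.continuousAt.comp (φ.continuousAt_symm (φ.map_source hxs))
    refine h1.preimage_mem_nhds (ψ.open_source.mem_nhds ?_)
    rwa [φ.left_inv hxs]
  have hs : ∀ᶠ z in 𝓝 (φ x), ContDiffAt ℝ ∞ (fun z => ψ (f (φ.symm z))) z := by
    filter_upwards [hP.eventually_nhds] with z hz
    have hz' := hz.self_of_nhds
    rw [← contMDiffAt_iff_contDiffAt]
    exact (contMDiffAt_of_mem_maximalAtlas hψ hz'.2).comp z
      (hf.contMDiffAt.comp z (contMDiffAt_symm_of_mem_maximalAtlas hφ hz'.1))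
  rw [tder_eq_fderiv_charts (hf.mdifferentiableAt (by simp))] at hbij
  obtain ⟨e, he, hef, heP, he1, he2⟩ := exists_openPartialHomeomorph_of_bijective hs hbij hP
  let Φ := φ ≫ₕ e ≫ₕ ψ.symm
  have hsub : ∀ z ∈ Φ.source, z ∈ φ.source ∧ φ z ∈ e.source ∧ e (φ z) ∈ ψ.target := by
    intro z hz
    simpa [Φ, OpenPartialHomeomorph.trans_source] using hz
  have hfΦ : Set.EqOn f Φ Φ.source := by
    intro z hz
    obtain ⟨h1, h2, h3⟩ := hsub z hz
    have h4 := (heP _ h2).2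
    change f z = ψ.symm (e (φ z))
    rw [hef]
    change f z = ψ.symm (ψ (f (φ.symm (φ z))))
    rw [ψ.left_inv h4, φ.left_inv h1]
  refine ⟨{ Φ.toPartialEquiv with
    open_source := Φ.open_source
    open_target := Φ.open_target
    contMDiffOn_toFun := hf.contMDiffOn.congr fun z hz => (hfΦ hz).symm
    contMDiffOn_invFun := ?_ }, ?_, hfΦ⟩
  · intro y hy
    have hy' : y ∈ ψ.source ∧ ψ y ∈ e.target ∧ e.symm (ψ y) ∈ φ.target := by
      have hy2 : y ∈ Φ.target := hy
      simp only [Φ, OpenPartialHomeomorph.trans_target] at hy2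
      simpa [and_assoc] using hy2
    refine ContMDiffAt.contMDiffWithinAt ?_
    change ContMDiffAt 𝓘(ℝ, F) 𝓘(ℝ, E) ∞ (fun y => φ.symm (e.symm (ψ y))) y
    exact (contMDiffAt_symm_of_mem_maximalAtlas hφ hy'.2.2).comp y
      (ContMDiffAt.comp y (contMDiffAt_iff_contDiffAt.2
        (he2.contDiffAt (e.open_target.mem_nhds hy'.2.1)))
        (contMDiffAt_of_mem_maximalAtlas hψ hy'.1))
  · change x ∈ Φ.source
    simp only [Φ, OpenPartialHomeomorph.trans_source]
    refine ⟨hxs, he, ?_⟩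
    change e (φ x) ∈ ψ.target
    rw [hef]
    change ψ (f (φ.symm (φ x))) ∈ _
    rw [φ.left_inv hxs]
    exact ψ.map_source hfs

end InverseFunction

section MaximalAtlas

variable {E M : Type*} [NormedAddCommGroup E] [NormedSpace ℝ E]
  [TopologicalSpace M] [ChartedSpace E M] [IsManifold 𝓘(ℝ, E) ∞ M]

/-- A diffeomorphism between open subsets of `M` and of the model space is a chart. -/
theorem mem_maximalAtlas_of_contMDiffOn (e : OpenPartialHomeomorph M E)
    (h1 : ContMDiffOn 𝓘(ℝ, E) 𝓘(ℝ, E) ∞ e e.source)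
    (h2 : ContMDiffOn 𝓘(ℝ, E) 𝓘(ℝ, E) ∞ e.symm e.target) :
    e ∈ IsManifold.maximalAtlas 𝓘(ℝ, E) ∞ M := by
  have key (e₁ e₂ : OpenPartialHomeomorph M E)
      (h1 : ContMDiffOn 𝓘(ℝ, E) 𝓘(ℝ, E) ∞ e₁ e₁.source)
      (h2 : ContMDiffOn 𝓘(ℝ, E) 𝓘(ℝ, E) ∞ e₂.symm e₂.target) :
      ContDiffOn ℝ ∞ (e₂.symm ≫ₕ e₁) (e₂.symm ≫ₕ e₁).source := by
    rw [← contMDiffOn_iff_contDiffOn]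
    exact h1.comp (h2.mono fun z hz => hz.1) fun z hz => hz.2
  have mem (e₁ e₂ : OpenPartialHomeomorph M E)
      (h1 : ContDiffOn ℝ ∞ (e₂.symm ≫ₕ e₁) (e₂.symm ≫ₕ e₁).source)
      (h2 : ContDiffOn ℝ ∞ (e₁.symm ≫ₕ e₂) (e₁.symm ≫ₕ e₂).source) :
      e₂.symm ≫ₕ e₁ ∈ contDiffGroupoid ∞ 𝓘(ℝ, E) := by
    rw [contDiffGroupoid, mem_groupoid_of_pregroupoid]
    refine ⟨?_, ?_⟩
    · simpa [contDiffPregroupoid] using h1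
    · simpa [contDiffPregroupoid] using h2
  rw [IsManifold.maximalAtlas, mem_maximalAtlas_iff]
  intro e' he'
  have he'' : e' ∈ IsManifold.maximalAtlas 𝓘(ℝ, E) ∞ M := IsManifold.subset_maximalAtlas he'
  have a := key e e' h1 (contMDiffOn_symm_of_mem_maximalAtlas he'')
  have b := key e' e (contMDiffOn_of_mem_maximalAtlas he'') h2
  exact ⟨mem e' e b a, mem e e' a b⟩

end MaximalAtlas

section Submersion

variable {E F M N : Type*} [NormedAddCommGroup E] [NormedSpace ℝ E]
  [NormedAddCommGroup F] [NormedSpace ℝ F]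
  [TopologicalSpace M] [ChartedSpace E M] [IsManifold 𝓘(ℝ, E) ∞ M]
  [TopologicalSpace N] [ChartedSpace F N] [IsManifold 𝓘(ℝ, F) ∞ N] {f : M → N} {x : M}

/-- The charts `ψ` at `f x` and `A⁻¹ ψ f` at `x`, for the differential `A` of `f` at `x`, turn `f`
into the linear isomorphism `A`. -/
theorem isSubmersionAt_of_isLocalDiffeomorphAt
    (hf : IsLocalDiffeomorphAt 𝓘(ℝ, E) 𝓘(ℝ, F) ∞ f x) :
    IsSubmersionAt 𝓘(ℝ, E) 𝓘(ℝ, F) ∞ f x := by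
  let A : E ≃L[ℝ] F := hf.mfderivToContinuousLinearEquiv (by simp)
  obtain ⟨Φ, hx, hΦ⟩ := hf
  set ψ := chartAt F (f x)
  have hψ : ψ ∈ IsManifold.maximalAtlas 𝓘(ℝ, F) ∞ N := IsManifold.chart_mem_maximalAtlas _
  let e : OpenPartialHomeomorph M E :=
    Φ.toOpenPartialHomeomorph ≫ₕ ψ ≫ₕ A.symm.toHomeomorph.toOpenPartialHomeomorph
  have hfx : Φ x = f x := (hΦ hx).symm
  have hes : ∀ z ∈ e.source, z ∈ Φ.source ∧ Φ z ∈ ψ.source := fun z hz => ⟨hz.1, hz.2.1⟩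
  have het : ∀ y ∈ e.target, A y ∈ ψ.target ∧ ψ.symm (A y) ∈ Φ.target :=
    fun y hy => ⟨hy.1.2, hy.2⟩
  have hA : ContMDiff 𝓘(ℝ, E) 𝓘(ℝ, F) ∞ A := A.contDiff.contMDiff
  have hA' : ContMDiff 𝓘(ℝ, F) 𝓘(ℝ, E) ∞ A.symm := A.symm.contDiff.contMDiff
  refine IsSubmersionAt.mk_of_continuousAt (F := PUnit.{1}) ?_
    (A.trans (ContinuousLinearEquiv.prodUnique ℝ F PUnit).symm) e ψ
    ⟨hx, ?_, trivial⟩ (mem_chart_source F _) (mem_maximalAtlas_of_contMDiffOn e ?_ ?_) hψ ?_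
  · exact (Φ.contMDiffOn_toFun.continuousOn.congr hΦ).continuousAt
      (Φ.open_source.mem_nhds hx)
  · change Φ x ∈ ψ.source
    rw [hfx]
    exact mem_chart_source F _
  · change ContMDiffOn 𝓘(ℝ, E) 𝓘(ℝ, E) ∞ (fun z => A.symm (ψ (Φ z))) e.source
    exact hA'.comp_contMDiffOn ((contMDiffOn_of_mem_maximalAtlas hψ).comp
      (Φ.contMDiffOn_toFun.mono fun z hz => (hes z hz).1) fun z hz => (hes z hz).2)
  · change ContMDiffOn 𝓘(ℝ, E) 𝓘(ℝ, E) ∞ (fun y => Φ.symm (ψ.symm (A y))) e.target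
    exact Φ.contMDiffOn_invFun.comp ((contMDiffOn_symm_of_mem_maximalAtlas hψ).comp
      hA.contMDiffOn fun y hy => (het y hy).1) fun y hy => (het y hy).2
  · intro y hy
    have hy' : y ∈ e.target := by simpa using hy
    obtain ⟨h1, h2⟩ := het y hy'
    change ψ (f (Φ.toPartialEquiv.symm (ψ.symm (A y)))) = A y
    rw [hΦ (Φ.toPartialEquiv.map_target h2)]
    rw [Φ.toPartialEquiv.right_inv h2, ψ.right_inv h1]

/-- Every continuous map to a zero-dimensional manifold is a submersion. -/
theorem isSubmersionAt_of_subsingleton [Subsingleton F] (hf : Continuous f) :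
    IsSubmersionAt 𝓘(ℝ, E) 𝓘(ℝ, F) ∞ f x := by
  have : Unique F := ⟨⟨0⟩, fun _ => Subsingleton.elim _ _⟩
  exact IsSubmersionAt.mk_of_continuousAt (F := E) hf.continuousAt
    (ContinuousLinearEquiv.uniqueProd ℝ E F).symm (chartAt E x) (chartAt F (f x))
    (mem_chart_source E x) (mem_chart_source F _) (IsManifold.chart_mem_maximalAtlas _)
    (IsManifold.chart_mem_maximalAtlas _) fun y _ => Subsingleton.elim _ _

end Submersion

section Immersion

variable {E F M N : Type*} [NormedAddCommGroup E] [NormedSpace ℝ E] [FiniteDimensional ℝ E]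
  [NormedAddCommGroup F] [NormedSpace ℝ F] [FiniteDimensional ℝ F]
  [TopologicalSpace M] [ChartedSpace E M] [IsManifold 𝓘(ℝ, E) ∞ M]
  [TopologicalSpace N] [ChartedSpace F N] [IsManifold 𝓘(ℝ, F) ∞ N] {f : M → N}

/-- A smooth map with injective differentials is an immersion. The codomain chart extends the map
`u ↦ f(u)` by `(u, c) ↦ f(u) + c`, for `c` in a complement of the image of the differential. -/
theorem isImmersion_of_injective (hf : ContMDiff 𝓘(ℝ, E) 𝓘(ℝ, F) ∞ f)
    (hinj : ∀ x, Function.Injective (tder E F f x)) : IsImmersion 𝓘(ℝ, E) 𝓘(ℝ, F) ∞ f := by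
  let K := Fin (Module.finrank ℝ F - Module.finrank ℝ E) → ℝ
  have key : IsImmersionOfComplement K 𝓘(ℝ, E) 𝓘(ℝ, F) ∞ f := by
    intro x
    set φ := chartAt E x
    set ψ := chartAt F (f x)
    have hφ : φ ∈ IsManifold.maximalAtlas 𝓘(ℝ, E) ∞ M := IsManifold.chart_mem_maximalAtlas x
    have hψ : ψ ∈ IsManifold.maximalAtlas 𝓘(ℝ, F) ∞ N := IsManifold.chart_mem_maximalAtlas _
    have hxs : x ∈ φ.source := mem_chart_source E x
    have hfs : f x ∈ ψ.source := mem_chart_source F (f x)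
    set L := tder E F f x with hL
    -- `K` is identified with a complement `C` by its dimension, so that it does not depend on `x`
    obtain ⟨C, hC⟩ := Submodule.exists_isCompl (LinearMap.range (L : E →ₗ[ℝ] F))
    have hdim : Module.finrank ℝ K = Module.finrank ℝ C := by
      have h1 := Submodule.finrank_add_eq_of_isCompl hC
      have h2 := LinearMap.finrank_range_of_inj (f := (L : E →ₗ[ℝ] F)) (hinj x)
      rw [Module.finrank_fin_fun]
      omega
    let a : K ≃ₗ[ℝ] C := LinearEquiv.ofFinrankEq K C hdim
    let A : K →L[ℝ] F := LinearMap.toContinuousLinearMap (C.subtype ∘ₗ a.toLinearMap)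
    have hAC (c : K) : A c ∈ C := (a c).2
    let B : E × K →L[ℝ] F := L.coprod A
    have hB : Function.Bijective B := by
      constructor
      · rw [injective_iff_map_eq_zero]
        rintro ⟨u, c⟩ h
        have h1 : L u + A c = 0 := h
        have h2 : A c = 0 := by
          have : A c ∈ LinearMap.range (L : E →ₗ[ℝ] F) := by
            rw [← neg_eq_of_add_eq_zero_right h1]
            exact neg_mem ⟨u, rfl⟩
          exact (Submodule.disjoint_def.1 hC.disjoint) _ this (hAC c)
        have h3 : u = 0 := hinj x (by rw [map_zero]; simpa [h2] using h1)
        have h4 : c = 0 := a.injective (by rw [map_zero]; exact Subtype.ext h2)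
        rw [h3, h4]
        rfl
      · intro w
        obtain ⟨y, hy, z, hz, rfl⟩ := Submodule.mem_sup.1
          ((hC.sup_eq_top ▸ Submodule.mem_top : w ∈ LinearMap.range (L : E →ₗ[ℝ] F) ⊔ C))
        obtain ⟨u, rfl⟩ := hy
        refine ⟨(u, a.symm ⟨z, hz⟩), ?_⟩
        change L u + (a (a.symm ⟨z, hz⟩) : F) = L u + z
        rw [a.apply_symm_apply]
    -- a local diffeomorphism with differential `B` at `(φ x, 0)`, equal to `f` on `E × 0`
    let g : E × K → F := fun p => ψ (f (φ.symm p.1)) + A p.2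
    have hP : ∀ᶠ z in 𝓝 (φ x), z ∈ φ.target ∧ f (φ.symm z) ∈ ψ.source := by
      refine Filter.Eventually.and (φ.open_target.mem_nhds (φ.map_source hxs)) ?_
      have h1 : ContinuousAt (fun z => f (φ.symm z)) (φ x) :=
        hf.continuous.continuousAt.comp (φ.continuousAt_symm (φ.map_source hxs))
      refine h1.preimage_mem_nhds (ψ.open_source.mem_nhds ?_)
      rwa [φ.left_inv hxs]
    have hs : ∀ᶠ z in 𝓝 (φ x), ContDiffAt ℝ ∞ (fun z => ψ (f (φ.symm z))) z := by
      filter_upwards [hP.eventually_nhds] with z hz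
      have hz' := hz.self_of_nhds
      rw [← contMDiffAt_iff_contDiffAt]
      exact (contMDiffAt_of_mem_maximalAtlas hψ hz'.2).comp z
        (hf.contMDiffAt.comp z (contMDiffAt_symm_of_mem_maximalAtlas hφ hz'.1))
    have ht : Filter.Tendsto (fun p : E × K => p.1) (𝓝 (φ x, 0)) (𝓝 (φ x)) :=
      continuous_fst.tendsto _
    have hg : ∀ᶠ p in 𝓝 ((φ x, 0) : E × K), ContDiffAt ℝ ∞ g p := by
      filter_upwards [ht.eventually hs] with p hp
      exact (hp.comp p contDiffAt_fst).add (A.contDiff.contDiffAt.comp p contDiffAt_snd)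
    have hd : fderiv ℝ g (φ x, 0) = B := by
      have h1 : HasFDerivAt (fun z => ψ (f (φ.symm z))) L (φ x) := by
        rw [hL, tder_eq_fderiv_charts (hf.mdifferentiableAt (by simp))]
        exact (hs.self_of_nhds.differentiableAt (by simp)).hasFDerivAt
      refine HasFDerivAt.fderiv ?_
      have h2 := (HasFDerivAt.comp (x := ((φ x, 0) : E × K)) (f := Prod.fst) h1
        (hasFDerivAt_fst)).add ((A.hasFDerivAt (x := (0 : K))).comp
        (x := ((φ x, 0) : E × K)) (f := Prod.snd) hasFDerivAt_snd)
      exact h2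
    obtain ⟨e, he, heg, heP, he1, he2⟩ := exists_openPartialHomeomorph_of_bijective hg
      (by rw [hd]; exact hB) (ht.eventually hP)
    let D : (E × K) ≃L[ℝ] F :=
      (LinearEquiv.ofBijective (B : E × K →ₗ[ℝ] F) hB).toContinuousLinearEquiv
    let χ : OpenPartialHomeomorph N F := ψ ≫ₕ e.symm ≫ₕ D.toHomeomorph.toOpenPartialHomeomorph
    let U : Set E := {z | (z, (0 : K)) ∈ e.source}
    have hU : IsOpen U := e.open_source.preimage
      (by fun_prop : Continuous fun z : E => (z, (0 : K)))
    let φ' := φ.restr (φ.source ∩ φ ⁻¹' U)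
    have hUo : IsOpen (φ.source ∩ φ ⁻¹' U) := φ.isOpen_inter_preimage hU
    have hgx (z : E) : e (z, 0) = ψ (f (φ.symm z)) := by
      rw [heg]
      change ψ (f (φ.symm z)) + A 0 = _
      rw [map_zero, add_zero]
    refine IsImmersionAtOfComplement.mk_of_continuousAt hf.continuous.continuousAt D φ' χ ?_ ?_
      (restr_mem_maximalAtlas (contDiffGroupoid ∞ 𝓘(ℝ, E)) hφ hUo)
      (mem_maximalAtlas_of_contMDiffOn χ ?_ ?_) ?_
    · rw [OpenPartialHomeomorph.restr_source, hUo.interior_eq]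
      exact ⟨hxs, hxs, he⟩
    · refine ⟨hfs, ?_, trivial⟩
      change ψ (f x) ∈ e.target
      have h1 := hgx (φ x)
      rw [φ.left_inv hxs] at h1
      rw [← h1]
      exact e.map_source he
    · change ContMDiffOn 𝓘(ℝ, F) 𝓘(ℝ, F) ∞ (fun z => D (e.symm (ψ z))) χ.source
      exact D.contDiff.contMDiff.comp_contMDiffOn (he2.contMDiffOn.comp
        ((contMDiffOn_of_mem_maximalAtlas hψ).mono fun z hz => hz.1) fun z hz => hz.2.1)
    · change ContMDiffOn 𝓘(ℝ, F) 𝓘(ℝ, F) ∞ (fun y => ψ.symm (e (D.symm y))) χ.target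
      exact (contMDiffOn_symm_of_mem_maximalAtlas hψ).comp (he1.contMDiffOn.comp
        D.symm.contDiff.contMDiff.contMDiffOn fun y hy => hy.1.2) fun y hy => hy.2
    · intro z hz
      have hz' : z ∈ φ'.target := by simpa using hz
      have h1 := φ'.map_target hz'
      rw [OpenPartialHomeomorph.restr_source, hUo.interior_eq] at h1
      have hzt : z ∈ φ.target := hz'.1
      have h2 : (z, (0 : K)) ∈ e.source := by
        have : φ (φ.symm z) ∈ U := h1.2.2
        rwa [φ.right_inv hzt] at this
      change D (e.symm (ψ (f (φ.symm z)))) = D (z, 0)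
      rw [← hgx, e.left_inv h2]
  exact key.isImmersion

end Immersion

/-! ### Products and powers of manifolds -/

theorem contDiffOn_coord_change {E M : Type*} [NormedAddCommGroup E] [NormedSpace ℝ E]
    [TopologicalSpace M] [ChartedSpace E M] [IsManifold 𝓘(ℝ, E) ∞ M]
    {e e' : OpenPartialHomeomorph M E} (he : e ∈ atlas E M) (he' : e' ∈ atlas E M) :
    ContDiffOn ℝ ∞ (e.symm ≫ₕ e') (e.symm ≫ₕ e').source := by
  have h := HasGroupoid.compatible (G := contDiffGroupoid ∞ 𝓘(ℝ, E)) he he'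
  rw [contDiffGroupoid, mem_groupoid_of_pregroupoid] at h
  simpa [contDiffPregroupoid] using h.1

section Prod

variable {E F M N EX X : Type*} [NormedAddCommGroup E] [NormedSpace ℝ E]
  [NormedAddCommGroup F] [NormedSpace ℝ F]
  [TopologicalSpace M] [ChartedSpace E M] [TopologicalSpace N] [ChartedSpace F N]
  [NormedAddCommGroup EX] [NormedSpace ℝ EX] [TopologicalSpace X] [ChartedSpace EX X]

/-- The product of manifolds without boundary, modelled on the product of the model spaces. -/
instance prodCharted : ChartedSpace (E × F) (M × N) := prodChartedSpace E M F N

instance [IsManifold 𝓘(ℝ, E) ∞ M] [IsManifold 𝓘(ℝ, F) ∞ N] :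
    IsManifold 𝓘(ℝ, E × F) ∞ (M × N) := by
  rw [modelWithCornersSelf_prod]
  exact IsManifold.prod M N

theorem contMDiffAt_prodModel_iff {f : X → M × N} {x : X} :
    ContMDiffAt 𝓘(ℝ, EX) 𝓘(ℝ, E × F) ∞ f x ↔
      ContMDiffAt 𝓘(ℝ, EX) 𝓘(ℝ, E) ∞ (fun z => (f z).1) x ∧
        ContMDiffAt 𝓘(ℝ, EX) 𝓘(ℝ, F) ∞ (fun z => (f z).2) x := by
  rw [modelWithCornersSelf_prod]
  exact contMDiffAt_prod_iff f

theorem contMDiff_fst' : ContMDiff 𝓘(ℝ, E × F) 𝓘(ℝ, E) ∞ (Prod.fst : M × N → M) :=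
  fun x => (contMDiffAt_prodModel_iff.1 (contMDiffAt_id (x := x))).1

theorem contMDiff_snd' : ContMDiff 𝓘(ℝ, E × F) 𝓘(ℝ, F) ∞ (Prod.snd : M × N → N) :=
  fun x => (contMDiffAt_prodModel_iff.1 (contMDiffAt_id (x := x))).2

theorem tder_fst (y : M × N) :
    tder (E × F) E (Prod.fst : M × N → M) y = ContinuousLinearMap.fst ℝ E F := by
  rw [tder, modelWithCornersSelf_prod]
  exact mfderiv_fst

theorem tder_snd (y : M × N) :
    tder (E × F) F (Prod.snd : M × N → N) y = ContinuousLinearMap.snd ℝ E F := by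
  rw [tder, modelWithCornersSelf_prod]
  exact mfderiv_snd

theorem tder_prod_apply {f : X → M × N} {x : X}
    (hf : MDifferentiableAt 𝓘(ℝ, EX) 𝓘(ℝ, E × F) f x) (w : EX) :
    tder EX (E × F) f x w =
      (tder EX E (fun z => (f z).1) x w, tder EX F (fun z => (f z).2) x w) := by
  rw [tder_comp rfl (contMDiff_fst'.mdifferentiable (by simp) _) hf,
    tder_comp rfl (contMDiff_snd'.mdifferentiable (by simp) _) hf, tder_fst, tder_snd]
  rfl

end Prod

section Pow

variable {ι : Type*} [Fintype ι] {E M EX X : Type*} [NormedAddCommGroup E] [NormedSpace ℝ E]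
  [TopologicalSpace M] [ChartedSpace E M]
  [NormedAddCommGroup EX] [NormedSpace ℝ EX] [TopologicalSpace X] [ChartedSpace EX X]

/-- The power of a manifold without boundary, modelled on the power of the model space. -/
instance powCharted : ChartedSpace (ι → E) (ι → M) :=
  piChartedSpace (fun _ : ι => E) (fun _ : ι => M)

theorem chartAt_pow (y z : ι → M) (i : ι) : chartAt (ι → E) y z i = chartAt E (y i) (z i) := rfl

instance [IsManifold 𝓘(ℝ, E) ∞ M] : IsManifold 𝓘(ℝ, ι → E) ∞ (ι → M) := by
  refine isManifold_of_contDiffOn _ _ _ ?_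
  rintro _ _ ⟨e, he, rfl⟩ ⟨e', he', rfl⟩
  simp only [modelWithCornersSelf_coe, modelWithCornersSelf_coe_symm, Set.range_id, Set.inter_univ,
    Function.comp_id, Function.id_comp, Set.preimage_id]
  rw [contDiffOn_pi]
  intro i
  have h := contDiffOn_coord_change (he i trivial) (he' i trivial)
  refine h.comp (contDiff_apply ℝ E i).contDiffOn fun z hz => ?_
  exact ⟨hz.1 i trivial, hz.2 i trivial⟩

theorem contMDiffAt_pow_iff {f : X → ι → M} {x : X} :
    ContMDiffAt 𝓘(ℝ, EX) 𝓘(ℝ, ι → E) ∞ f x ↔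
      ∀ i, ContMDiffAt 𝓘(ℝ, EX) 𝓘(ℝ, E) ∞ (fun z => f z i) x := by
  simp only [contMDiffAt_iff, forall_and]
  refine and_congr continuousAt_pi ?_
  rw [contDiffWithinAt_pi]
  rfl

theorem contMDiff_eval (i : ι) : ContMDiff 𝓘(ℝ, ι → E) 𝓘(ℝ, E) ∞ (fun y : ι → M => y i) :=
  fun x => contMDiffAt_pow_iff.1 (contMDiffAt_id (x := x)) i

theorem tder_eval (y : ι → M) (i : ι) :
    tder (ι → E) E (fun z : ι → M => z i) y = ContinuousLinearMap.proj i := by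
  rw [tder, (contMDiff_eval i |>.mdifferentiable (by simp) y).mfderiv]
  simp only [writtenInExtChartAt, modelWithCornersSelf_coe, Set.range_id, fderivWithin_univ]
  have h : (fun z : ι → E => chartAt E (y i) (((chartAt (ι → E) y).symm z) i))
      =ᶠ[𝓝 (chartAt (ι → E) y y)] fun z => z i := by
    filter_upwards [(chartAt (ι → E) y).open_target.mem_nhds (mem_chart_target (ι → E) y)] with z hz
    rw [← chartAt_pow, (chartAt (ι → E) y).right_inv hz]
  exact h.fderiv_eq.trans (ContinuousLinearMap.proj (R := ℝ) (φ := fun _ : ι => E) i).fderiv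

theorem tder_pow_apply {f : X → ι → M} {x : X}
    (hf : MDifferentiableAt 𝓘(ℝ, EX) 𝓘(ℝ, ι → E) f x) (w : EX) (i : ι) :
    tder EX (ι → E) f x w i = tder EX E (fun z => f z i) x w := by
  rw [tder_comp (g := fun y : ι → M => y i) rfl ((contMDiff_eval i).mdifferentiable (by simp) _) hf,
    tder_eval]
  rfl

end Pow

/-! ### Étale maps and manifold structures pulled back along them -/

section Etale

variable {E N X EZ Z : Type*} [NormedAddCommGroup E] [NormedSpace ℝ E]
  [TopologicalSpace N] [ChartedSpace E N] [TopologicalSpace X]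
  [NormedAddCommGroup EZ] [NormedSpace ℝ EZ] [TopologicalSpace Z] [ChartedSpace EZ Z]

/-- The charts of `N`, pulled back along a local homeomorphism `X → N`. -/
abbrev etaleCharted {π : X → N} (hπ : IsLocalHomeomorph π) : ChartedSpace E X where
  atlas := Set.range fun x => (hπ x).choose ≫ₕ chartAt E (π x)
  chartAt x := (hπ x).choose ≫ₕ chartAt E (π x)
  mem_chart_source x := by
    refine ⟨(hπ x).choose_spec.1, ?_⟩
    change (hπ x).choose x ∈ (chartAt E (π x)).source
    rw [← (hπ x).choose_spec.2]
    exact mem_chart_source E (π x)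
  chart_mem_atlas x := ⟨x, rfl⟩

/-- Where they are defined, the coordinate changes of `X` are those of `N`. -/
theorem etale_isManifold [IsManifold 𝓘(ℝ, E) ∞ N] {π : X → N} (hπ : IsLocalHomeomorph π) :
    letI := etaleCharted (E := E) hπ
    IsManifold 𝓘(ℝ, E) ∞ X := by
  let := etaleCharted (E := E) hπ
  refine isManifold_of_contDiffOn _ _ _ ?_
  rintro _ _ ⟨x, rfl⟩ ⟨y, rfl⟩
  simp only [modelWithCornersSelf_coe, modelWithCornersSelf_coe_symm, Set.range_id, Set.inter_univ,
    Function.comp_id, Function.id_comp, Set.preimage_id]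
  obtain ⟨hx1, hx2⟩ := (hπ x).choose_spec
  obtain ⟨hy1, hy2⟩ := (hπ y).choose_spec
  set e := (hπ x).choose
  set e' := (hπ y).choose
  have h := contDiffOn_coord_change (chart_mem_atlas E (π x)) (chart_mem_atlas E (π y))
  have key : ∀ z ∈ ((e ≫ₕ chartAt E (π x)).symm ≫ₕ e' ≫ₕ chartAt E (π y)).source,
      z ∈ (chartAt E (π x)).target ∧
        e' (e.symm ((chartAt E (π x)).symm z)) = (chartAt E (π x)).symm z := by
    intro z hz
    refine ⟨hz.1.1, ?_⟩
    exact ((congrFun hy2 _).symm.trans (congrFun hx2 _)).trans (e.right_inv hz.1.2)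
  refine (h.mono fun z hz => ⟨(key z hz).1, ?_⟩).congr fun z hz => ?_
  · change (chartAt E (π x)).symm z ∈ (chartAt E (π y)).source
    rw [← (key z hz).2]
    exact hz.2.2
  · change chartAt E (π y) (e' (e.symm ((chartAt E (π x)).symm z))) = _
    rw [(key z hz).2]
    rfl

/-- `π : X → N` identifies the preferred charts of `X` with those of `N`. -/
structure IsEtale [ChartedSpace E X] (π : X → N) : Prop where
  continuous : Continuous π
  chart_eq : ∀ x y, chartAt E x y = chartAt E (π x) (π y)

theorem etaleCharted_isEtale {π : X → N} (hπ : IsLocalHomeomorph π) :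
    letI := etaleCharted (E := E) hπ
    IsEtale (E := E) π :=
  letI := etaleCharted (E := E) hπ
  ⟨hπ.continuous, fun x y => by
    change chartAt E (π x) ((hπ x).choose y) = _
    rw [← (hπ x).choose_spec.2]⟩

/-- The manifold structure pulled back along a local homeomorphism. -/
def etaleStr {E : Type v} {X : Type u} {N : Type*} [NormedAddCommGroup E] [NormedSpace ℝ E]
    [CompleteSpace E]
    [TopologicalSpace N] [ChartedSpace E N] [IsManifold 𝓘(ℝ, E) ∞ N] [TopologicalSpace X]
    [T2Space X] {π : X → N} (hπ : IsLocalHomeomorph π) : ManifoldStr.{u, v} X :=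
  letI := etaleCharted (E := E) hπ
  haveI := etale_isManifold (E := E) hπ
  { E := E }

variable [ChartedSpace E X] {π : X → N}

namespace IsEtale

variable (hπ : IsEtale (E := E) π)
include hπ

theorem contMDiffAt_iff {f : Z → X} {z : Z} :
    ContMDiffAt 𝓘(ℝ, EZ) 𝓘(ℝ, E) ∞ f z ↔
      ContinuousAt f z ∧ ContMDiffAt 𝓘(ℝ, EZ) 𝓘(ℝ, E) ∞ (fun w => π (f w)) z := by
  have h : (fun y => extChartAt 𝓘(ℝ, E) (f z) y) =
      fun y => extChartAt 𝓘(ℝ, E) (π (f z)) (π y) := funext (hπ.chart_eq (f z))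
  rw [_root_.contMDiffAt_iff, _root_.contMDiffAt_iff]
  change _ ∧ ContDiffWithinAt ℝ ∞ ((fun y => extChartAt 𝓘(ℝ, E) (f z) y) ∘ _) _ _ ↔ _
  rw [h]
  exact ⟨fun a => ⟨a.1, hπ.continuous.continuousAt.comp a.1, a.2⟩, fun a => ⟨a.1, a.2.2⟩⟩

theorem contMDiff : ContMDiff 𝓘(ℝ, E) 𝓘(ℝ, E) ∞ π :=
  fun x => (hπ.contMDiffAt_iff.1 (contMDiffAt_id (x := x))).2

theorem tder_eq_id (x : X) : tder E E π x = ContinuousLinearMap.id ℝ E := by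
  rw [tder, (hπ.contMDiff.mdifferentiable (by simp) x).mfderiv]
  simp only [writtenInExtChartAt, modelWithCornersSelf_coe, Set.range_id, fderivWithin_univ]
  have h : (fun z : E => chartAt E (π x) (π ((chartAt E x).symm z)))
      =ᶠ[𝓝 (chartAt E x x)] fun z => z := by
    filter_upwards [(chartAt E x).open_target.mem_nhds (mem_chart_target E x)] with z hz
    rw [← hπ.chart_eq, (chartAt E x).right_inv hz]
  exact h.fderiv_eq.trans fderiv_id

end IsEtale

/-- A continuous lift of a smooth map along a local diffeomorphism is smooth. -/
theorem contMDiffAt_of_comp_isLocalDiffeomorphAt {EM M EG G : Type*}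
    [NormedAddCommGroup EM] [NormedSpace ℝ EM] [TopologicalSpace M] [ChartedSpace EM M]
    [NormedAddCommGroup EG] [NormedSpace ℝ EG] [TopologicalSpace G] [ChartedSpace EG G]
    {Q : M → G} {y : Z → M} {z : Z} (hy : ContinuousAt y z)
    (hQ : IsLocalDiffeomorphAt 𝓘(ℝ, EM) 𝓘(ℝ, EG) ∞ Q (y z))
    (hQy : ContMDiffAt 𝓘(ℝ, EZ) 𝓘(ℝ, EG) ∞ (fun w => Q (y w)) z) :
    ContMDiffAt 𝓘(ℝ, EZ) 𝓘(ℝ, EM) ∞ y z := by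
  have h1 : (fun w => hQ.localInverse (Q (y w))) =ᶠ[𝓝 z] y :=
    hy.eventually hQ.localInverse_eventuallyEq_left
  exact (hQ.localInverse_contMDiffAt.comp z hQy).congr_of_eventuallyEq h1.symm

end Etale

/-- Let `X` be the space of all `(n, m) ∈ N × M ^ ι` such that the `Q (m i)` are given functions of
`n`. If `Q` is a local homeomorphism, then so is the projection `X → N`. -/
theorem isLocalHomeomorph_of_lift {X N M G ι : Type*} [Finite ι] [TopologicalSpace X]
    [TopologicalSpace N] [TopologicalSpace M] [TopologicalSpace G] {π : X → N} {ρ : X → ι → M}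
    {Q : M → G} (hQ : IsLocalHomeomorph Q) {g : N → ι → G} (hg : Continuous g)
    (hemb : Topology.IsEmbedding fun x => (π x, ρ x)) (hcomm : ∀ x i, Q (ρ x i) = g (π x) i)
    (hlift : ∀ n m, (∀ i, Q (m i) = g n i) → ∃ x, π x = n ∧ ρ x = m) :
    IsLocalHomeomorph π := by
  classical
  intro x₀
  choose e he heQ using fun i => hQ (ρ x₀ i)
  have hlift' : ∀ n, (∀ i, g n i ∈ (e i).target) →
      ∃ x, π x = n ∧ ρ x = fun i => (e i).symm (g n i) := by
    intro n hn
    refine hlift n _ fun i => ?_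
    rw [heQ i, (e i).right_inv (hn i)]
  let s : N → X := fun n => if h : ∀ i, g n i ∈ (e i).target then (hlift' n h).choose else x₀
  have hs (n : N) (h : ∀ i, g n i ∈ (e i).target) :
      π (s n) = n ∧ ρ (s n) = fun i => (e i).symm (g n i) := by
    have : s n = (hlift' n h).choose := dif_pos h
    rw [this]
    exact (hlift' n h).choose_spec
  have hπc : Continuous π := continuous_fst.comp hemb.continuous
  have hρc : Continuous ρ := continuous_snd.comp hemb.continuous
  have hgi (i : ι) : Continuous fun n => g n i := (continuous_apply i).comp hg
  refine ⟨{ toFun := π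
            invFun := s
            source := {x | ∀ i, ρ x i ∈ (e i).source}
            target := {n | ∀ i, g n i ∈ (e i).target}
            map_source' := fun x hx i => ?_
            map_target' := fun n hn i => ?_
            left_inv' := fun x hx => ?_
            right_inv' := fun n hn => (hs n hn).1
            open_source := ?_
            open_target := ?_
            continuousOn_toFun := hπc.continuousOn
            continuousOn_invFun := ?_ }, he, rfl⟩
  · rw [← hcomm, heQ i]
    exact (e i).map_source (hx i)
  · rw [(hs n hn).2]
    exact (e i).map_target (hn i)
  · have hn : ∀ i, g (π x) i ∈ (e i).target := fun i => by
      rw [← hcomm, heQ i]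
      exact (e i).map_source (hx i)
    refine hemb.injective (Prod.ext (hs _ hn).1 ?_)
    refine (hs _ hn).2.trans (funext fun i => ?_)
    rw [← hcomm, heQ i, (e i).left_inv (hx i)]
  · rw [hemb.continuousOn_iff]
    have : ContinuousOn (fun n => (n, fun i => (e i).symm (g n i)))
        {n | ∀ i, g n i ∈ (e i).target} :=
      continuousOn_id.prodMk (continuousOn_pi.2 fun i =>
        (e i).continuousOn_symm.comp (hgi i).continuousOn fun n hn => hn i)
    exact this.congr fun n hn => Prod.ext (hs n hn).1 (hs n hn).2
  · simp only [Set.ofPred_forall]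
    exact isOpen_iInter_of_finite fun i =>
      (e i).open_source.preimage ((continuous_apply i).comp hρc)
  · simp only [Set.ofPred_forall]
    exact isOpen_iInter_of_finite fun i => (e i).open_target.preimage (hgi i)

/-! ### Simplices of the codiagonal as cocycles -/

section Combinatorics

variable {G : Type*} {Hp Hm : Type u} [Group G] [Group Hp] [Group Hm]
  {φp : Hp →* G} {φm : Hm →* G} {n : ℕ}

/-- The cell with rows `p ≤ p'` and columns `q ≤ q'` of an `n`-simplex of the codiagonal, where
`p' ≤ k ≤ q`, read off from its `k`-th component. -/
def cellAt (x : CodiagonalObj (doubleNerve φp φm) n) (k p p' q q' : ℕ) (h1 : p ≤ p') (h2 : p' ≤ k)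
    (h3 : k ≤ q) (h4 : q ≤ q') (h5 : q' ≤ n) : LWSquare φp φm :=
  Grid.cell (φp := φp) (φm := φm) (P := Fin (k + 1)) (Q := Fin (n - k + 1)) (x.1 ⟨k, by omega⟩)
    ⟨(⟨p, by omega⟩, ⟨p', by omega⟩), h1⟩
    ⟨(⟨q - k, by omega⟩, ⟨q' - k, by omega⟩), Fin.mk_le_mk.2 (Nat.sub_le_sub_right h4 k)⟩

variable (x : CodiagonalObj (doubleNerve φp φm) n)

/-- A cell does not depend on the component from which it is read off. -/
theorem cellAt_eq (k k' p p' q q' : ℕ) (h1 : p ≤ p') (h2 : p' ≤ k) (hk : k ≤ k') (h3 : k' ≤ q)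
    (h4 : q ≤ q') (h5 : q' ≤ n) :
    cellAt x k p p' q q' h1 h2 (hk.trans h3) h4 h5 =
      cellAt x k' p p' q q' h1 (h2.trans hk) h3 h4 h5 := by
  have h := congrArg (fun g => Grid.cell (φp := φp) (φm := φm) (P := Fin (k + 1))
    (Q := Fin (n - k' + 1)) g ⟨(⟨p, by omega⟩, ⟨p', by omega⟩), h1⟩
    ⟨(⟨q - k', by omega⟩, ⟨q' - k', by omega⟩), Fin.mk_le_mk.2 (Nat.sub_le_sub_right h4 k')⟩)
    (x.compat k k' hk (by omega))
  refine Eq.trans ?_ h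
  unfold cellAt
  refine congrArg (Grid.cell (φp := φp) (φm := φm) (P := Fin (k + 1)) (Q := Fin (n - k + 1))
    (x.1 ⟨k, by omega⟩) _) ?_
  refine Subtype.ext (Prod.ext (Fin.ext ?_) (Fin.ext ?_))
  · change q - k = q - k' + (k' - k)
    omega
  · change q' - k = q' - k' + (k' - k)
    omega

theorem cellAt_hMul (k p p' q q' q'' : ℕ) (h1 : p ≤ p') (h2 : p' ≤ k) (h3 : k ≤ q) (h4 : q ≤ q')
    (h5 : q' ≤ q'') (h6 : q'' ≤ n) :
    ∃ hc : (cellAt x k p p' q q' h1 h2 h3 h4 (h5.trans h6)).right =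
        (cellAt x k p p' q' q'' h1 h2 (h3.trans h4) h5 h6).left,
      (cellAt x k p p' q q' h1 h2 h3 h4 (h5.trans h6)).hMul
        (cellAt x k p p' q' q'' h1 h2 (h3.trans h4) h5 h6) hc =
      cellAt x k p p' q q'' h1 h2 h3 (h4.trans h5) h6 :=
  Grid.horizontal (φp := φp) (φm := φm) (P := Fin (k + 1)) (Q := Fin (n - k + 1))
    (x.1 ⟨k, by omega⟩) ⟨(⟨p, by omega⟩, ⟨p', by omega⟩), h1⟩ ⟨q - k, by omega⟩
    ⟨q' - k, by omega⟩ ⟨q'' - k, by omega⟩ (Fin.mk_le_mk.2 (Nat.sub_le_sub_right h4 k))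
    (Fin.mk_le_mk.2 (Nat.sub_le_sub_right h5 k))

theorem cellAt_vMul (k p p' p'' q q' : ℕ) (h1 : p ≤ p') (h1' : p' ≤ p'') (h2 : p'' ≤ k)
    (h3 : k ≤ q) (h4 : q ≤ q') (h5 : q' ≤ n) :
    ∃ hc : (cellAt x k p p' q q' h1 (h1'.trans h2) h3 h4 h5).bottom =
        (cellAt x k p' p'' q q' h1' h2 h3 h4 h5).top,
      (cellAt x k p p' q q' h1 (h1'.trans h2) h3 h4 h5).vMul
        (cellAt x k p' p'' q q' h1' h2 h3 h4 h5) hc =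
      cellAt x k p p'' q q' (h1.trans h1') h2 h3 h4 h5 :=
  Grid.vertical (φp := φp) (φm := φm) (P := Fin (k + 1)) (Q := Fin (n - k + 1))
    (x.1 ⟨k, by omega⟩) ⟨(⟨q - k, by omega⟩, ⟨q' - k, by omega⟩), _⟩ ⟨p, by omega⟩
    ⟨p', by omega⟩ ⟨p'', by omega⟩ h1 h1'

/-- The `H₋`-component of the edge `i ≤ j`. -/
def edgeM (i j : ℕ) (h : i ≤ j) (hn : j ≤ n) : Hm :=
  (cellAt x i i i i j le_rfl le_rfl le_rfl h hn).top

/-- The `H₊`-component of the edge `i ≤ j`. -/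
def edgeP (i j : ℕ) (h : i ≤ j) (hn : j ≤ n) : Hp :=
  (cellAt x j i j j j h le_rfl le_rfl le_rfl hn).left

theorem edgeM_self (i : ℕ) (hn : i ≤ n) : edgeM x i i le_rfl hn = 1 := by
  have h := Grid.horizontal_unit (φp := φp) (φm := φm) (P := Fin (i + 1)) (Q := Fin (n - i + 1))
    (x.1 ⟨i, by omega⟩) ⟨(⟨i, by omega⟩, ⟨i, by omega⟩), le_rfl⟩ ⟨i - i, by omega⟩
  exact congrArg LWSquare.top h

theorem edgeP_self (i : ℕ) (hn : i ≤ n) : edgeP x i i le_rfl hn = 1 := by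
  have h := Grid.vertical_unit (φp := φp) (φm := φm) (P := Fin (i + 1)) (Q := Fin (n - i + 1))
    (x.1 ⟨i, by omega⟩) ⟨(⟨i - i, by omega⟩, ⟨i - i, by omega⟩), le_rfl⟩ ⟨i, by omega⟩
  exact congrArg LWSquare.left h

section

variable (k p p' q q' : ℕ) (h1 : p ≤ p') (h2 : p' ≤ k) (h3 : k ≤ q) (h4 : q ≤ q') (h5 : q' ≤ n)

theorem cellAt_left_self : (cellAt x k p p' q q h1 h2 h3 le_rfl (h4.trans h5)).left =
    edgeP x p q (h1.trans (h2.trans h3)) (h4.trans h5) *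
      (edgeP x p' q (h2.trans h3) (h4.trans h5))⁻¹ := by
  obtain ⟨_, h⟩ := cellAt_vMul x q p p' q q q h1 (h2.trans h3) le_rfl le_rfl le_rfl (h4.trans h5)
  rw [eq_mul_inv_iff_mul_eq, cellAt_eq x k q p p' q q h1 h2 h3 le_rfl le_rfl (h4.trans h5)]
  exact congrArg LWSquare.left h

theorem cellAt_left : (cellAt x k p p' q q' h1 h2 h3 h4 h5).left =
    edgeP x p q (h1.trans (h2.trans h3)) (h4.trans h5) *
      (edgeP x p' q (h2.trans h3) (h4.trans h5))⁻¹ := by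
  obtain ⟨_, h⟩ := cellAt_hMul x k p p' q q q' h1 h2 h3 le_rfl h4 h5
  rw [← h]
  exact cellAt_left_self x k p p' q q' h1 h2 h3 h4 h5

theorem cellAt_right : (cellAt x k p p' q q' h1 h2 h3 h4 h5).right =
    edgeP x p q' (h1.trans (h2.trans (h3.trans h4))) h5 *
      (edgeP x p' q' (h2.trans (h3.trans h4)) h5)⁻¹ := by
  obtain ⟨h, _⟩ := cellAt_hMul x k p p' q q' q' h1 h2 h3 h4 le_rfl h5
  rw [h]
  exact cellAt_left_self x k p p' q' q' h1 h2 (h3.trans h4) le_rfl h5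

theorem cellAt_top_self (hk : p ≤ k) : (cellAt x k p p q q' le_rfl hk h3 h4 h5).top =
    (edgeM x p q (hk.trans h3) (h4.trans h5))⁻¹ * edgeM x p q' (hk.trans (h3.trans h4)) h5 := by
  obtain ⟨_, h⟩ := cellAt_hMul x p p p p q q' le_rfl le_rfl le_rfl (hk.trans h3) h4 h5
  rw [eq_inv_mul_iff_mul_eq, ← cellAt_eq x p k p p q q' le_rfl le_rfl hk h3 h4 h5]
  exact congrArg LWSquare.top h

theorem cellAt_top : (cellAt x k p p' q q' h1 h2 h3 h4 h5).top =
    (edgeM x p q (h1.trans (h2.trans h3)) (h4.trans h5))⁻¹ *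
      edgeM x p q' (h1.trans (h2.trans (h3.trans h4))) h5 := by
  obtain ⟨_, h⟩ := cellAt_vMul x k p p p' q q' le_rfl h1 h2 h3 h4 h5
  rw [← h]
  exact cellAt_top_self x k p q q' h3 h4 h5 (h1.trans h2)

theorem cellAt_bottom : (cellAt x k p p' q q' h1 h2 h3 h4 h5).bottom =
    (edgeM x p' q (h2.trans h3) (h4.trans h5))⁻¹ *
      edgeM x p' q' (h2.trans (h3.trans h4)) h5 := by
  obtain ⟨h, _⟩ := cellAt_vMul x k p p' p' q q' h1 le_rfl h2 h3 h4 h5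
  rw [h]
  exact cellAt_top_self x k p' q q' h3 h4 h5 h2

end

variable (φp φm) in
/-- The multiplication map `H₋ × H₊ → G`. -/
def mulMap (y : Hm × Hp) : G := φm y.1 * φp y.2

theorem mulMap_one : mulMap φp φm 1 = 1 := by simp [mulMap]

variable (φp φm) in
/-- Families `y i j ∈ H₋ × H₊`, the images of which in `G` form a cocycle `g i j * g j k = g i k`.
Values at `j ≤ i` are normalized to `1`. -/
structure IsCocycle (y : Fin (n + 1) → Fin (n + 1) → Hm × Hp) : Prop where
  eq_one : ∀ i j, j ≤ i → y i j = 1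
  mul : ∀ i j k, i ≤ j → j ≤ k →
    mulMap φp φm (y i j) * mulMap φp φm (y j k) = mulMap φp φm (y i k)

/-- The edges of a simplex of the codiagonal. -/
def edge (x : CodiagonalObj (doubleNerve φp φm) n) (i j : Fin (n + 1)) : Hm × Hp :=
  if h : i ≤ j then
    (edgeM x i j h (Nat.le_of_lt_succ j.2),
      edgeP x i j h (Nat.le_of_lt_succ j.2))
  else 1

theorem edge_of_le (x : CodiagonalObj (doubleNerve φp φm) n) {i j : Fin (n + 1)} (h : i ≤ j) :
    edge x i j = (edgeM x i j h (Nat.le_of_lt_succ j.2),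
      edgeP x i j h (Nat.le_of_lt_succ j.2)) := dif_pos h

/-- The element of `Γ` with rows `p ≤ p'` and columns `q ≤ q'` defined by a cocycle. -/
def IsCocycle.square {y : Fin (n + 1) → Fin (n + 1) → Hm × Hp} (hy : IsCocycle φp φm y)
    (p p' q q' : Fin (n + 1)) (h1 : p ≤ p') (h2 : p' ≤ q) (h3 : q ≤ q') : LWSquare φp φm where
  left := (y p q).2 * (y p' q).2⁻¹
  top := (y p q).1⁻¹ * (y p q').1
  bottom := (y p' q).1⁻¹ * (y p' q').1
  right := (y p q').2 * (y p' q').2⁻¹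
  comm := by
    have e1 := hy.mul p p' q h1 h2
    have e2 := hy.mul p p' q' h1 (h2.trans h3)
    have e3 : mulMap φp φm (y p q) * (mulMap φp φm (y p' q))⁻¹ * mulMap φp φm (y p' q') =
        mulMap φp φm (y p q') := by
      rw [← e1, ← e2]
      group
    simp only [mulMap, mul_inv_rev] at e3
    simp only [map_mul, map_inv]
    rw [← mul_assoc ((φm (y p q).1)⁻¹ * _), eq_mul_inv_iff_mul_eq, mul_assoc ((φm (y p q).1)⁻¹),
      eq_inv_mul_iff_mul_eq, ← e3]
    simp only [mul_assoc]

section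

variable {y : Fin (n + 1) → Fin (n + 1) → Hm × Hp} (hy : IsCocycle φp φm y)
  (p p' q q' : Fin (n + 1)) (h1 : p ≤ p') (h2 : p' ≤ q) (h3 : q ≤ q')

theorem IsCocycle.square_left :
    (hy.square p p' q q' h1 h2 h3).left = (y p q).2 * (y p' q).2⁻¹ := rfl

theorem IsCocycle.square_top :
    (hy.square p p' q q' h1 h2 h3).top = (y p q).1⁻¹ * (y p q').1 := rfl

theorem IsCocycle.square_bottom :
    (hy.square p p' q q' h1 h2 h3).bottom = (y p' q).1⁻¹ * (y p' q').1 := rfl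

theorem IsCocycle.square_right :
    (hy.square p p' q q' h1 h2 h3).right = (y p q').2 * (y p' q').2⁻¹ := rfl

end

/-- The relation `g i j * g j k = g i k` is the defining relation of `Γ`, for the cell with rows `i
≤ j` and columns `j ≤ k`. -/
theorem edge_isCocycle (x : CodiagonalObj (doubleNerve φp φm) n) : IsCocycle φp φm (edge x) where
  eq_one i j hij := by
    rcases hij.eq_or_lt with rfl | h
    · rw [edge_of_le x le_rfl, edgeM_self, edgeP_self]
      rfl
    · exact dif_neg (not_le.2 h)
  mul i j k hij hjk := by
    have hk := Nat.le_of_lt_succ k.2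
    have h := (cellAt x j i j j k hij le_rfl le_rfl hjk hk).comm
    rw [cellAt_left, cellAt_bottom, cellAt_top, cellAt_right, edgeM_self, edgeP_self] at h
    simp only [inv_one, one_mul, mul_one, map_mul, map_inv] at h
    rw [edge_of_le x hij, edge_of_le x hjk, edge_of_le x (hij.trans hjk)]
    simp only [mulMap]
    rw [mul_assoc, ← mul_assoc (φp _) (φm _), h]
    simp only [mul_assoc, inv_mul_cancel, mul_one, mul_inv_cancel_left]

theorem cellAt_eq_square (x : CodiagonalObj (doubleNerve φp φm) n) (k p p' q q' : ℕ) (h1 : p ≤ p')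
    (h2 : p' ≤ k) (h3 : k ≤ q) (h4 : q ≤ q') (h5 : q' ≤ n) :
    cellAt x k p p' q q' h1 h2 h3 h4 h5 =
      (edge_isCocycle x).square ⟨p, by omega⟩ ⟨p', by omega⟩ ⟨q, by omega⟩ ⟨q', by omega⟩
        h1 (h2.trans h3) h4 := by
  have e1 : (⟨p, by omega⟩ : Fin (n + 1)) ≤ ⟨q, by omega⟩ := h1.trans (h2.trans h3)
  have e2 : (⟨p, by omega⟩ : Fin (n + 1)) ≤ ⟨q', by omega⟩ := h1.trans (h2.trans (h3.trans h4))
  have e3 : (⟨p', by omega⟩ : Fin (n + 1)) ≤ ⟨q, by omega⟩ := h2.trans h3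
  have e4 : (⟨p', by omega⟩ : Fin (n + 1)) ≤ ⟨q', by omega⟩ := h2.trans (h3.trans h4)
  ext
  · rw [cellAt_left, IsCocycle.square_left, edge_of_le x e1, edge_of_le x e3]
  · rw [cellAt_top, IsCocycle.square_top, edge_of_le x e1, edge_of_le x e2]
  · rw [cellAt_bottom, IsCocycle.square_bottom, edge_of_le x e3, edge_of_le x e4]
  · rw [cellAt_right, IsCocycle.square_right, edge_of_le x e2, edge_of_le x e4]

theorem cell_index_lt (k : Fin (n + 1)) (c : Fin (n - (k : ℕ) + 1)) : (c : ℕ) + k < n + 1 := by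
  have := c.2
  have := k.2
  omega

theorem row_index_lt (k : Fin (n + 1)) (r : Fin ((k : ℕ) + 1)) : (r : ℕ) < n + 1 := by
  have := r.2
  have := k.2
  omega

theorem row_le_column (k : Fin (n + 1)) (r : Fin ((k : ℕ) + 1)) (c : Fin (n - (k : ℕ) + 1)) :
    (⟨r, row_index_lt k r⟩ : Fin (n + 1)) ≤ ⟨c + k, cell_index_lt k c⟩ :=
  Fin.mk_le_mk.2 ((Nat.le_of_lt_succ r.2).trans (Nat.le_add_left _ _))

/-- The entries of a simplex of the codiagonal, in terms of its edges. -/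
theorem cell_eq_square (x : CodiagonalObj (doubleNerve φp φm) n) (k : Fin (n + 1))
    (r : Ivl (Fin ((k : ℕ) + 1))) (c : Ivl (Fin (n - (k : ℕ) + 1))) :
    Grid.cell (φp := φp) (φm := φm) (P := Fin ((k : ℕ) + 1)) (Q := Fin (n - (k : ℕ) + 1))
      (x.1 k) r c =
    (edge_isCocycle x).square ⟨r.1.1, row_index_lt k _⟩ ⟨r.1.2, row_index_lt k _⟩
      ⟨c.1.1 + k, cell_index_lt k _⟩ ⟨c.1.2 + k, cell_index_lt k _⟩ r.2 (row_le_column k _ _)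
      (Fin.mk_le_mk.2 (Nat.add_le_add_right c.2 _)) := by
  have h1 := Nat.le_of_lt_succ r.1.2.2
  have h2 := Nat.le_of_lt_succ (cell_index_lt k c.1.2)
  rw [← cellAt_eq_square x k _ _ _ _ r.2 h1 (Nat.le_add_left _ _) (Nat.add_le_add_right c.2 _) h2]
  refine congrArg (Grid.cell (φp := φp) (φm := φm) (P := Fin ((k : ℕ) + 1))
    (Q := Fin (n - (k : ℕ) + 1)) (x.1 k) _) (Subtype.ext (Prod.ext (Fin.ext ?_) (Fin.ext ?_)))
  · exact (Nat.add_sub_cancel _ _).symm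
  · exact (Nat.add_sub_cancel _ _).symm

/-- A simplex of the codiagonal is determined by its edges. -/
theorem edge_injective :
    Function.Injective (edge : CodiagonalObj (doubleNerve φp φm) n → _) := by
  intro x y h
  refine Subtype.ext (funext fun k => ?_)
  refine Grid.ext (φp := φp) (φm := φm) (P := Fin ((k : ℕ) + 1)) (Q := Fin (n - (k : ℕ) + 1)) ?_
  funext r c
  rw [cell_eq_square, cell_eq_square]
  ext <;> simp only [IsCocycle.square_left, IsCocycle.square_top, IsCocycle.square_bottom,
    IsCocycle.square_right, h]

/-- The simplicial operators of the codiagonal reindex the vertices. -/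
theorem edge_map {m : ℕ} (f : ⦋m⦌ ⟶ ⦋n⦌) (x : CodiagonalObj (doubleNerve φp φm) n)
    (i j : Fin (m + 1)) :
    edge (CodiagonalObj.map f x) i j = edge x (f.toOrderHom i) (f.toOrderHom j) := by
  rcases le_or_gt i j with h | h
  · rw [edge_of_le _ h, edge_of_le _ (f.toOrderHom.monotone h)]
    have e1 : (⟨(i : ℕ) + (i - i), by omega⟩ : Fin (m + 1)) = i := Fin.ext (by simp)
    have e2 : (⟨(i : ℕ) + (j - i), by omega⟩ : Fin (m + 1)) = j :=
      Fin.ext (by have := Fin.le_def.1 h; simp; omega)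
    have e3 : (⟨(j : ℕ) + (j - j), by omega⟩ : Fin (m + 1)) = j := Fin.ext (by simp)
    refine Prod.ext ?_ ?_
    · refine congrArg LWSquare.top (congrArg (Grid.cell (φp := φp) (φm := φm)
        (P := Fin ((f.toOrderHom i : ℕ) + 1)) (Q := Fin (n - (f.toOrderHom i : ℕ) + 1))
        (x.1 (f.toOrderHom i)) _) (Subtype.ext (Prod.ext (Fin.ext ?_) (Fin.ext ?_))))
      · exact congrArg (fun a => (f.toOrderHom a : ℕ) - (f.toOrderHom i : ℕ)) e1
      · exact congrArg (fun a => (f.toOrderHom a : ℕ) - (f.toOrderHom i : ℕ)) e2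
    · refine congrArg LWSquare.left (congrArg (Grid.cell (φp := φp) (φm := φm)
        (P := Fin ((f.toOrderHom j : ℕ) + 1)) (Q := Fin (n - (f.toOrderHom j : ℕ) + 1))
        (x.1 (f.toOrderHom j)) _) (Subtype.ext (Prod.ext (Fin.ext ?_) (Fin.ext ?_))))
      · exact congrArg (fun a => (f.toOrderHom a : ℕ) - (f.toOrderHom j : ℕ)) e3
      · exact congrArg (fun a => (f.toOrderHom a : ℕ) - (f.toOrderHom j : ℕ)) e3
  · rw [(edge_isCocycle _).eq_one i j h.le,
      (edge_isCocycle _).eq_one _ _ (f.toOrderHom.monotone h.le)]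

/-- The simplex of the codiagonal defined by a cocycle. -/
def IsCocycle.simplex {y : Fin (n + 1) → Fin (n + 1) → Hm × Hp} (hy : IsCocycle φp φm y) :
    CodiagonalObj (doubleNerve φp φm) n :=
  ⟨fun k => show Grid φp φm (Fin ((k : ℕ) + 1)) (Fin (n - (k : ℕ) + 1)) from
    { cell := fun r c => hy.square ⟨r.1.1, row_index_lt k _⟩ ⟨r.1.2, row_index_lt k _⟩
        ⟨c.1.1 + k, cell_index_lt k _⟩ ⟨c.1.2 + k, cell_index_lt k _⟩ r.2 (row_le_column k _ _)
        (Fin.mk_le_mk.2 (Nat.add_le_add_right c.2 _))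
      horizontal := fun r p p' p'' h h' => ⟨rfl, by
        ext <;> simp [LWSquare.hMul, IsCocycle.square, mul_assoc]⟩
      vertical := fun c q q' q'' h h' => ⟨rfl, by
        ext <;> simp [LWSquare.vMul, IsCocycle.square, mul_assoc]⟩
      horizontal_unit := fun r p => by
        ext <;> simp [LWSquare.hUnit, IsCocycle.square]
      vertical_unit := fun c q => by
        ext <;> simp [LWSquare.vUnit, IsCocycle.square] },
    fun k hk => by
      refine Grid.ext (φp := φp) (φm := φm) (P := Fin (k + 1)) (Q := Fin (n - (k + 1) + 1)) ?_
      funext r c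
      have e (i : Fin (n - (k + 1) + 1)) (h : (i : ℕ) + (k + 1 - k) + k < n + 1) :
          (⟨(i : ℕ) + (k + 1 - k) + k, h⟩ : Fin (n + 1)) = ⟨(i : ℕ) + (k + 1), by omega⟩ :=
        Fin.ext (by simp; omega)
      ext
      · exact congrArg (fun a => (y _ a).2 * (y _ a).2⁻¹) (e c.1.1 _)
      · exact congrArg₂ (fun a b => (y _ a).1⁻¹ * (y _ b).1) (e c.1.1 _) (e c.1.2 _)
      · exact congrArg₂ (fun a b => (y _ a).1⁻¹ * (y _ b).1) (e c.1.1 _) (e c.1.2 _)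
      · exact congrArg (fun a => (y _ a).2 * (y _ a).2⁻¹) (e c.1.2 _)⟩

theorem IsCocycle.edge_simplex {y : Fin (n + 1) → Fin (n + 1) → Hm × Hp}
    (hy : IsCocycle φp φm y) : edge hy.simplex = y := by
  funext i j
  rcases le_or_gt i j with h | h
  · rw [edge_of_le _ h]
    have e1 (i : Fin (n + 1)) (h : (i : ℕ) - i + i < n + 1) :
        (⟨(i : ℕ) - i + i, h⟩ : Fin (n + 1)) = i :=
      Fin.ext (by simp)
    have e2 (h' : (j : ℕ) - i + i < n + 1) : (⟨(j : ℕ) - i + i, h'⟩ : Fin (n + 1)) = j :=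
      Fin.ext (Nat.sub_add_cancel h)
    refine Prod.ext ?_ ?_
    · change (y i ⟨(i : ℕ) - i + i, _⟩).1⁻¹ * (y i ⟨(j : ℕ) - i + i, _⟩).1 = _
      rw [e1, e2, hy.eq_one i i le_rfl]
      simp
    · change (y i ⟨(j : ℕ) - j + j, _⟩).2 * (y j ⟨(j : ℕ) - j + j, _⟩).2⁻¹ = _
      rw [e1, hy.eq_one j j le_rfl]
      simp
  · rw [(edge_isCocycle _).eq_one i j h.le, hy.eq_one i j h.le]

end Combinatorics

/-! ### Low levels, faces and horns of the codiagonal -/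

section Levels

variable {G : Type*} {Hp Hm : Type u} [Group G] [Group Hp] [Group Hm]
  {φp : Hp →* G} {φm : Hm →* G}

theorem edge_map_apply {m n : ℕ} (f : ⦋m⦌ ⟶ ⦋n⦌) (x : (GammaBar φp φm).obj (op ⦋n⦌))
    (i j : Fin (m + 1)) :
    edge (φp := φp) (φm := φm) ((GammaBar φp φm).map f.op x) i j =
      edge (φp := φp) (φm := φm) (n := n) x (f.toOrderHom i) (f.toOrderHom j) :=
  edge_map f x i j

theorem edge_δ {n : ℕ} (k : Fin (n + 2)) (x : (GammaBar φp φm).obj (op ⦋n + 1⦌))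
    (i j : Fin (n + 1)) :
    edge (φp := φp) (φm := φm) (n := n) ((GammaBar φp φm).δ k x) i j =
      edge (φp := φp) (φm := φm) (n := n + 1) x (k.succAbove i) (k.succAbove j) :=
  edge_map (SimplexCategory.δ k) x i j

theorem edge_σ {n : ℕ} (k : Fin (n + 1)) (x : (GammaBar φp φm).obj (op ⦋n⦌))
    (i j : Fin (n + 2)) :
    edge (φp := φp) (φm := φm) (n := n + 1) ((GammaBar φp φm).σ k x) i j =
      edge (φp := φp) (φm := φm) (n := n) x (k.predAbove i) (k.predAbove j) :=
  edge_map (SimplexCategory.σ k) x i j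

theorem gammaBar_ext {n : ℕ} {x y : (GammaBar φp φm).obj (op ⦋n⦌)}
    (h : ∀ i j, edge (φp := φp) (φm := φm) (n := n) x i j =
      edge (φp := φp) (φm := φm) (n := n) y i j) : x = y :=
  edge_injective (funext₂ h)

theorem level1_eq_edge (x : (GammaBar φp φm).obj (op ⦋1⦌)) :
    level1 x = edge (φp := φp) (φm := φm) (n := 1) x 0 1 := by
  have h := edge_isCocycle (φp := φp) (φm := φm) (n := 1) x
  refine Prod.ext ?_ ?_
  · refine (congrArg LWSquare.top (cell_eq_square (φp := φp) (φm := φm) (n := 1) x 0 _ _)).trans ?_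
    rw [IsCocycle.square_top]
    change (edge (φp := φp) (φm := φm) (n := 1) x 0 0).1⁻¹ *
      (edge (φp := φp) (φm := φm) (n := 1) x 0 1).1 = _
    rw [h.eq_one 0 0 le_rfl]
    simp
  · refine (congrArg LWSquare.left (cell_eq_square (φp := φp) (φm := φm) (n := 1) x 1 _ _)).trans ?_
    rw [IsCocycle.square_left]
    change (edge (φp := φp) (φm := φm) (n := 1) x 0 1).2 *
      (edge (φp := φp) (φm := φm) (n := 1) x 1 1).2⁻¹ = _
    rw [h.eq_one 1 1 le_rfl]
    simp

/-- The element of `Γ` underlying a `2`-simplex. -/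
def midSquare (x : (GammaBar φp φm).obj (op ⦋2⦌)) : LWSquare φp φm :=
  (edge_isCocycle (φp := φp) (φm := φm) (n := 2) x).square 0 1 1 2 (by decide) le_rfl (by decide)

theorem level2_eq (x : (GammaBar φp φm).obj (op ⦋2⦌)) :
    level2 x = ((edge (φp := φp) (φm := φm) (n := 2) x 0 1).1, midSquare x,
      (edge (φp := φp) (φm := φm) (n := 2) x 1 2).2) := by
  have h := edge_isCocycle (φp := φp) (φm := φm) (n := 2) x
  refine Prod.ext ?_ (Prod.ext ?_ ?_)
  · refine (congrArg LWSquare.top (cell_eq_square (φp := φp) (φm := φm) (n := 2) x 0 _ _)).trans ?_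
    rw [IsCocycle.square_top]
    change (edge (φp := φp) (φm := φm) (n := 2) x 0 0).1⁻¹ *
      (edge (φp := φp) (φm := φm) (n := 2) x 0 1).1 = _
    rw [h.eq_one 0 0 le_rfl]
    simp
  · exact cell_eq_square (φp := φp) (φm := φm) (n := 2) x 1 _ _
  · refine (congrArg LWSquare.left (cell_eq_square (φp := φp) (φm := φm) (n := 2) x 2 _ _)).trans ?_
    rw [IsCocycle.square_left]
    change (edge (φp := φp) (φm := φm) (n := 2) x 1 2).2 *
      (edge (φp := φp) (φm := φm) (n := 2) x 2 2).2⁻¹ = _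
    rw [h.eq_one 2 2 le_rfl]
    simp

variable (x : (GammaBar φp φm).obj (op ⦋2⦌))

theorem midSquare_left :
    (midSquare x).left = (edge (φp := φp) (φm := φm) (n := 2) x 0 1).2 := by
  rw [midSquare, IsCocycle.square_left,
    (edge_isCocycle (φp := φp) (φm := φm) (n := 2) x).eq_one 1 1 le_rfl]
  simp

theorem midSquare_top : (midSquare x).top =
    (edge (φp := φp) (φm := φm) (n := 2) x 0 1).1⁻¹ *
      (edge (φp := φp) (φm := φm) (n := 2) x 0 2).1 := rfl

theorem midSquare_bottom :
    (midSquare x).bottom = (edge (φp := φp) (φm := φm) (n := 2) x 1 2).1 := by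
  rw [midSquare, IsCocycle.square_bottom,
    (edge_isCocycle (φp := φp) (φm := φm) (n := 2) x).eq_one 1 1 le_rfl]
  simp

theorem midSquare_right : (midSquare x).right =
    (edge (φp := φp) (φm := φm) (n := 2) x 0 2).2 *
      (edge (φp := φp) (φm := φm) (n := 2) x 1 2).2⁻¹ := rfl

theorem level1_δ (a₃ a₂ a₁ : Hm) (h₃ h₂ h₁ : Hp) (hc : φp h₃ * φm a₁ = φm a₂ * φp h₂)
    (y : (GammaBar φp φm).obj (op ⦋2⦌)) (hy : level2 y = (a₃, ⟨h₃, a₂, a₁, h₂, hc⟩, h₁)) :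
    level1 ((GammaBar φp φm).δ (0 : Fin 3) y) = (a₁, h₁) ∧
      level1 ((GammaBar φp φm).δ (1 : Fin 3) y) = (a₃ * a₂, h₂ * h₁) ∧
      level1 ((GammaBar φp φm).δ (2 : Fin 3) y) = (a₃, h₃) := by
  rw [level2_eq, Prod.ext_iff, Prod.ext_iff] at hy
  obtain ⟨e1, e2, e3⟩ := hy
  have e4 := (midSquare_left y).symm.trans (congrArg LWSquare.left e2)
  have e5 := (midSquare_top y).symm.trans (congrArg LWSquare.top e2)
  have e6 := (midSquare_bottom y).symm.trans (congrArg LWSquare.bottom e2)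
  have e7 := (midSquare_right y).symm.trans (congrArg LWSquare.right e2)
  dsimp only at e1 e3 e4 e5 e6 e7
  rw [inv_mul_eq_iff_eq_mul, e1] at e5
  rw [mul_inv_eq_iff_eq_mul, e3] at e7
  rw [level1_eq_edge, level1_eq_edge, level1_eq_edge, edge_δ, edge_δ, edge_δ]
  exact ⟨Prod.ext e6 e3, Prod.ext e5 e7, Prod.ext e1 e4⟩

theorem level2_σ (a : Hm) (h : Hp) (y : (GammaBar φp φm).obj (op ⦋1⦌)) (hy : level1 y = (a, h)) :
    level2 ((GammaBar φp φm).σ (0 : Fin 2) y) = (1, ⟨1, a, a, 1, by simp⟩, h) ∧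
      level2 ((GammaBar φp φm).σ (1 : Fin 2) y) = (a, ⟨h, 1, 1, h, by simp⟩, 1) := by
  rw [level1_eq_edge] at hy
  have h0 (i : Fin 2) := (edge_isCocycle (φp := φp) (φm := φm) (n := 1) y).eq_one i i le_rfl
  have e0 := edge_σ (φp := φp) (φm := φm) (0 : Fin 2) y
  have e1 := edge_σ (φp := φp) (φm := φm) (1 : Fin 2) y
  have a1 := (e0 0 1).trans (h0 0)
  have a2 := (e0 0 2).trans hy
  have a3 := (e0 1 2).trans hy
  have b1 := (e1 0 1).trans hy
  have b2 := (e1 0 2).trans hy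
  have b3 := (e1 1 2).trans (h0 1)
  rw [level2_eq, level2_eq]
  refine ⟨Prod.ext (congrArg (fun z : Hm × Hp => z.1) a1)
      (Prod.ext ?_ (congrArg (fun z : Hm × Hp => z.2) a3)),
    Prod.ext (congrArg (fun z : Hm × Hp => z.1) b1)
      (Prod.ext ?_ (congrArg (fun z : Hm × Hp => z.2) b3))⟩
  · ext
    · exact (midSquare_left _).trans (congrArg Prod.snd a1)
    · refine (midSquare_top _).trans ?_
      rw [a1, a2]
      simp
    · exact (midSquare_bottom _).trans (congrArg Prod.fst a3)
    · refine (midSquare_right _).trans ?_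
      rw [a2, a3]
      simp
  · ext
    · exact (midSquare_left _).trans (congrArg Prod.snd b1)
    · refine (midSquare_top _).trans ?_
      rw [b1, b2]
      simp
    · exact (midSquare_bottom _).trans (congrArg Prod.fst b3)
    · refine (midSquare_right _).trans ?_
      rw [b2, b3]
      simp

theorem one_isCocycle {n : ℕ} :
    IsCocycle (n := n) φp φm (fun _ _ => 1) :=
  ⟨fun _ _ _ => rfl, fun _ _ _ _ _ => by simp [mulMap_one]⟩

theorem exists_edge_eq {n : ℕ} {y : Fin (n + 1) → Fin (n + 1) → Hm × Hp}
    (hy : IsCocycle φp φm y) : ∃ x : (GammaBar φp φm).obj (op ⦋n⦌),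
      edge (φp := φp) (φm := φm) (n := n) x = y :=
  ⟨hy.simplex, hy.edge_simplex⟩

theorem pair_isCocycle (y : Hm × Hp) : IsCocycle (n := 1) φp φm ![![1, y], ![1, 1]] := by
  refine ⟨fun i j hij => ?_, fun i j k hij hjk => ?_⟩
  · fin_cases i <;> fin_cases j <;> first | (exact absurd hij (by decide)) | rfl
  · fin_cases i <;> fin_cases j <;> fin_cases k <;>
      first
      | exact absurd hij (by decide)
      | exact absurd hjk (by decide)
      | simp [mulMap_one]

theorem edge_one_bijective : Function.Bijective
    fun x : (GammaBar φp φm).obj (op ⦋1⦌) => edge (φp := φp) (φm := φm) (n := 1) x 0 1 := by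
  refine ⟨fun x y hxy => gammaBar_ext fun i j => ?_, fun y => ?_⟩
  · rcases le_or_gt j i with hij | hij
    · rw [(edge_isCocycle (φp := φp) (φm := φm) (n := 1) x).eq_one i j hij,
        (edge_isCocycle (φp := φp) (φm := φm) (n := 1) y).eq_one i j hij]
    · obtain ⟨rfl, rfl⟩ : i = 0 ∧ j = 1 := by
        have := Fin.lt_def.1 hij
        exact ⟨Fin.ext (by simp; omega), Fin.ext (by simp; omega)⟩
      exact hxy
  · obtain ⟨x, hx⟩ := exists_edge_eq (pair_isCocycle (φp := φp) (φm := φm) y)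
    exact ⟨x, congrFun (congrFun hx 0) 1⟩

theorem triple_isCocycle (y : Hm × LWSquare φp φm × Hp) : IsCocycle (n := 2) φp φm
    ![![1, (y.1, y.2.1.left), (y.1 * y.2.1.top, y.2.1.right * y.2.2)],
      ![1, 1, (y.2.1.bottom, y.2.2)], ![1, 1, 1]] := by
  have hc : φm y.1 * φp y.2.1.left * (φm y.2.1.bottom * φp y.2.2) =
      φm (y.1 * y.2.1.top) * φp (y.2.1.right * y.2.2) := by
    rw [map_mul, map_mul, mul_assoc, ← mul_assoc (φp y.2.1.left), y.2.1.comm]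
    simp only [mul_assoc]
  refine ⟨fun i j hij => ?_, fun i j k hij hjk => ?_⟩
  · fin_cases i <;> fin_cases j <;> first | (exact absurd hij (by decide)) | rfl
  · fin_cases i <;> fin_cases j <;> fin_cases k <;>
      first
      | exact absurd hij (by decide)
      | exact absurd hjk (by decide)
      | exact hc
      | simp [mulMap_one]

theorem edge_of_level2_eq {x : (GammaBar φp φm).obj (op ⦋2⦌)} {y : Hm × LWSquare φp φm × Hp}
    (hx : level2 x = y) :
    edge (φp := φp) (φm := φm) (n := 2) x 0 1 = (y.1, y.2.1.left) ∧
    edge (φp := φp) (φm := φm) (n := 2) x 0 2 = (y.1 * y.2.1.top, y.2.1.right * y.2.2) ∧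
    edge (φp := φp) (φm := φm) (n := 2) x 1 2 = (y.2.1.bottom, y.2.2) := by
  subst hx
  rw [level2_eq, midSquare_left, midSquare_top, midSquare_bottom, midSquare_right]
  simp

theorem level2_bijective : Function.Bijective (level2 (φp := φp) (φm := φm)) := by
  refine ⟨fun x x' hx => gammaBar_ext fun i j => ?_, fun y => ?_⟩
  · obtain ⟨e1, e2, e3⟩ := edge_of_level2_eq hx
    obtain ⟨e1', e2', e3'⟩ := edge_of_level2_eq (rfl : level2 x' = level2 x')
    have h0 := (edge_isCocycle (φp := φp) (φm := φm) (n := 2) x).eq_one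
    have h0' := (edge_isCocycle (φp := φp) (φm := φm) (n := 2) x').eq_one
    rcases le_or_gt j i with hij | hij
    · rw [h0 i j hij, h0' i j hij]
    · fin_cases i <;> fin_cases j
      · exact absurd hij (by decide)
      · exact e1.trans e1'.symm
      · exact e2.trans e2'.symm
      · exact absurd hij (by decide)
      · exact absurd hij (by decide)
      · exact e3.trans e3'.symm
      · exact absurd hij (by decide)
      · exact absurd hij (by decide)
      · exact absurd hij (by decide)
  · obtain ⟨x, hx⟩ := exists_edge_eq (triple_isCocycle (φp := φp) (φm := φm) y)
    have e1 := congrFun (congrFun hx 0) 1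
    have e2 := congrFun (congrFun hx 0) 2
    have e3 := congrFun (congrFun hx 1) 2
    change _ = (y.1, y.2.1.left) at e1
    change _ = (y.1 * y.2.1.top, y.2.1.right * y.2.2) at e2
    change _ = (y.2.1.bottom, y.2.2) at e3
    refine ⟨x, ?_⟩
    rw [level2_eq]
    refine Prod.ext (congrArg (fun z : Hm × Hp => z.1) e1) (Prod.ext (LWSquare.ext ?_ ?_ ?_ ?_)
      (congrArg (fun z : Hm × Hp => z.2) e3))
    · exact (midSquare_left x).trans (congrArg Prod.snd e1)
    · refine (midSquare_top x).trans ?_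
      rw [e1, e2]
      simp
    · exact (midSquare_bottom x).trans (congrArg Prod.fst e3)
    · refine (midSquare_right x).trans ?_
      rw [e2, e3]
      simp

theorem gammaBar_zero_eq (x y : (GammaBar φp φm).obj (op ⦋0⦌)) : x = y :=
  gammaBar_ext fun i j => by
    rw [(edge_isCocycle (φp := φp) (φm := φm) (n := 0) x).eq_one i j (Fin.le_def.2 (by omega)),
      (edge_isCocycle (φp := φp) (φm := φm) (n := 0) y).eq_one i j (Fin.le_def.2 (by omega))]

theorem gammaBar_zero_unique : Nonempty (Unique ((GammaBar φp φm).obj (op ⦋0⦌))) :=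
  ⟨⟨⟨(one_isCocycle (φp := φp) (φm := φm) (n := 0)).simplex⟩, fun _ => gammaBar_zero_eq _ _⟩⟩

/-- An edge which misses the vertex `k` is an edge of the `k`-th face. -/
theorem edge_eq_edge_face {n : ℕ} (k i j : Fin (n + 2)) (hi : i ≠ k) (hj : j ≠ k) :
    ∃ i' j' : Fin (n + 1), ∀ x : (GammaBar φp φm).obj (op ⦋n + 1⦌),
      edge (φp := φp) (φm := φm) (n := n + 1) x i j =
        edge (φp := φp) (φm := φm) (n := n) ((GammaBar φp φm).δ k x) i' j' := by
  obtain ⟨i', rfl⟩ := Fin.exists_succAbove_eq hi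
  obtain ⟨j', rfl⟩ := Fin.exists_succAbove_eq hj
  exact ⟨i', j', fun x => (edge_δ k x i' j').symm⟩

end Levels

section Horns

theorem hornFace_hornProj (X : SSet.{u}) (l : ℕ) (j : Fin (l + 2)) (i : {i : Fin (l + 2) // i ≠ j})
    (x : X.obj (op ⦋l + 1⦌)) : hornFace X l j i (hornProj X (l + 1) j x) = X.δ i.1 x := rfl

theorem horn_ext {X : SSet.{u}} {l : ℕ} {j : Fin (l + 2)} {h h' : HornSpace X (l + 1) j}
    (H : ∀ i, hornFace X l j i h = hornFace X l j i h') : h = h' :=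
  SSet.horn.hom_ext _ _ fun i hi => H ⟨i, hi⟩

theorem exists_horn {X : SSet.{u}} {l : ℕ} {j : Fin (l + 2)} (f : {i : Fin (l + 2) // i ≠ j} →
    X.obj (op ⦋l⦌))
    (hf : SSet.horn.IsCompatible (i := j) fun i hi => SSet.yonedaEquiv.symm (f ⟨i, hi⟩)) :
    ∃ h : HornSpace X (l + 1) j, ∀ i, hornFace X l j i h = f i := by
  refine ⟨hf.desc, fun i => ?_⟩
  have h := congrArg SSet.yonedaEquiv (hf.ι_desc i.1 i.2)
  rw [SSet.yonedaEquiv_comp, SSet.horn.yonedaEquiv_ι, Equiv.apply_symm_apply] at h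
  exact h

/-- There are at least four vertices, so an edge and the vertex `j` do not exhaust them. Hence every
edge of a simplex lies in a face of its horn. -/
theorem exists_notMem_triple {l : ℕ} (hl : 2 ≤ l) (j p q : Fin (l + 2)) :
    ∃ i, i ≠ j ∧ p ≠ i ∧ q ≠ i := by
  by_contra! h
  have h1 : (Finset.univ : Finset (Fin (l + 2))) ⊆ {j, p, q} := by
    intro i _
    simp only [Finset.mem_insert, Finset.mem_singleton]
    by_cases h1 : i = j
    · exact Or.inl h1
    · by_cases h2 : p = i
      · exact Or.inr (Or.inl h2.symm)
      · exact Or.inr (Or.inr (h i h1 h2).symm)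
  have h2 := (Finset.card_le_card h1).trans Finset.card_le_three
  rw [Finset.card_univ, Fintype.card_fin] at h2
  omega

/-- The value of a horn on a simplex of `Λ[n, j]`, given by a monotone map `[m] → [n]` which misses
a vertex different from `j`. -/
def hornVal {X : SSet.{u}} {n m : ℕ} {j : Fin (n + 1)} (h : HornSpace X n j) (f : ⦋m⦌ ⟶ ⦋n⦌)
    (hf : ∃ i, i ≠ j ∧ ∀ a, f.toOrderHom a ≠ i) : X.obj (op ⦋m⦌) :=
  h.app (op ⦋m⦌) ⟨SSet.stdSimplex.objEquiv.symm f, by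
    obtain ⟨i, hi, hf⟩ := hf
    rw [SSet.mem_horn_iff_notMem_range]
    exact ⟨i, hi, fun ⟨a, ha⟩ => hf a ha⟩⟩

theorem hornVal_map {X : SSet.{u}} {n m k : ℕ} {j : Fin (n + 1)} (h : HornSpace X n j)
    (f : ⦋m⦌ ⟶ ⦋n⦌) (g : ⦋k⦌ ⟶ ⦋m⦌) (hf : ∃ i, i ≠ j ∧ ∀ a, f.toOrderHom a ≠ i)
    (hgf : ∃ i, i ≠ j ∧ ∀ a, (g ≫ f).toOrderHom a ≠ i) :
    hornVal h (g ≫ f) hgf = X.map g.op (hornVal h f hf) :=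
  ConcreteCategory.congr_hom (h.naturality g.op)
    (⟨SSet.stdSimplex.objEquiv.symm f, by
      obtain ⟨i, hi, hf⟩ := hf
      rw [SSet.mem_horn_iff_notMem_range]
      exact ⟨i, hi, fun ⟨a, ha⟩ => hf a ha⟩⟩ : (SSet.horn.{u} n j).obj (op ⦋m⦌))

theorem hornFace_eq_hornVal {X : SSet.{u}} {l : ℕ} {j : Fin (l + 2)} (h : HornSpace X (l + 1) j)
    (i : {i : Fin (l + 2) // i ≠ j}) :
    hornFace X l j i h = hornVal h (SimplexCategory.δ i.1)
      ⟨i.1, i.2, fun a => Fin.succAbove_ne i.1 a⟩ := rfl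

variable {G : Type*} {Hp Hm : Type u} [Group G] [Group Hp] [Group Hm]
  {φp : Hp →* G} {φm : Hm →* G}

/-- In dimensions one and two the faces of a horn may be prescribed arbitrarily, since `Γ̄_0` is a
point. -/
theorem exists_hornFace_eq {l : ℕ} (hl : l ≤ 1) {j : Fin (l + 2)}
    (f : {i : Fin (l + 2) // i ≠ j} → (GammaBar φp φm).obj (op ⦋l⦌)) :
    ∃ h : HornSpace (GammaBar φp φm) (l + 1) j, ∀ i, hornFace (GammaBar φp φm) l j i h = f i := by
  refine exists_horn f ?_
  obtain rfl | rfl : l = 0 ∨ l = 1 := by omega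
  · trivial
  · intro _ _ _ _ _
    exact SSet.yonedaEquiv.injective (gammaBar_zero_eq _ _)

theorem hornProj_injective {l : ℕ} (hl : 2 ≤ l) (j : Fin (l + 2)) :
    Function.Injective (hornProj (GammaBar φp φm) (l + 1) j) := by
  intro x y hxy
  refine gammaBar_ext fun p q => ?_
  obtain ⟨i, hi, hp, hq⟩ := exists_notMem_triple hl j p q
  obtain ⟨p', q', h⟩ := edge_eq_edge_face (φp := φp) (φm := φm) i p q hp hq
  rw [h, h, ← hornFace_hornProj _ l j ⟨i, hi⟩, hxy]
  rfl

section

variable {l : ℕ} (hl : 2 ≤ l) {j : Fin (l + 2)} (h : HornSpace (GammaBar φp φm) (l + 1) j)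
include hl

theorem missing_of_edge {a b : Fin (l + 2)} (hab : a ≤ b) :
    ∃ i, i ≠ j ∧ ∀ c, (SimplexCategory.mkOfLe a b hab).toOrderHom c ≠ i := by
  obtain ⟨i, hi, h1, h2⟩ := exists_notMem_triple hl j a b
  refine ⟨i, hi, fun c => ?_⟩
  fin_cases c
  · exact h1
  · exact h2

/-- The edges of a horn. -/
def hornEdge (a b : Fin (l + 2)) : Hm × Hp :=
  if hab : a ≤ b then
    edge (φp := φp) (φm := φm) (n := 1)
      (hornVal h (SimplexCategory.mkOfLe a b hab) (missing_of_edge hl hab)) 0 1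
  else 1

theorem edge_hornVal {m : ℕ} (f : ⦋m⦌ ⟶ ⦋l + 1⦌) (hf : ∃ i, i ≠ j ∧ ∀ a, f.toOrderHom a ≠ i)
    {a b : Fin (m + 1)} (hab : a ≤ b) :
    edge (φp := φp) (φm := φm) (n := m) (hornVal h f hf) a b =
      hornEdge hl h (f.toOrderHom a) (f.toOrderHom b) := by
  have h1 : SimplexCategory.mkOfLe a b hab ≫ f =
      SimplexCategory.mkOfLe (f.toOrderHom a) (f.toOrderHom b) (f.toOrderHom.monotone hab) := by
    refine hom_ext_val fun c => ?_
    fin_cases c <;> rfl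
  have h2 := edge_map_apply (φp := φp) (φm := φm) (SimplexCategory.mkOfLe a b hab)
    (hornVal h f hf) 0 1
  rw [← hornVal_map h f _ hf (by rw [h1]; exact missing_of_edge hl _)] at h2
  refine h2.symm.trans ?_
  rw [hornEdge, dif_pos (f.toOrderHom.monotone hab)]
  congr 2

/-- The simplex `[2] → [n]` with given vertices. -/
def triangleMap {n : ℕ} (a b c : Fin (n + 1)) (hab : a ≤ b) (hbc : b ≤ c) : ⦋2⦌ ⟶ ⦋n⦌ :=
  SimplexCategory.mkHom
    { toFun := ![a, b, c]
      monotone' := by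
        rw [Fin.monotone_iff_le_succ]
        intro i
        fin_cases i
        · exact hab
        · exact hbc }

/-- The edges of a horn satisfy the cocycle condition on a triangle containing the vertex `j`. -/
theorem hornEdge_mul {a b c : Fin (l + 2)} (hab : a ≤ b) (hbc : b ≤ c)
    (hj : a = j ∨ b = j ∨ c = j) :
    mulMap φp φm (hornEdge hl h a b) * mulMap φp φm (hornEdge hl h b c) =
      mulMap φp φm (hornEdge hl h a c) := by
  have hm : ∃ i, i ≠ j ∧ ∀ d, (triangleMap a b c hab hbc).toOrderHom d ≠ i := by
    obtain ⟨i, hi, h1, h2, h3⟩ : ∃ i, i ≠ j ∧ a ≠ i ∧ b ≠ i ∧ c ≠ i := by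
      rcases hj with rfl | rfl | rfl
      · obtain ⟨i, hi, h1, h2⟩ := exists_notMem_triple hl a b c
        exact ⟨i, hi, hi.symm, h1, h2⟩
      · obtain ⟨i, hi, h1, h2⟩ := exists_notMem_triple hl b a c
        exact ⟨i, hi, h1, hi.symm, h2⟩
      · obtain ⟨i, hi, h1, h2⟩ := exists_notMem_triple hl c a b
        exact ⟨i, hi, h1, h2, hi.symm⟩
    refine ⟨i, hi, fun d => ?_⟩
    fin_cases d
    · exact h1
    · exact h2
    · exact h3
  have key := (edge_isCocycle (φp := φp) (φm := φm) (n := 2)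
    (hornVal h (triangleMap a b c hab hbc) hm)).mul 0 1 2 (by decide) (by decide)
  rw [edge_hornVal hl h _ hm (by decide), edge_hornVal hl h _ hm (by decide),
    edge_hornVal hl h _ hm (by decide)] at key
  exact key

theorem hornEdge_self (a : Fin (l + 2)) : hornEdge hl h a a = 1 := by
  have h1 := edge_hornVal hl h (SimplexCategory.mkOfLe a a le_rfl) (missing_of_edge hl le_rfl)
    (a := 0) (b := 0) le_rfl
  exact h1.symm.trans ((edge_isCocycle (φp := φp) (φm := φm) (n := 1) _).eq_one 0 0 le_rfl)

/-- The image in `G` of the edge from `j` to `a`. -/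
def hornPot (a : Fin (l + 2)) : G :=
  if j ≤ a then mulMap φp φm (hornEdge hl h j a) else (mulMap φp φm (hornEdge hl h a j))⁻¹

/-- All edges of a horn are determined by the edges containing the vertex `j`. This gives the
cocycle condition also on a triangle which is not contained in the horn. -/
theorem mulMap_hornEdge {a b : Fin (l + 2)} (hab : a ≤ b) :
    mulMap φp φm (hornEdge hl h a b) = (hornPot hl h a)⁻¹ * hornPot hl h b := by
  rw [eq_inv_mul_iff_mul_eq, hornPot, hornPot]
  by_cases h1 : j ≤ a
  · rw [if_pos h1, if_pos (h1.trans hab)]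
    exact hornEdge_mul hl h h1 hab (Or.inl rfl)
  · rw [if_neg h1]
    have h1' := (not_le.1 h1).le
    by_cases h2 : j ≤ b
    · rw [if_pos h2, inv_mul_eq_iff_eq_mul]
      exact (hornEdge_mul hl h h1' h2 (Or.inr (Or.inl rfl))).symm
    · rw [if_neg h2, inv_mul_eq_iff_eq_mul, eq_mul_inv_iff_mul_eq]
      exact hornEdge_mul hl h hab (not_le.1 h2).le (Or.inr (Or.inr rfl))

theorem hornEdge_isCocycle : IsCocycle φp φm (hornEdge hl h) where
  eq_one a b hab := by
    rcases hab.eq_or_lt with rfl | hlt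
    · exact hornEdge_self hl h b
    · exact dif_neg (not_le.2 hlt)
  mul a b c hab hbc := by
    rw [mulMap_hornEdge hl h hab, mulMap_hornEdge hl h hbc, mulMap_hornEdge hl h (hab.trans hbc)]
    group

end

/-- Horns of dimension at least `3` have unique fillers. -/
theorem hornProj_bijective {l : ℕ} (hl : 2 ≤ l) (j : Fin (l + 2)) :
    Function.Bijective (hornProj (GammaBar φp φm) (l + 1) j) := by
  refine ⟨hornProj_injective hl j, fun h => ?_⟩
  obtain ⟨x, hx⟩ := exists_edge_eq (hornEdge_isCocycle hl h)
  refine ⟨x, horn_ext fun i => gammaBar_ext fun a b => ?_⟩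
  rw [hornFace_hornProj, edge_δ, hx]
  rcases le_or_gt a b with hab | hab
  · rw [hornFace_eq_hornVal, edge_hornVal hl h _ _ hab]
    rfl
  · rw [(hornEdge_isCocycle hl h).eq_one _ _ ((Fin.strictMono_succAbove i.1).monotone hab.le)]
    exact ((edge_isCocycle (φp := φp) (φm := φm) (n := l) _).eq_one a b hab.le).symm

end Horns

/-! ### Manifolds of lifts along a local diffeomorphism -/

section Joint

variable {N M : Type*} {S : ManifoldStr N} {R : ManifoldStr M} {ι : Type*} [Finite ι]
  {f : ι → S.Carrier → R.Carrier}

/-- In finite dimension a jointly injective family of differentials has a joint left inverse. -/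
theorem isJointSmoothEmbedding_of_injective [FiniteDimensional ℝ S.E] [FiniteDimensional ℝ R.E]
    (hf : ∀ i, ContMDiff 𝓘(ℝ, S.E) 𝓘(ℝ, R.E) ∞ (f i))
    (hemb : Topology.IsEmbedding fun x i => f i x)
    (hinj : ∀ x w, (∀ i, tder S.E R.E (f i) x w = 0) → w = 0) : IsJointSmoothEmbedding S R f := by
  have := Fintype.ofFinite ι
  refine ⟨hf, hemb, fun x => ?_⟩
  let A : S.E →ₗ[ℝ] ι → R.E := LinearMap.pi fun i => (tder S.E R.E (f i) x).toLinearMap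
  have hA : LinearMap.ker A = ⊥ :=
    LinearMap.ker_eq_bot'.2 fun w hw => hinj x w fun i => congrFun hw i
  obtain ⟨L, hL⟩ := LinearMap.exists_leftInverse_of_injective A hA
  exact ⟨LinearMap.toContinuousLinearMap L, fun w => LinearMap.congr_fun hL w⟩

end Joint

section Lift

/-- `X` consists of all `(n, m) ∈ N × M ^ ι` such that `Q (m i) = g n i`, where `Q` is a local
diffeomorphism. -/
structure IsLiftSpace {X N M G ι : Type*} (E EM EG : Type*)
    [NormedAddCommGroup E] [NormedSpace ℝ E] [TopologicalSpace N] [ChartedSpace E N]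
    [NormedAddCommGroup EM] [NormedSpace ℝ EM] [TopologicalSpace M] [ChartedSpace EM M]
    [NormedAddCommGroup EG] [NormedSpace ℝ EG] [TopologicalSpace G] [ChartedSpace EG G]
    (π : X → N) (ρ : X → ι → M) (Q : M → G) (g : N → ι → G) : Prop where
  localDiffeo : IsLocalDiffeomorph 𝓘(ℝ, EM) 𝓘(ℝ, EG) ∞ Q
  smooth : ∀ i, ContMDiff 𝓘(ℝ, E) 𝓘(ℝ, EG) ∞ fun n => g n i
  injective : Function.Injective fun x => (π x, ρ x)
  comm : ∀ x i, Q (ρ x i) = g (π x) i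
  lift : ∀ n m, (∀ i, Q (m i) = g n i) → ∃ x, π x = n ∧ ρ x = m

variable {E EM : Type v} {X : Type u} {N M EG G ι : Type*} [Finite ι]
    [NormedAddCommGroup E] [NormedSpace ℝ E] [CompleteSpace E]
    [TopologicalSpace N] [T2Space N] [ChartedSpace E N] [IsManifold 𝓘(ℝ, E) ∞ N]
    [NormedAddCommGroup EM] [NormedSpace ℝ EM]
    [TopologicalSpace M] [T2Space M] [ChartedSpace EM M]
    [NormedAddCommGroup EG] [NormedSpace ℝ EG] [TopologicalSpace G] [ChartedSpace EG G]
    {π : X → N} {ρ : X → ι → M} {Q : M → G} {g : N → ι → G}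

namespace IsLiftSpace

variable (h : IsLiftSpace E EM EG π ρ Q g)
include h

theorem isLocalHomeomorph [TopologicalSpace X]
    (hemb : Topology.IsEmbedding fun x => (π x, ρ x)) : IsLocalHomeomorph π :=
  isLocalHomeomorph_of_lift h.localDiffeo.isLocalHomeomorph
    (continuous_pi fun i => (h.smooth i).continuous) hemb h.comm h.lift

/-- The manifold `X`, with the topology of `N × M ^ ι` and the charts of `N`. -/
def str : ManifoldStr.{u, v} X :=
  letI : TopologicalSpace X := TopologicalSpace.induced (fun x => (π x, ρ x)) inferInstance
  have hemb : Topology.IsEmbedding fun x => (π x, ρ x) := ⟨⟨rfl⟩, h.injective⟩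
  haveI : T2Space X := hemb.t2Space
  etaleStr (E := E) (h.isLocalHomeomorph hemb)

theorem embedding : Topology.IsEmbedding fun x : h.str.Carrier => (π x, ρ x) :=
  ⟨⟨rfl⟩, h.injective⟩

/-- The model space of `X` is that of `N`. -/
def model : h.str.E ≃L[ℝ] E := ContinuousLinearEquiv.refl ℝ E

theorem continuous_lift (i : ι) : Continuous (h.str.mapTo fun x => ρ x i) :=
  (continuous_apply i).comp (continuous_snd.comp h.embedding.continuous)

/-- The charts of `X` take values in the model space of `N`. -/
abbrev charted : ChartedSpace E h.str.Carrier :=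
  inferInstanceAs (ChartedSpace h.str.E h.str.Carrier)

theorem isEtale :
    letI := h.charted
    IsEtale (E := E) (h.str.mapTo π) :=
  letI : TopologicalSpace X := TopologicalSpace.induced (fun x => (π x, ρ x)) inferInstance
  have hemb : Topology.IsEmbedding fun x => (π x, ρ x) := ⟨⟨rfl⟩, h.injective⟩
  etaleCharted_isEtale (E := E) (h.isLocalHomeomorph hemb)

theorem smooth_base : ContMDiff 𝓘(ℝ, h.str.E) 𝓘(ℝ, E) ∞ (h.str.mapTo π) :=
  letI := h.charted
  IsEtale.contMDiff (E := E) h.isEtale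

theorem tder_base (x : h.str.Carrier) : tder h.str.E E (h.str.mapTo π) x = h.model :=
  letI := h.charted
  IsEtale.tder_eq_id (E := E) h.isEtale x

theorem eq_zero_of_tder_base {x : h.str.Carrier} {w : h.str.E}
    (hw : tder h.str.E E (h.str.mapTo π) x w = 0) : w = 0 := by
  rw [h.tder_base x] at hw
  exact h.model.map_eq_zero_iff.1 hw

theorem smooth_lift (i : ι) : ContMDiff 𝓘(ℝ, h.str.E) 𝓘(ℝ, EM) ∞ (h.str.mapTo fun x => ρ x i) := by
  intro x
  refine contMDiffAt_of_comp_isLocalDiffeomorphAt (h.continuous_lift i).continuousAt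
    (h.localDiffeo _) ?_
  have h1 : (fun w => Q (h.str.mapTo (fun x => ρ x i) w)) =
      fun w => g (h.str.mapTo π w) i := funext fun w => h.comm w i
  rw [h1]
  exact ((h.smooth i).comp h.smooth_base).contMDiffAt

variable {EZ Z : Type*} [NormedAddCommGroup EZ] [NormedSpace ℝ EZ] [TopologicalSpace Z]
  [ChartedSpace EZ Z]

/-- For a map into a space of lifts, only the component in the base has to be smooth; for the others
continuity is enough. -/
theorem contMDiff_of_components {f : Z → h.str.Carrier}
    (h1 : ContMDiff 𝓘(ℝ, EZ) 𝓘(ℝ, E) ∞ fun z => h.str.mapTo π (f z))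
    (h2 : ∀ i, Continuous fun z => h.str.mapTo (fun x => ρ x i) (f z)) :
    ContMDiff 𝓘(ℝ, EZ) 𝓘(ℝ, h.str.E) ∞ f := fun z =>
  letI := h.charted
  (IsEtale.contMDiffAt_iff h.isEtale).2 ⟨(h.embedding.continuous_iff.2
    (h1.continuous.prodMk (continuous_pi h2))).continuousAt, h1 z⟩

end IsLiftSpace

end Lift

section Transport

variable {E : Type v} {X : Type u} {N : Type*}
    [NormedAddCommGroup E] [NormedSpace ℝ E] [CompleteSpace E]
    [TopologicalSpace N] [T2Space N] [ChartedSpace E N] [IsManifold 𝓘(ℝ, E) ∞ N]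
    {π : X → N}

theorem isLiftSpace_of_bijective (hπ : Function.Bijective π) :
    IsLiftSpace (N := N) (M := E) (G := E) (ι := Empty) E E E π (fun _ i => i.elim) id
      (fun _ i => i.elim) where
  localDiffeo := (Diffeomorph.refl 𝓘(ℝ, E) E ∞).isLocalDiffeomorph
  smooth i := i.elim
  injective x y hxy := hπ.1 (congrArg Prod.fst hxy)
  comm _ i := i.elim
  lift n m _ := by
    obtain ⟨x, hx⟩ := hπ.2 n
    exact ⟨x, hx, Subsingleton.elim _ _⟩

variable (E) in
/-- The manifold structure transported along a bijection. -/
def transportStr (hπ : Function.Bijective π) : ManifoldStr.{u, v} X :=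
  (isLiftSpace_of_bijective (E := E) hπ).str

variable (hπ : Function.Bijective π)

/-- The model space is unchanged. -/
def transportModel : (transportStr E hπ).E ≃L[ℝ] E := ContinuousLinearEquiv.refl ℝ E

theorem contMDiff_transport :
    ContMDiff 𝓘(ℝ, (transportStr E hπ).E) 𝓘(ℝ, E) ∞ ((transportStr E hπ).mapTo π) :=
  (isLiftSpace_of_bijective (E := E) hπ).smooth_base

theorem tder_transport (x : (transportStr E hπ).Carrier) :
    tder (transportStr E hπ).E E ((transportStr E hπ).mapTo π) x = transportModel (E := E) hπ :=
  (isLiftSpace_of_bijective (E := E) hπ).tder_base x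

theorem isEmbedding_transport : Topology.IsEmbedding ((transportStr E hπ).mapTo π) := by
  let F : N → N × (Empty → E) := fun n => (n, fun i => i.elim)
  have hF : Continuous F := continuous_id.prodMk continuous_const
  refine Topology.IsEmbedding.of_comp (contMDiff_transport (E := E) hπ).continuous hF ?_
  exact (isLiftSpace_of_bijective (E := E) hπ).embedding

theorem contMDiff_of_transport {EZ Z : Type*} [NormedAddCommGroup EZ] [NormedSpace ℝ EZ]
    [TopologicalSpace Z] [ChartedSpace EZ Z] {f : Z → (transportStr E hπ).Carrier}
    (hf : ContMDiff 𝓘(ℝ, EZ) 𝓘(ℝ, E) ∞ fun z => (transportStr E hπ).mapTo π (f z)) :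
    ContMDiff 𝓘(ℝ, EZ) 𝓘(ℝ, (transportStr E hπ).E) ∞ f :=
  (isLiftSpace_of_bijective (E := E) hπ).contMDiff_of_components hf fun i => i.elim

end Transport

/-! ### The manifolds `Γ` and `Γ̄_n` -/

section LocalDouble

variable {EG G : Type*} [NormedAddCommGroup EG] [NormedSpace ℝ EG]
  [TopologicalSpace G] [ChartedSpace EG G] [Group G] [LieGroup 𝓘(ℝ, EG) ∞ G]
  {Ep Em : Type v} {Hp Hm : Type u}
  [NormedAddCommGroup Ep] [NormedSpace ℝ Ep] [FiniteDimensional ℝ Ep] [CompleteSpace Ep]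
  [TopologicalSpace Hp] [ChartedSpace Ep Hp] [Group Hp] [LieGroup 𝓘(ℝ, Ep) ∞ Hp] [T2Space Hp]
  [NormedAddCommGroup Em] [NormedSpace ℝ Em] [FiniteDimensional ℝ Em] [CompleteSpace Em]
  [TopologicalSpace Hm] [ChartedSpace Em Hm] [Group Hm] [LieGroup 𝓘(ℝ, Em) ∞ Hm] [T2Space Hm]

variable (EG Ep Em) in
/-- The morphisms `φ₊` and `φ₋` are smooth, and the multiplication map `H₋ × H₊ → G` is a local
diffeomorphism. -/
structure IsLocalDouble (φp : Hp →* G) (φm : Hm →* G) : Prop where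
  smooth_p : ContMDiff 𝓘(ℝ, Ep) 𝓘(ℝ, EG) ∞ φp
  smooth_m : ContMDiff 𝓘(ℝ, Em) 𝓘(ℝ, EG) ∞ φm
  localDiffeo : IsLocalDiffeomorph 𝓘(ℝ, Em × Ep) 𝓘(ℝ, EG) ∞ (mulMap φp φm)

namespace IsLocalDouble

variable {φp : Hp →* G} {φm : Hm →* G} (h : IsLocalDouble EG Ep Em φp φm)
include h

/-- Given the left and bottom edges of a square, the top and right edges are a lift through the
multiplication map of their product in `G`. -/
theorem isLiftSpace_square :
    IsLiftSpace (X := LWSquare φp φm) (ι := Unit) (Ep × Em) (Em × Ep) EG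
      (fun ξ => (ξ.left, ξ.bottom)) (fun ξ _ => (ξ.top, ξ.right)) (mulMap φp φm)
      (fun n _ => φp n.1 * φm n.2) where
  localDiffeo := h.localDiffeo
  smooth _ := (h.smooth_p.comp contMDiff_fst').mul (h.smooth_m.comp contMDiff_snd')
  injective ξ ξ' hξ := by
    rw [Prod.ext_iff, Prod.ext_iff] at hξ
    have h2 := Prod.ext_iff.1 (congrFun hξ.2 ())
    exact LWSquare.ext hξ.1.1 h2.1 hξ.1.2 h2.2
  comm ξ _ := ξ.comm.symm
  lift n m hm := ⟨⟨n.1, (m ()).1, n.2, (m ()).2, (hm ()).symm⟩, rfl, rfl⟩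

/-- The pairs `i < j < n`. -/
abbrev InnerPair (n : ℕ) : Type := {r : Fin n × Fin n // r.1 < r.2}

/-- The edges ending at the last vertex are arbitrary, and the edge from `i` to `j` is a lift
through the multiplication map of `g i n * (g j n)⁻¹`. -/
theorem isLiftSpace_level (n : ℕ) :
    IsLiftSpace (X := (GammaBar φp φm).obj (op ⦋n⦌)) (ι := InnerPair n)
      (Fin n → Em × Ep) (Em × Ep) EG
      (fun x i => edge (φp := φp) (φm := φm) (n := n) x i.castSucc (Fin.last n))
      (fun x r => edge (φp := φp) (φm := φm) (n := n) x r.1.1.castSucc r.1.2.castSucc)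
      (mulMap φp φm)
      (fun y r => mulMap φp φm (y r.1.1) * (mulMap φp φm (y r.1.2))⁻¹) where
  localDiffeo := h.localDiffeo
  smooth r := (h.localDiffeo.contMDiff.comp (contMDiff_eval r.1.1)).mul
    (h.localDiffeo.contMDiff.comp (contMDiff_eval r.1.2)).inv
  injective x y hxy := by
    rw [Prod.ext_iff] at hxy
    refine gammaBar_ext fun i j => ?_
    have hx := edge_isCocycle (φp := φp) (φm := φm) (n := n) x
    have hy := edge_isCocycle (φp := φp) (φm := φm) (n := n) y
    rcases le_or_gt j i with hij | hij
    · rw [hx.eq_one i j hij, hy.eq_one i j hij]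
    · obtain ⟨i, rfl⟩ := Fin.exists_castSucc_eq.2 (hij.trans_le (Fin.le_last j)).ne
      rcases eq_or_ne j (Fin.last n) with rfl | hj
      · exact congrFun hxy.1 i
      · obtain ⟨j, rfl⟩ := Fin.exists_castSucc_eq.2 hj
        exact congrFun hxy.2 ⟨(i, j), hij⟩
  comm x r := by
    rw [eq_mul_inv_iff_mul_eq]
    exact (edge_isCocycle (φp := φp) (φm := φm) (n := n) x).mul _ _ _
      (Fin.castSucc_le_castSucc_iff.2 r.2.le) (Fin.le_last _)
  lift y m hm := by
    -- the family of edges with values `p i * (p j)⁻¹` in `G`, where `p i = g i n`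
    let z : Fin (n + 1) → Fin (n + 1) → Hm × Hp := fun i j =>
      if hi : (i : ℕ) < n then
        if hj : (j : ℕ) < n then
          if hij : (⟨i, hi⟩ : Fin n) < ⟨j, hj⟩ then m ⟨(⟨i, hi⟩, ⟨j, hj⟩), hij⟩ else 1
        else y ⟨i, hi⟩
      else 1
    let p : Fin (n + 1) → G := fun i => if hi : (i : ℕ) < n then mulMap φp φm (y ⟨i, hi⟩) else 1
    have hz : ∀ i j, i ≤ j → mulMap φp φm (z i j) = p i * (p j)⁻¹ := by
      intro i j hij
      simp only [z, p]
      split_ifs with h1 h2 h3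
      · exact hm ⟨(⟨i, h1⟩, ⟨j, h2⟩), h3⟩
      · have : i = j := Fin.ext (le_antisymm hij (by simpa using h3))
        subst this
        simp [mulMap_one]
      · simp
      · have := Fin.le_def.1 hij
        omega
      · simp [mulMap_one]
    have hc : IsCocycle φp φm z :=
      { eq_one := fun i j hij => by
          have := Fin.le_def.1 hij
          simp only [z]
          split_ifs with h1 h2 h3
          · have := Fin.lt_def.1 h3
            simp only at this
            omega
          · rfl
          · omega
          · rfl
        mul := fun i j k hij hjk => by
          rw [hz i j hij, hz j k hjk, hz i k (hij.trans hjk)]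
          group }
    obtain ⟨x, hx⟩ := exists_edge_eq hc
    refine ⟨x, funext fun i => ?_, funext fun r => ?_⟩
    · rw [hx]
      simp [z]
    · rw [hx]
      have := r.2
      simp only [z, Fin.val_castSucc, Fin.is_lt, dite_true]
      rw [dif_pos r.2]

/-- The manifold `Γ`, locally diffeomorphic to `H₊ × H₋` by `ξ ↦ (t^h ξ, s^v ξ)`. -/
def squareStr : ManifoldStr.{u, v} (LWSquare φp φm) := h.isLiftSpace_square.str

/-- The manifold `Γ̄_n`, locally diffeomorphic to `(H₋ × H₊) ^ n` by the edges ending at the last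
vertex. -/
def levelStr (n : ℕ) : ManifoldStr.{u, v} ((GammaBar φp φm).obj (op ⦋n⦌)) :=
  (h.isLiftSpace_level n).str

end IsLocalDouble

end LocalDouble

/-! ### Smooth maps into `Γ` and `Γ̄_n` -/

section LocalDouble

variable {EG G : Type*} [NormedAddCommGroup EG] [NormedSpace ℝ EG]
  [TopologicalSpace G] [ChartedSpace EG G] [Group G] [LieGroup 𝓘(ℝ, EG) ∞ G]
  {Ep Em : Type v} {Hp Hm : Type u}
  [NormedAddCommGroup Ep] [NormedSpace ℝ Ep] [FiniteDimensional ℝ Ep] [CompleteSpace Ep]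
  [TopologicalSpace Hp] [ChartedSpace Ep Hp] [Group Hp] [LieGroup 𝓘(ℝ, Ep) ∞ Hp] [T2Space Hp]
  [NormedAddCommGroup Em] [NormedSpace ℝ Em] [FiniteDimensional ℝ Em] [CompleteSpace Em]
  [TopologicalSpace Hm] [ChartedSpace Em Hm] [Group Hm] [LieGroup 𝓘(ℝ, Em) ∞ Hm] [T2Space Hm]
  {EZ Z : Type*} [NormedAddCommGroup EZ] [NormedSpace ℝ EZ] [TopologicalSpace Z]
  [ChartedSpace EZ Z]

namespace IsLocalDouble

variable {φp : Hp →* G} {φm : Hm →* G} (h : IsLocalDouble EG Ep Em φp φm)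
include h

section Square

theorem contMDiff_left :
    ContMDiff 𝓘(ℝ, h.squareStr.E) 𝓘(ℝ, Ep) ∞ (h.squareStr.mapTo LWSquare.left) :=
  contMDiff_fst'.comp h.isLiftSpace_square.smooth_base

theorem contMDiff_bottom :
    ContMDiff 𝓘(ℝ, h.squareStr.E) 𝓘(ℝ, Em) ∞ (h.squareStr.mapTo LWSquare.bottom) :=
  contMDiff_snd'.comp h.isLiftSpace_square.smooth_base

theorem contMDiff_top :
    ContMDiff 𝓘(ℝ, h.squareStr.E) 𝓘(ℝ, Em) ∞ (h.squareStr.mapTo LWSquare.top) :=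
  contMDiff_fst'.comp (h.isLiftSpace_square.smooth_lift ())

theorem contMDiff_right :
    ContMDiff 𝓘(ℝ, h.squareStr.E) 𝓘(ℝ, Ep) ∞ (h.squareStr.mapTo LWSquare.right) :=
  contMDiff_snd'.comp (h.isLiftSpace_square.smooth_lift ())

theorem contMDiff_square {f : Z → h.squareStr.Carrier}
    (h1 : ContMDiff 𝓘(ℝ, EZ) 𝓘(ℝ, Ep) ∞ fun z => h.squareStr.mapTo LWSquare.left (f z))
    (h2 : ContMDiff 𝓘(ℝ, EZ) 𝓘(ℝ, Em) ∞ fun z => h.squareStr.mapTo LWSquare.top (f z))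
    (h3 : ContMDiff 𝓘(ℝ, EZ) 𝓘(ℝ, Em) ∞ fun z => h.squareStr.mapTo LWSquare.bottom (f z))
    (h4 : ContMDiff 𝓘(ℝ, EZ) 𝓘(ℝ, Ep) ∞ fun z => h.squareStr.mapTo LWSquare.right (f z)) :
    ContMDiff 𝓘(ℝ, EZ) 𝓘(ℝ, h.squareStr.E) ∞ f :=
  h.isLiftSpace_square.contMDiff_of_components
    (fun z => contMDiffAt_prodModel_iff.2 ⟨h1 z, h3 z⟩)
    fun _ => h2.continuous.prodMk h4.continuous

theorem finiteDimensional_square : FiniteDimensional ℝ h.squareStr.E :=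
  inferInstanceAs (FiniteDimensional ℝ (Ep × Em))

/-- The projection to two of the four components is already étale, so the inclusion is an immersion.
-/
theorem isSmoothEmbedding_toProd : IsSmoothEmbedding 𝓘(ℝ, h.squareStr.E)
    (𝓘(ℝ, Ep).prod (𝓘(ℝ, Em).prod (𝓘(ℝ, Em).prod 𝓘(ℝ, Ep)))) ∞
    (h.squareStr.mapTo LWSquare.toProd) := by
  have := h.finiteDimensional_square
  have hs : ContMDiff 𝓘(ℝ, h.squareStr.E) 𝓘(ℝ, Ep × Em × Em × Ep) ∞
      (h.squareStr.mapTo LWSquare.toProd) := fun z =>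
    contMDiffAt_prodModel_iff.2 ⟨h.contMDiff_left z, contMDiffAt_prodModel_iff.2
      ⟨h.contMDiff_top z, contMDiffAt_prodModel_iff.2 ⟨h.contMDiff_bottom z, h.contMDiff_right z⟩⟩⟩
  let P : Hp × Hm × Hm × Hp → Hp × Hm := fun y => (y.1, y.2.2.1)
  have hP : ContMDiff 𝓘(ℝ, Ep × Em × Em × Ep) 𝓘(ℝ, Ep × Em) ∞ P := fun z =>
    contMDiffAt_prodModel_iff.2 ⟨contMDiff_fst' z,
      ((contMDiff_fst'.comp contMDiff_snd').comp contMDiff_snd') z⟩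
  have hi := isImmersion_of_injective hs fun x => by
    refine (injective_iff_map_eq_zero _).2 fun w hw => ?_
    refine h.isLiftSpace_square.eq_zero_of_tder_base (x := x) ?_
    have h1 := tder_comp (g := P) rfl (hP.mdifferentiable (by simp) _)
      (hs.mdifferentiable (by simp) x)
    refine (congrArg (fun L : h.squareStr.E →L[ℝ] Ep × Em => L w) h1).trans ?_
    exact (congrArg (tder (Ep × Em × Em × Ep) (Ep × Em) P _) hw).trans
      (ContinuousLinearMap.map_zero _)
  simp only [modelWithCornersSelf_prod] at hi
  refine ⟨hi, ?_⟩
  let F : Hp × Hm × Hm × Hp → (Hp × Hm) × (Unit → Hm × Hp) :=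
    fun y => ((y.1, y.2.2.1), fun _ => (y.2.1, y.2.2.2))
  have hF : Continuous F := by fun_prop
  exact Topology.IsEmbedding.of_comp hs.continuous hF h.isLiftSpace_square.embedding

end Square

section Level

variable (n : ℕ) (i j : Fin (n + 1))

/-- The edge `i ≤ j`, as a map on `Γ̄_n`. -/
def edgeFun : (h.levelStr n).Carrier → Hm × Hp :=
  (h.levelStr n).mapTo fun x => edge (φp := φp) (φm := φm) (n := n) x i j

/-- An edge is trivial, ends at the last vertex (and is a coordinate of the base), or is one of the
lifted components. -/
theorem edgeFun_cases : (∀ x, h.edgeFun n i j x = 1) ∨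
    (∃ k, ∀ x, h.edgeFun n i j x =
      edge (φp := φp) (φm := φm) (n := n) x (Fin.castSucc k) (Fin.last n)) ∨
    ∃ r : InnerPair n, ∀ x, h.edgeFun n i j x =
      edge (φp := φp) (φm := φm) (n := n) x r.1.1.castSucc r.1.2.castSucc := by
  rcases le_or_gt j i with hij | hij
  · exact Or.inl fun x => (edge_isCocycle (φp := φp) (φm := φm) (n := n) x).eq_one i j hij
  · obtain ⟨i, rfl⟩ := Fin.exists_castSucc_eq.2 (hij.trans_le (Fin.le_last j)).ne
    rcases eq_or_ne j (Fin.last n) with rfl | hj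
    · exact Or.inr (Or.inl ⟨i, fun _ => rfl⟩)
    · obtain ⟨j, rfl⟩ := Fin.exists_castSucc_eq.2 hj
      exact Or.inr (Or.inr ⟨⟨(i, j), hij⟩, fun _ => rfl⟩)

theorem contMDiff_edgeFun :
    ContMDiff 𝓘(ℝ, (h.levelStr n).E) 𝓘(ℝ, Em × Ep) ∞ (h.edgeFun n i j) := by
  rcases h.edgeFun_cases n i j with h1 | ⟨k, h1⟩ | ⟨r, h1⟩
  · rw [funext h1]
    exact contMDiff_const
  · rw [funext h1]
    exact (contMDiff_eval k).comp (h.isLiftSpace_level n).smooth_base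
  · rw [funext h1]
    exact (h.isLiftSpace_level n).smooth_lift r

/-- A map to `Γ̄_n` is smooth if its edges are. -/
theorem contMDiff_level {n : ℕ} {f : Z → (h.levelStr n).Carrier}
    (hf : ∀ i j, ContMDiff 𝓘(ℝ, EZ) 𝓘(ℝ, Em × Ep) ∞ fun z => h.edgeFun n i j (f z)) :
    ContMDiff 𝓘(ℝ, EZ) 𝓘(ℝ, (h.levelStr n).E) ∞ f :=
  (h.isLiftSpace_level n).contMDiff_of_components
    (fun z => contMDiffAt_pow_iff.2 fun k => hf k.castSucc (Fin.last n) z)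
    fun r => (hf r.1.1.castSucc r.1.2.castSucc).continuous

theorem isEmbedding_edgeFun : Topology.IsEmbedding fun x i j => h.edgeFun n i j x := by
  let F : (Fin (n + 1) → Fin (n + 1) → Hm × Hp) → (Fin n → Hm × Hp) × (InnerPair n → Hm × Hp) :=
    fun y => (fun i => y i.castSucc (Fin.last n), fun r => y r.1.1.castSucc r.1.2.castSucc)
  have hF : Continuous F := by fun_prop
  exact Topology.IsEmbedding.of_comp (continuous_pi fun i => continuous_pi fun j =>
    (h.contMDiff_edgeFun n i j).continuous) hF (h.isLiftSpace_level n).embedding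

/-- A tangent vector of `Γ̄_n` is determined by the edges ending at the last vertex. -/
theorem eq_zero_of_tder_edgeFun {n : ℕ} (x : (h.levelStr n).Carrier) (w : (h.levelStr n).E)
    (hw : ∀ i, tder (h.levelStr n).E (Em × Ep)
      (h.edgeFun n (Fin.castSucc i) (Fin.last n)) x w = 0) : w = 0 := by
  refine (h.isLiftSpace_level n).eq_zero_of_tder_base (x := x) (funext fun i => ?_)
  exact (tder_pow_apply ((h.isLiftSpace_level n).smooth_base.mdifferentiable (by simp) x) w i).trans
    (hw i)

theorem finiteDimensional_level : FiniteDimensional ℝ (h.levelStr n).E :=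
  inferInstanceAs (FiniteDimensional ℝ (Fin n → Em × Ep))

/-- The simplicial manifold `Γ̄`. -/
def simplicialManifold : SimplicialManifold.{u, v} (GammaBar φp φm) where
  lvl := h.levelStr
  smooth_map {m n} f := h.contMDiff_level fun i j => by
    have h1 : (fun z => h.edgeFun m i j ((h.levelStr n).mapOf (h.levelStr m)
        ((GammaBar φp φm).map f.op) z)) = h.edgeFun n (f.toOrderHom i) (f.toOrderHom j) :=
      funext fun x => edge_map_apply f x i j
    rw [h1]
    exact h.contMDiff_edgeFun _ _ _

end Level

end IsLocalDouble

end LocalDouble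

/-! ### The entries of a simplex, and `Γ̄_1` and `Γ̄_2` -/

section LocalDouble

variable {EG G : Type*} [NormedAddCommGroup EG] [NormedSpace ℝ EG]
  [TopologicalSpace G] [ChartedSpace EG G] [Group G] [LieGroup 𝓘(ℝ, EG) ∞ G]
  {Ep Em : Type v} {Hp Hm : Type u}
  [NormedAddCommGroup Ep] [NormedSpace ℝ Ep] [FiniteDimensional ℝ Ep] [CompleteSpace Ep]
  [TopologicalSpace Hp] [ChartedSpace Ep Hp] [Group Hp] [LieGroup 𝓘(ℝ, Ep) ∞ Hp] [T2Space Hp]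
  [NormedAddCommGroup Em] [NormedSpace ℝ Em] [FiniteDimensional ℝ Em] [CompleteSpace Em]
  [TopologicalSpace Hm] [ChartedSpace Em Hm] [Group Hm] [LieGroup 𝓘(ℝ, Em) ∞ Hm] [T2Space Hm]
  {EZ Z : Type*} [NormedAddCommGroup EZ] [NormedSpace ℝ EZ] [TopologicalSpace Z]
  [ChartedSpace EZ Z]

namespace IsLocalDouble

variable {φp : Hp →* G} {φm : Hm →* G} (h : IsLocalDouble EG Ep Em φp φm)
include h

section Entries

theorem contMDiff_entry (n : ℕ) (a : EntryIdx n) : ContMDiff 𝓘(ℝ, (h.levelStr n).E)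
    𝓘(ℝ, h.squareStr.E) ∞ ((h.levelStr n).mapOf h.squareStr (entry n a)) := by
  obtain ⟨k, r, c⟩ := a
  have hM (i j : Fin (n + 1)) := contMDiff_fst'.comp (h.contMDiff_edgeFun n i j)
  have hP (i j : Fin (n + 1)) := contMDiff_snd'.comp (h.contMDiff_edgeFun n i j)
  have key (x : (h.levelStr n).Carrier) :=
    cell_eq_square (φp := φp) (φm := φm) (n := n) x k r c
  refine h.contMDiff_square ?_ ?_ ?_ ?_
  · exact ((hP _ _).mul (hP _ _).inv).congr fun x =>
      (congrArg LWSquare.left (key x)).trans (IsCocycle.square_left ..)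
  · exact ((hM _ _).inv.mul (hM _ _)).congr fun x =>
      (congrArg LWSquare.top (key x)).trans (IsCocycle.square_top ..)
  · exact ((hM _ _).inv.mul (hM _ _)).congr fun x =>
      (congrArg LWSquare.bottom (key x)).trans (IsCocycle.square_bottom ..)
  · exact ((hP _ _).mul (hP _ _).inv).congr fun x =>
      (congrArg LWSquare.right (key x)).trans (IsCocycle.square_right ..)

/-- The edges of a simplex are components of its entries. -/
theorem exists_edgeFun_eq_entry (n : ℕ) (i j : Fin (n + 1)) : (∀ x, h.edgeFun n i j x = 1) ∨
    ∃ a b : EntryIdx n, ∀ x, h.edgeFun n i j x =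
      (h.squareStr.mapTo LWSquare.top ((h.levelStr n).mapOf h.squareStr (entry n a) x),
        h.squareStr.mapTo LWSquare.left ((h.levelStr n).mapOf h.squareStr (entry n b) x)) := by
  rcases le_or_gt i j with hij | hij
  · refine Or.inr ⟨⟨i, ⟨(⟨i, by omega⟩, ⟨i, by omega⟩), le_rfl⟩, ⟨(⟨i - i, by omega⟩,
      ⟨j - i, by omega⟩), Fin.mk_le_mk.2 (Nat.sub_le_sub_right hij i)⟩⟩,
      ⟨j, ⟨(⟨i, by omega⟩, ⟨j, by omega⟩), hij⟩, ⟨(⟨j - j, by omega⟩, ⟨j - j, by omega⟩), le_rfl⟩⟩,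
      fun x => ?_⟩
    exact edge_of_le (φp := φp) (φm := φm) (n := n) x hij
  · exact Or.inl fun x => (edge_isCocycle (φp := φp) (φm := φm) (n := n) x).eq_one i j hij.le

/-- The entries embed `Γ̄_n`, since every edge is a component of an entry. -/
theorem isJointSmoothEmbedding_entry (n : ℕ) :
    IsJointSmoothEmbedding (h.levelStr n) h.squareStr
      fun a : EntryIdx n => (h.levelStr n).mapOf h.squareStr (entry n a) := by
  have := h.finiteDimensional_level n
  have := h.finiteDimensional_square
  refine isJointSmoothEmbedding_of_injective (h.contMDiff_entry n) ?_ fun x w hw => ?_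
  · have key (i j : Fin (n + 1)) : ∃ F : (EntryIdx n → h.squareStr.Carrier) → Hm × Hp,
        Continuous F ∧ ∀ x, h.edgeFun n i j x =
          F fun a => (h.levelStr n).mapOf h.squareStr (entry n a) x := by
      rcases h.exists_edgeFun_eq_entry n i j with h1 | ⟨a, b, h1⟩
      · exact ⟨fun _ => 1, continuous_const, h1⟩
      · exact ⟨fun y => (h.squareStr.mapTo LWSquare.top (y a),
            h.squareStr.mapTo LWSquare.left (y b)),
          (h.contMDiff_top.continuous.comp (continuous_apply a)).prodMk
            (h.contMDiff_left.continuous.comp (continuous_apply b)), h1⟩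
    choose F hF hF' using key
    have h1 := h.isEmbedding_edgeFun n
    have h2 : (fun x i j => h.edgeFun n i j x) = (fun y i j => F i j y) ∘
        fun x a => (h.levelStr n).mapOf h.squareStr (entry n a) x :=
      funext fun x => funext₂ fun i j => hF' i j x
    rw [h2] at h1
    exact Topology.IsEmbedding.of_comp
      (continuous_pi fun a => (h.contMDiff_entry n a).continuous)
      (continuous_pi fun i => continuous_pi fun j => hF i j) h1
  · refine h.eq_zero_of_tder_edgeFun x w fun i => ?_
    rcases h.exists_edgeFun_eq_entry n i.castSucc (Fin.last n) with h1 | ⟨a, b, h1⟩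
    · rw [funext h1, tder_const]
      rfl
    · rw [tder_prod_apply ((h.contMDiff_edgeFun n _ _).mdifferentiable (by simp) x), funext h1]
      refine Prod.ext ?_ ?_
      · have h2 := tder_comp (g := h.squareStr.mapTo LWSquare.top) rfl
          (h.contMDiff_top.mdifferentiable (by simp) _)
          ((h.contMDiff_entry n a).mdifferentiable (by simp) x)
        refine (congrArg (fun L : (h.levelStr n).E →L[ℝ] Em => L w) h2).trans ?_
        exact (congrArg (tder h.squareStr.E Em _ _) (hw a)).trans (ContinuousLinearMap.map_zero _)
      · have h2 := tder_comp (g := h.squareStr.mapTo LWSquare.left) rfl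
          (h.contMDiff_left.mdifferentiable (by simp) _)
          ((h.contMDiff_entry n b).mdifferentiable (by simp) x)
        refine (congrArg (fun L : (h.levelStr n).E →L[ℝ] Ep => L w) h2).trans ?_
        exact (congrArg (tder h.squareStr.E Ep _ _) (hw b)).trans (ContinuousLinearMap.map_zero _)

end Entries

section LowLevels

/-- The diffeomorphism `Γ̄_1 → H₋ × H₊`. -/
def diffeoOne : Diffeomorph 𝓘(ℝ, (h.levelStr 1).E) 𝓘(ℝ, Em × Ep) (h.levelStr 1).Carrier
    (Hm × Hp) ∞ where
  toFun := h.edgeFun 1 0 1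
  invFun := (Equiv.ofBijective _ (edge_one_bijective (φp := φp) (φm := φm))).symm
  left_inv := (Equiv.ofBijective _ (edge_one_bijective (φp := φp) (φm := φm))).symm_apply_apply
  right_inv := (Equiv.ofBijective _ (edge_one_bijective (φp := φp) (φm := φm))).apply_symm_apply
  contMDiff_toFun := h.contMDiff_edgeFun 1 0 1
  contMDiff_invFun := h.contMDiff_level fun i j => by
    have h1 := (Equiv.ofBijective _ (edge_one_bijective (φp := φp) (φm := φm))).apply_symm_apply
    have h2 (y : Hm × Hp) (hij : j ≤ i) := (edge_isCocycle (φp := φp) (φm := φm) (n := 1)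
      ((Equiv.ofBijective _ (edge_one_bijective (φp := φp) (φm := φm))).symm y)).eq_one i j hij
    rcases le_or_gt j i with hij | hij
    · exact contMDiff_const.congr fun y => h2 y hij
    · obtain ⟨rfl, rfl⟩ : i = 0 ∧ j = 1 := by
        have := Fin.lt_def.1 hij
        exact ⟨Fin.ext (by simp; omega), Fin.ext (by simp; omega)⟩
      exact contMDiff_id.congr h1

/-- The diffeomorphism `Γ̄_2 → H₋ × Γ × H₊`. -/
def diffeoTwo : Diffeomorph 𝓘(ℝ, (h.levelStr 2).E) 𝓘(ℝ, Em × h.squareStr.E × Ep)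
    (h.levelStr 2).Carrier (Hm × h.squareStr.Carrier × Hp) ∞ where
  toFun := level2
  invFun := (Equiv.ofBijective _ (level2_bijective (φp := φp) (φm := φm))).symm
  left_inv := (Equiv.ofBijective _ (level2_bijective (φp := φp) (φm := φm))).symm_apply_apply
  right_inv := (Equiv.ofBijective _ (level2_bijective (φp := φp) (φm := φm))).apply_symm_apply
  contMDiff_toFun := fun x => contMDiffAt_prodModel_iff.2
    ⟨(h.contMDiff_top.comp (h.contMDiff_entry 2 _)) x, contMDiffAt_prodModel_iff.2
      ⟨h.contMDiff_entry 2 _ x, (h.contMDiff_left.comp (h.contMDiff_entry 2 _)) x⟩⟩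
  contMDiff_invFun := h.contMDiff_level fun i j => by
    have h1 (y : Hm × h.squareStr.Carrier × Hp) := edge_of_level2_eq (φp := φp) (φm := φm)
      ((Equiv.ofBijective _ (level2_bijective (φp := φp) (φm := φm))).apply_symm_apply y)
    have h2 (y : Hm × h.squareStr.Carrier × Hp) (hij : j ≤ i) :=
      (edge_isCocycle (φp := φp) (φm := φm) (n := 2) ((Equiv.ofBijective _
        (level2_bijective (φp := φp) (φm := φm))).symm y)).eq_one i j hij
    have s1 : ContMDiff 𝓘(ℝ, Em × h.squareStr.E × Ep) 𝓘(ℝ, Em) ∞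
      fun y : Hm × h.squareStr.Carrier × Hp => y.1 := contMDiff_fst'
    have s2 : ContMDiff 𝓘(ℝ, Em × h.squareStr.E × Ep) 𝓘(ℝ, h.squareStr.E) ∞
      fun y : Hm × h.squareStr.Carrier × Hp => y.2.1 := contMDiff_fst'.comp contMDiff_snd'
    have s3 : ContMDiff 𝓘(ℝ, Em × h.squareStr.E × Ep) 𝓘(ℝ, Ep) ∞
      fun y : Hm × h.squareStr.Carrier × Hp => y.2.2 := contMDiff_snd'.comp contMDiff_snd'
    rcases le_or_gt j i with hij | hij
    · exact contMDiff_const.congr fun y => h2 y hij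
    · obtain ⟨rfl, rfl⟩ | ⟨rfl, rfl⟩ | ⟨rfl, rfl⟩ : (i = 0 ∧ j = 1) ∨ (i = 0 ∧ j = 2) ∨
          (i = 1 ∧ j = 2) := by
        simp only [Fin.ext_iff]
        have := Fin.lt_def.1 hij
        have := j.2
        simp
        omega
      · exact ContMDiff.congr (f := fun y : Hm × h.squareStr.Carrier × Hp =>
          (y.1, h.squareStr.mapTo LWSquare.left y.2.1)) (fun y => contMDiffAt_prodModel_iff.2
          ⟨s1 y, (h.contMDiff_left.comp s2) y⟩) fun y => (h1 y).1
      · exact ContMDiff.congr (f := fun y : Hm × h.squareStr.Carrier × Hp =>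
          (y.1 * h.squareStr.mapTo LWSquare.top y.2.1,
            h.squareStr.mapTo LWSquare.right y.2.1 * y.2.2))
          (fun y => contMDiffAt_prodModel_iff.2
          ⟨(s1.mul (h.contMDiff_top.comp s2)) y, ((h.contMDiff_right.comp s2).mul s3) y⟩)
          fun y => (h1 y).2.1
      · exact ContMDiff.congr (f := fun y : Hm × h.squareStr.Carrier × Hp =>
          (h.squareStr.mapTo LWSquare.bottom y.2.1, y.2.2)) (fun y => contMDiffAt_prodModel_iff.2
          ⟨(h.contMDiff_bottom.comp s2) y, s3 y⟩) fun y => (h1 y).2.2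

end LowLevels

end IsLocalDouble

end LocalDouble

/-! ### Horn projections -/

section LocalDouble

variable {EG G : Type*} [NormedAddCommGroup EG] [NormedSpace ℝ EG]
  [TopologicalSpace G] [ChartedSpace EG G] [Group G] [LieGroup 𝓘(ℝ, EG) ∞ G]
  {Ep Em : Type v} {Hp Hm : Type u}
  [NormedAddCommGroup Ep] [NormedSpace ℝ Ep] [FiniteDimensional ℝ Ep] [CompleteSpace Ep]
  [TopologicalSpace Hp] [ChartedSpace Ep Hp] [Group Hp] [LieGroup 𝓘(ℝ, Ep) ∞ Hp] [T2Space Hp]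
  [NormedAddCommGroup Em] [NormedSpace ℝ Em] [FiniteDimensional ℝ Em] [CompleteSpace Em]
  [TopologicalSpace Hm] [ChartedSpace Em Hm] [Group Hm] [LieGroup 𝓘(ℝ, Em) ∞ Hm] [T2Space Hm]
  {EZ Z : Type*} [NormedAddCommGroup EZ] [NormedSpace ℝ EZ] [TopologicalSpace Z]
  [ChartedSpace EZ Z]

namespace IsLocalDouble

variable {φp : Hp →* G} {φm : Hm →* G} (h : IsLocalDouble EG Ep Em φp φm)
include h

section ThirdEdge

theorem contMDiff_mulMap : ContMDiff 𝓘(ℝ, Em × Ep) 𝓘(ℝ, EG) ∞ (mulMap φp φm) :=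
  h.localDiffeo.contMDiff

theorem tder_mulMap_injective (y : Hm × Hp) :
    Function.Injective (tder (Em × Ep) EG (mulMap φp φm) y) :=
  ((h.localDiffeo y).mfderivToContinuousLinearEquiv (by simp)).injective

/-- The edge `i ≤ j`, mapped to `G`. -/
def edgeG (n : ℕ) (i j : Fin (n + 1)) (x : (h.levelStr n).Carrier) : G :=
  mulMap φp φm (h.edgeFun n i j x)

theorem contMDiff_edgeG (n : ℕ) (i j : Fin (n + 1)) :
    ContMDiff 𝓘(ℝ, (h.levelStr n).E) 𝓘(ℝ, EG) ∞ (h.edgeG n i j) :=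
  h.contMDiff_mulMap.comp (h.contMDiff_edgeFun n i j)

/-- Since the multiplication map is étale, an edge is infinitesimally constant if and only if its
image in `G` is. -/
theorem lLog_edgeG_eq_zero_iff {n : ℕ} {i j : Fin (n + 1)} {x : (h.levelStr n).Carrier}
    {w : (h.levelStr n).E} : lLog (h.levelStr n).E EG (h.edgeG n i j) x w = 0 ↔
      tder (h.levelStr n).E (Em × Ep) (h.edgeFun n i j) x w = 0 := by
  rw [lLog_eq_zero_iff ((h.contMDiff_edgeG n i j).mdifferentiable (by simp) x)]
  have h1 : tder (h.levelStr n).E EG (h.edgeG n i j) x w =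
      tder (Em × Ep) EG (mulMap φp φm) (h.edgeFun n i j x)
        (tder (h.levelStr n).E (Em × Ep) (h.edgeFun n i j) x w) :=
    congrArg (fun L : (h.levelStr n).E →L[ℝ] EG => L w)
      (tder_comp (g := mulMap φp φm) (f := h.edgeFun n i j) rfl
        (h.contMDiff_mulMap.mdifferentiable (by simp) _)
        ((h.contMDiff_edgeFun n i j).mdifferentiable (by simp) x))
  rw [h1]
  refine ⟨fun h2 => h.tder_mulMap_injective _ (h2.trans (ContinuousLinearMap.map_zero _).symm),
    fun h2 => ?_⟩
  rw [h2]
  exact ContinuousLinearMap.map_zero _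

theorem lLog_edgeG_mul {n : ℕ} {i j k : Fin (n + 1)} (hij : i ≤ j) (hjk : j ≤ k)
    (x : (h.levelStr n).Carrier) (w : (h.levelStr n).E) :
    lLog (h.levelStr n).E EG (h.edgeG n i k) x w =
      adj EG (h.edgeG n j k x)⁻¹ (lLog (h.levelStr n).E EG (h.edgeG n i j) x w) +
        lLog (h.levelStr n).E EG (h.edgeG n j k) x w := by
  have h1 : h.edgeG n i k = fun z => h.edgeG n i j z * h.edgeG n j k z := funext fun z =>
    ((edge_isCocycle (φp := φp) (φm := φm) (n := n) z).mul i j k hij hjk).symm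
  rw [h1, lLog_mul ((h.contMDiff_edgeG n i j).mdifferentiable (by simp) x)
    ((h.contMDiff_edgeG n j k).mdifferentiable (by simp) x)]
  rfl

/-- A tangent vector of `Γ̄_2` is zero if the two edges at some vertex `t` are infinitesimally
constant along it. -/
theorem eq_zero_of_two_edges {x : (h.levelStr 2).Carrier} {w : (h.levelStr 2).E}
    {t : Fin 3} (hw : ∀ i j, i < j → ¬(i ≠ t ∧ j ≠ t) →
      tder (h.levelStr 2).E (Em × Ep) (h.edgeFun 2 i j) x w = 0) : w = 0 := by
  have h3 := h.lLog_edgeG_mul (i := 0) (j := 1) (k := 2) (by decide) (by decide) x w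
  simp only [← h.lLog_edgeG_eq_zero_iff] at hw
  have key : lLog (h.levelStr 2).E EG (h.edgeG 2 0 2) x w = 0 ∧
      lLog (h.levelStr 2).E EG (h.edgeG 2 1 2) x w = 0 := by
    fin_cases t
    · have e1 := hw 0 1 (by decide) (by decide)
      have e2 := hw 0 2 (by decide) (by decide)
      rw [e1, e2, map_zero, zero_add] at h3
      exact ⟨e2, h3.symm⟩
    · have e1 := hw 0 1 (by decide) (by decide)
      have e2 := hw 1 2 (by decide) (by decide)
      rw [e1, e2, map_zero, zero_add] at h3
      exact ⟨h3, e2⟩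
    · exact ⟨hw 0 2 (by decide) (by decide), hw 1 2 (by decide) (by decide)⟩
  refine h.eq_zero_of_tder_edgeFun x w fun i => ?_
  rw [← h.lLog_edgeG_eq_zero_iff]
  fin_cases i
  · exact key.1
  · exact key.2

end ThirdEdge

section Horns

theorem contMDiff_map {m n : ℕ} (f : ⦋m⦌ ⟶ ⦋n⦌) :
    ContMDiff 𝓘(ℝ, (h.levelStr n).E) 𝓘(ℝ, (h.levelStr m).E) ∞
      ((h.levelStr n).mapOf (h.levelStr m) ((GammaBar φp φm).map f.op)) :=
  h.simplicialManifold.smooth_map f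

theorem contMDiff_δ {n : ℕ} (i : Fin (n + 2)) :
    ContMDiff 𝓘(ℝ, (h.levelStr (n + 1)).E) 𝓘(ℝ, (h.levelStr n).E) ∞
      ((h.levelStr (n + 1)).mapOf (h.levelStr n) ((GammaBar φp φm).δ i)) :=
  h.contMDiff_map (SimplexCategory.δ i)

/-- An edge missing the vertex `k` is infinitesimally constant along a vector killed by the `k`-th
face map. -/
theorem tder_edgeFun_eq_zero {n : ℕ} {k i j : Fin (n + 2)} (hi : i ≠ k) (hj : j ≠ k)
    {x : (h.levelStr (n + 1)).Carrier} {w : (h.levelStr (n + 1)).E}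
    (hw : tder (h.levelStr (n + 1)).E (h.levelStr n).E
      ((h.levelStr (n + 1)).mapOf (h.levelStr n) ((GammaBar φp φm).δ k)) x w = 0) :
    tder (h.levelStr (n + 1)).E (Em × Ep) (h.edgeFun (n + 1) i j) x w = 0 := by
  obtain ⟨i', j', h1⟩ := edge_eq_edge_face (φp := φp) (φm := φm) k i j hi hj
  have h2 : h.edgeFun (n + 1) i j = fun z => h.edgeFun n i' j'
    ((h.levelStr (n + 1)).mapOf (h.levelStr n) ((GammaBar φp φm).δ k) z) := funext h1
  rw [h2, tder_comp (g := h.edgeFun n i' j') rfl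
    ((h.contMDiff_edgeFun n i' j').mdifferentiable (by simp) _)
    ((h.contMDiff_δ k).mdifferentiable (by simp) x)]
  exact (congrArg (tder (h.levelStr n).E (Em × Ep) _ _) hw).trans (ContinuousLinearMap.map_zero _)

theorem hornFaces_bijective {l : ℕ} (hl : l ≤ 1) (j : Fin (l + 2)) :
    Function.Bijective fun (y : HornSpace (GammaBar φp φm) (l + 1) j)
      (i : {i : Fin (l + 2) // i ≠ j}) => (show (h.levelStr l).Carrier from hornFace _ l j i y) :=
  ⟨fun _ _ hxy => horn_ext fun i => congrFun hxy i, fun f =>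
    (exists_hornFace_eq hl f).imp fun _ hy => funext hy⟩

/-- The manifold of horns of dimension one or two: the faces may be prescribed arbitrarily. -/
def lowHornStr {l : ℕ} (hl : l ≤ 1) (j : Fin (l + 2)) :
    ManifoldStr.{u, v} (HornSpace (GammaBar φp φm) (l + 1) j) :=
  transportStr ({i : Fin (l + 2) // i ≠ j} → (h.levelStr l).E) (h.hornFaces_bijective hl j)

theorem hornFilling_bijective {l : ℕ} (hl : 2 ≤ l) (j : Fin (l + 2)) :
    Function.Bijective fun y : HornSpace (GammaBar φp φm) (l + 1) j =>
      (show (h.levelStr (l + 1)).Carrier from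
        (Equiv.ofBijective _ (hornProj_bijective (φp := φp) (φm := φm) hl j)).symm y) :=
  (Equiv.ofBijective _ (hornProj_bijective (φp := φp) (φm := φm) hl j)).symm.bijective

/-- The manifold of horns of higher dimension: horns have unique fillers. -/
def highHornStr {l : ℕ} (hl : 2 ≤ l) (j : Fin (l + 2)) :
    ManifoldStr.{u, v} (HornSpace (GammaBar φp φm) (l + 1) j) :=
  transportStr (h.levelStr (l + 1)).E (h.hornFilling_bijective hl j)

theorem contMDiff_hornFace_low {l : ℕ} (hl : l ≤ 1) (j : Fin (l + 2))
    (i : {i : Fin (l + 2) // i ≠ j}) :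
    ContMDiff 𝓘(ℝ, (h.lowHornStr hl j).E) 𝓘(ℝ, (h.levelStr l).E) ∞
      ((h.lowHornStr hl j).mapOf (h.levelStr l) (hornFace _ l j i)) :=
  (contMDiff_eval i).comp (contMDiff_transport (h.hornFaces_bijective hl j))

theorem finiteDimensional_lowHorn {l : ℕ} (hl : l ≤ 1) (j : Fin (l + 2)) :
    FiniteDimensional ℝ (h.lowHornStr hl j).E :=
  inferInstanceAs (FiniteDimensional ℝ ({i : Fin (l + 2) // i ≠ j} → Fin l → Em × Ep))

theorem isJointSmoothEmbedding_lowHorn {l : ℕ} (hl : l ≤ 1) (j : Fin (l + 2)) :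
    IsJointSmoothEmbedding (h.lowHornStr hl j) (h.levelStr l)
      fun i => (h.lowHornStr hl j).mapOf (h.levelStr l) (hornFace _ l j i) := by
  have := h.finiteDimensional_level l
  have := h.finiteDimensional_lowHorn hl j
  refine isJointSmoothEmbedding_of_injective (h.contMDiff_hornFace_low hl j)
    (isEmbedding_transport (E := {i : Fin (l + 2) // i ≠ j} → (h.levelStr l).E)
      (h.hornFaces_bijective hl j)) fun x w hw => ?_
  refine (transportModel (E := {i : Fin (l + 2) // i ≠ j} → (h.levelStr l).E)
      (h.hornFaces_bijective hl j)).map_eq_zero_iff.1 ?_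
  have h1 := tder_transport (E := {i : Fin (l + 2) // i ≠ j} → (h.levelStr l).E)
      (h.hornFaces_bijective hl j) x
  refine (congrArg (fun L => L w) h1).symm.trans (funext fun i => ?_)
  exact (tder_pow_apply ((contMDiff_transport (h.hornFaces_bijective hl j)).mdifferentiable
    (by simp) x) w i).trans (hw i)

theorem contMDiff_hornProj_low {l : ℕ} (hl : l ≤ 1) (j : Fin (l + 2)) :
    ContMDiff 𝓘(ℝ, (h.levelStr (l + 1)).E) 𝓘(ℝ, (h.lowHornStr hl j).E) ∞
      ((h.levelStr (l + 1)).mapOf (h.lowHornStr hl j) (hornProj _ (l + 1) j)) :=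
  contMDiff_of_transport (h.hornFaces_bijective hl j) fun x =>
    contMDiffAt_pow_iff.2 fun i => h.contMDiff_δ i.1 x

/-- A horn of dimension one is a point. -/
theorem isSubmersionAt_hornProj_zero (j : Fin 2) (x : (h.levelStr 1).Carrier) :
    IsSubmersionAt 𝓘(ℝ, (h.levelStr 1).E) 𝓘(ℝ, (h.lowHornStr zero_le_one j).E) ∞
      ((h.levelStr 1).mapOf (h.lowHornStr zero_le_one j) (hornProj _ 1 j)) x := by
  have : Subsingleton (h.lowHornStr (l := 0) zero_le_one j).E :=
    inferInstanceAs (Subsingleton ({i : Fin 2 // i ≠ j} → Fin 0 → Em × Ep))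
  exact isSubmersionAt_of_subsingleton (h.contMDiff_hornProj_low zero_le_one j).continuous

/-- Two edges of a triangle determine the image in `G` of the third, so that a horn of dimension two
has locally a unique filler. -/
theorem isSubmersionAt_hornProj_one (j : Fin 3) (x : (h.levelStr 2).Carrier) :
    IsSubmersionAt 𝓘(ℝ, (h.levelStr 2).E) 𝓘(ℝ, (h.lowHornStr le_rfl j).E) ∞
      ((h.levelStr 2).mapOf (h.lowHornStr le_rfl j) (hornProj _ 2 j)) x := by
  have h0 := h.finiteDimensional_level 2
  have h0' := h.finiteDimensional_lowHorn le_rfl j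
  have hs := h.contMDiff_hornProj_low le_rfl j
  refine isSubmersionAt_of_isLocalDiffeomorphAt (isLocalDiffeomorphAt_of_bijective hs ?_)
  have hinj : Function.Injective (tder (h.levelStr 2).E (h.lowHornStr le_rfl j).E
      ((h.levelStr 2).mapOf (h.lowHornStr le_rfl j) (hornProj _ 2 j)) x) := by
    refine (injective_iff_map_eq_zero _).2 fun w hw => ?_
    have hδ (i : Fin 3) (hi : i ≠ j) : tder (h.levelStr 2).E (h.levelStr 1).E
        ((h.levelStr 2).mapOf (h.levelStr 1) ((GammaBar φp φm).δ i)) x w = 0 := by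
      have h1 := tder_comp (f := (h.levelStr 2).mapOf (h.lowHornStr le_rfl j) (hornProj _ 2 j))
        (g := (h.lowHornStr le_rfl j).mapOf (h.levelStr 1) (hornFace _ 1 j ⟨i, hi⟩)) rfl
        ((h.contMDiff_hornFace_low le_rfl j ⟨i, hi⟩).mdifferentiable (by simp) _)
        (hs.mdifferentiable (by simp) x)
      refine (congrArg (fun L : (h.levelStr 2).E →L[ℝ] (h.levelStr 1).E => L w) h1).trans ?_
      exact (congrArg (tder (h.lowHornStr le_rfl j).E (h.levelStr 1).E _ _) hw).trans
        (ContinuousLinearMap.map_zero _)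
    refine h.eq_zero_of_two_edges (t := j) (x := x) fun p q hpq hj => ?_
    obtain ⟨i, h1, h2, h3⟩ : ∃ i : Fin 3, i ≠ j ∧ p ≠ i ∧ q ≠ i := by
      have : ∀ j p q : Fin 3, p < q → ¬(p ≠ j ∧ q ≠ j) → ∃ i, i ≠ j ∧ p ≠ i ∧ q ≠ i := by decide
      exact this j p q hpq hj
    exact h.tder_edgeFun_eq_zero h2 h3 (hδ i h1)
  refine ⟨hinj, ?_⟩
  refine (LinearMap.injective_iff_surjective_of_finrank_eq_finrank
    (f := (tder (h.levelStr 2).E (h.lowHornStr le_rfl j).E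
      ((h.levelStr 2).mapOf (h.lowHornStr le_rfl j) (hornProj _ 2 j)) x).toLinearMap) ?_).1 hinj
  change Module.finrank ℝ (Fin 2 → Em × Ep) =
    Module.finrank ℝ ({i : Fin 3 // i ≠ j} → Fin 1 → Em × Ep)
  rw [Module.finrank_pi_fintype, Module.finrank_pi_fintype]
  simp [Module.finrank_pi_fintype]

section High

variable {l : ℕ} (hl : 2 ≤ l) (j : Fin (l + 2))

theorem finiteDimensional_highHorn : FiniteDimensional ℝ (h.highHornStr hl j).E :=
  inferInstanceAs (FiniteDimensional ℝ (Fin (l + 1) → Em × Ep))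

/-- The unique filler of a horn, as a function of the horn. -/
def filler : (h.highHornStr hl j).Carrier → (h.levelStr (l + 1)).Carrier :=
  (h.highHornStr hl j).mapOf (h.levelStr (l + 1))
    (Equiv.ofBijective _ (hornProj_bijective (φp := φp) (φm := φm) hl j)).symm

theorem contMDiff_filler : ContMDiff 𝓘(ℝ, (h.highHornStr hl j).E) 𝓘(ℝ, (h.levelStr (l + 1)).E) ∞
    (h.filler hl j) :=
  contMDiff_transport (h.hornFilling_bijective hl j)

theorem hornProj_filler (y : (h.highHornStr hl j).Carrier) :
    hornProj (GammaBar φp φm) (l + 1) j (h.filler hl j y) = y :=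
  (Equiv.ofBijective _ (hornProj_bijective (φp := φp) (φm := φm) hl j)).apply_symm_apply y

theorem filler_hornProj (x : (h.levelStr (l + 1)).Carrier) :
    h.filler hl j (hornProj (GammaBar φp φm) (l + 1) j x) = x :=
  (Equiv.ofBijective _ (hornProj_bijective (φp := φp) (φm := φm) hl j)).symm_apply_apply x

theorem contMDiff_hornProj_high :
    ContMDiff 𝓘(ℝ, (h.levelStr (l + 1)).E) 𝓘(ℝ, (h.highHornStr hl j).E) ∞
      ((h.levelStr (l + 1)).mapOf (h.highHornStr hl j) (hornProj _ (l + 1) j)) :=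
  contMDiff_of_transport (h.hornFilling_bijective hl j)
    (contMDiff_id.congr fun x => h.filler_hornProj hl j x)

theorem isLocalDiffeomorph_hornProj_high :
    IsLocalDiffeomorph 𝓘(ℝ, (h.levelStr (l + 1)).E) 𝓘(ℝ, (h.highHornStr hl j).E) ∞
      ((h.levelStr (l + 1)).mapOf (h.highHornStr hl j) (hornProj _ (l + 1) j)) :=
  Diffeomorph.isLocalDiffeomorph (M := (h.levelStr (l + 1)).Carrier)
    (N := (h.highHornStr hl j).Carrier)
    { toEquiv := Equiv.ofBijective _ (hornProj_bijective (φp := φp) (φm := φm) hl j)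
      contMDiff_toFun := h.contMDiff_hornProj_high hl j
      contMDiff_invFun := h.contMDiff_filler hl j }

theorem hornFace_eq_δ_filler (i : {i : Fin (l + 2) // i ≠ j}) :
    (h.highHornStr hl j).mapOf (h.levelStr l) (hornFace _ l j i) = fun y =>
      (h.levelStr (l + 1)).mapOf (h.levelStr l) ((GammaBar φp φm).δ i.1) (h.filler hl j y) := by
  funext y
  have h1 := hornFace_hornProj (GammaBar φp φm) l j i (h.filler hl j y)
  rw [h.hornProj_filler hl j y] at h1
  exact h1

/-- The faces embed the manifold of horns: every edge of the filler is an edge of a face of the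
horn. -/
theorem isJointSmoothEmbedding_highHorn :
    IsJointSmoothEmbedding (h.highHornStr hl j) (h.levelStr l)
      fun i => (h.highHornStr hl j).mapOf (h.levelStr l) (hornFace _ l j i) := by
  have := h.finiteDimensional_level l
  have := h.finiteDimensional_highHorn hl j
  have hs (i) : ContMDiff 𝓘(ℝ, (h.highHornStr hl j).E) 𝓘(ℝ, (h.levelStr l).E) ∞
      ((h.highHornStr hl j).mapOf (h.levelStr l) (hornFace _ l j i)) := by
    rw [h.hornFace_eq_δ_filler hl j i]
    exact (h.contMDiff_δ i.1).comp (h.contMDiff_filler hl j)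
  refine isJointSmoothEmbedding_of_injective hs ?_ fun y w hw => ?_
  · have key (p q : Fin (l + 2)) : ∃ F : ({i : Fin (l + 2) // i ≠ j} → (h.levelStr l).Carrier) →
        Hm × Hp, Continuous F ∧ ∀ y, h.edgeFun (l + 1) p q (h.filler hl j y) =
          F fun i => (h.highHornStr hl j).mapOf (h.levelStr l) (hornFace _ l j i) y := by
      obtain ⟨i, hi, hp, hq⟩ := exists_notMem_triple hl j p q
      obtain ⟨p', q', h1⟩ := edge_eq_edge_face (φp := φp) (φm := φm) i p q hp hq
      refine ⟨fun f => h.edgeFun l p' q' (f ⟨i, hi⟩),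
        (h.contMDiff_edgeFun l p' q').continuous.comp (continuous_apply _), fun y => ?_⟩
      refine (h1 _).trans ?_
      exact congrArg (h.edgeFun l p' q') (congrFun (h.hornFace_eq_δ_filler hl j ⟨i, hi⟩) y).symm
    choose F hF hF' using key
    have h1 := (h.isEmbedding_edgeFun (l + 1)).comp
      (isEmbedding_transport (E := (h.levelStr (l + 1)).E) (h.hornFilling_bijective hl j))
    refine Topology.IsEmbedding.of_comp (continuous_pi fun i => (hs i).continuous)
      (continuous_pi fun p => continuous_pi fun q => hF p q) ?_
    have h2 : (fun (f : {i : Fin (l + 2) // i ≠ j} → (h.levelStr l).Carrier) p q => F p q f) ∘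
        (fun y i => (h.highHornStr hl j).mapOf (h.levelStr l) (hornFace _ l j i) y) =
        fun y p q => h.edgeFun (l + 1) p q (h.filler hl j y) :=
      funext fun y => funext₂ fun p q => (hF' p q y).symm
    rw [h2]
    exact h1
  · have hfill : Function.Injective (tder (h.highHornStr hl j).E (h.levelStr (l + 1)).E
        (h.filler hl j) y) := by
      have h1 := tder_transport (h.hornFilling_bijective hl j) y
      have h2 := (transportModel (E := (h.levelStr (l + 1)).E)
        (h.hornFilling_bijective hl j)).injective
      exact (congrArg (fun L : (h.highHornStr hl j).E →L[ℝ] (h.levelStr (l + 1)).E =>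
        Function.Injective L) h1).mpr h2
    refine hfill (Eq.trans ?_ (ContinuousLinearMap.map_zero _).symm)
    refine h.eq_zero_of_tder_edgeFun (h.filler hl j y) _ fun q => ?_
    obtain ⟨i, hi, hp, hq⟩ := exists_notMem_triple hl j q.castSucc (Fin.last (l + 1))
    refine h.tder_edgeFun_eq_zero hp hq ?_
    have h1 := hw ⟨i, hi⟩
    rw [h.hornFace_eq_δ_filler hl j ⟨i, hi⟩, tder_comp
      (g := (h.levelStr (l + 1)).mapOf (h.levelStr l) ((GammaBar φp φm).δ i)) rfl
      ((h.contMDiff_δ i).mdifferentiable (by simp) _)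
      ((h.contMDiff_filler hl j).mdifferentiable (by simp) y)] at h1
    exact h1

end High

theorem isLocalLieGroup : h.simplicialManifold.IsLocalLieGroup 2 := by
  refine ⟨fun l j => ?_, gammaBar_zero_unique⟩
  rcases Nat.lt_or_ge 1 l with hl | hl
  · exact ⟨h.highHornStr hl j, h.isJointSmoothEmbedding_highHorn hl j, fun x =>
      isSubmersionAt_of_isLocalDiffeomorphAt (h.isLocalDiffeomorph_hornProj_high hl j x),
      fun _ => ⟨hornProj_injective hl j, h.isLocalDiffeomorph_hornProj_high hl j⟩⟩
  · refine ⟨h.lowHornStr hl j, h.isJointSmoothEmbedding_lowHorn hl j, ?_, fun hl' => by omega⟩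
    obtain rfl | rfl : l = 0 ∨ l = 1 := by omega
    · exact h.isSubmersionAt_hornProj_zero j
    · exact h.isSubmersionAt_hornProj_one j

end Horns

end IsLocalDouble

end LocalDouble

/-! ### The quadratic Lie algebra on the model space of `G` -/

section Integration

variable {𝔤 : Type*} [LieRing 𝔤] [LieAlgebra ℝ 𝔤] {T : ManinTriple 𝔤}
  {EG G : Type*} [NormedAddCommGroup EG] [NormedSpace ℝ EG] [FiniteDimensional ℝ EG]
  [CompleteSpace EG]
  [TopologicalSpace G] [ChartedSpace EG G] [Group G] [LieGroup 𝓘(ℝ, EG) ∞ G]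
  {Ep Em : Type v} {Hp Hm : Type u}
  [NormedAddCommGroup Ep] [NormedSpace ℝ Ep] [FiniteDimensional ℝ Ep] [CompleteSpace Ep]
  [TopologicalSpace Hp] [ChartedSpace Ep Hp] [Group Hp] [LieGroup 𝓘(ℝ, Ep) ∞ Hp]
  [NormedAddCommGroup Em] [NormedSpace ℝ Em] [FiniteDimensional ℝ Em] [CompleteSpace Em]
  [TopologicalSpace Hm] [ChartedSpace Em Hm] [Group Hm] [LieGroup 𝓘(ℝ, Em) ∞ Hm]
  (D : Integration T EG G Ep Hp Em Hm)

namespace Integration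

/-- The identification of the model space of `G` with `𝔤`. -/
def toG : EG ≃ₗ[ℝ] 𝔤 := D.lieG.toLinearEquiv

/-- The identification of the model space of `H₊` with `𝔥₊`. -/
def toP : Ep ≃ₗ[ℝ] T.plus := D.lieP.toLinearEquiv

/-- The identification of the model space of `H₋` with `𝔥₋`. -/
def toM : Em ≃ₗ[ℝ] T.minus := D.lieM.toLinearEquiv

/-- The inclusion of `𝔥₊`, on model spaces. -/
def incP : Ep →L[ℝ] EG := tder Ep EG D.φp 1

/-- The inclusion of `𝔥₋`, on model spaces. -/
def incM : Em →L[ℝ] EG := tder Em EG D.φm 1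

theorem toG_incP (w : Ep) : D.toG (D.incP w) = (D.toP w : 𝔤) := D.d_φp w

theorem toG_incM (w : Em) : D.toG (D.incM w) = (D.toM w : 𝔤) := D.d_φm w

theorem toG_brk (v w : EG) : D.toG (brk G v w) = ⁅D.toG v, D.toG w⁆ :=
  LieEquiv.map_lie D.lieG (x := v) (y := w)

/-- The pairing of `𝔤`, on the model space of `G`. -/
def form : EG →L[ℝ] EG →L[ℝ] ℝ :=
  LinearMap.toContinuousLinearMap
    ((LinearMap.toContinuousLinearMap : (EG →ₗ[ℝ] ℝ) ≃ₗ[ℝ] (EG →L[ℝ] ℝ)).toLinearMap ∘ₗ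
      T.pairing.compl₁₂ D.toG.toLinearMap D.toG.toLinearMap)

theorem form_apply (v w : EG) : D.form v w = T.pairing (D.toG v) (D.toG w) := rfl

theorem form_symm (v w : EG) : D.form v w = D.form w v := T.symm _ _

theorem form_invariant (x y z : EG) :
    D.form (brk G y x) z + D.form y (brk G z x) = 0 := by
  rw [form_apply, form_apply, toG_brk, toG_brk, ← lie_skew, ← lie_skew (D.toG z), map_neg,
    LinearMap.neg_apply, map_neg, ← neg_add, T.invariant, neg_zero]

theorem form_incP_incP (v w : Ep) : D.form (D.incP v) (D.incP w) = 0 := by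
  rw [form_apply, toG_incP, toG_incP]
  exact T.plus_isotropic _ (D.toP v).2 _ (D.toP w).2

theorem form_incM_incM (v w : Em) : D.form (D.incM v) (D.incM w) = 0 := by
  rw [form_apply, toG_incM, toG_incM]
  exact T.minus_isotropic _ (D.toM v).2 _ (D.toM w).2

theorem form_brk_incP (u v w : Ep) :
    D.form (brk G (D.incP u) (D.incP v)) (D.incP w) = 0 := by
  rw [form_apply, toG_brk, toG_incP, toG_incP, toG_incP]
  exact T.plus_isotropic _ (T.plus.lie_mem (D.toP u).2 (D.toP v).2) _ (D.toP w).2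

theorem form_brk_incM (u v w : Em) :
    D.form (brk G (D.incM u) (D.incM v)) (D.incM w) = 0 := by
  rw [form_apply, toG_brk, toG_incM, toG_incM, toG_incM]
  exact T.minus_isotropic _ (T.minus.lie_mem (D.toM u).2 (D.toM v).2) _ (D.toM w).2

theorem form_incP_incM (v : Ep) (w : Em) : D.form (D.incP v) (D.incM w) = D.pair v w := by
  rw [form_apply, toG_incP, toG_incM]
  rfl

theorem form_adj [PreconnectedSpace G] (a : G) (v w : EG) :
    D.form (adj EG a v) (adj EG a w) = D.form v w :=
  pairing_adj D.form D.form_invariant a v w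

theorem eq_zero_of_incM_add_incP {v : Em} {w : Ep} (h : D.incM v + D.incP w = 0) :
    v = 0 ∧ w = 0 := by
  have h1 := congrArg D.toG h
  rw [map_add, map_zero, toG_incM, toG_incP] at h1
  have h2 : (D.toM v : 𝔤) = 0 := by
    refine (Submodule.disjoint_def.1 T.isCompl.disjoint) _ ?_ (D.toM v).2
    rw [eq_neg_of_add_eq_zero_left h1]
    exact T.plus.toSubmodule.neg_mem (D.toP w).2
  rw [h2, zero_add] at h1
  exact ⟨D.toM.map_eq_zero_iff.1 (Subtype.ext h2), D.toP.map_eq_zero_iff.1 (Subtype.ext h1)⟩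

include D in
theorem finrank_eq : Module.finrank ℝ (Em × Ep) = Module.finrank ℝ EG := by
  have : FiniteDimensional ℝ 𝔤 := D.toG.finiteDimensional
  rw [Module.finrank_prod, D.toM.finrank_eq, D.toP.finrank_eq, D.toG.finrank_eq, add_comm]
  exact Submodule.finrank_add_eq_of_isCompl T.isCompl

/-- The multiplication map `H₋ × H₊ → G` is étale, since `𝔤 = 𝔥₋ ⊕ 𝔥₊`. -/
theorem tder_mulMap_bijective (y : Hm × Hp) :
    Function.Bijective (tder (Em × Ep) EG (mulMap D.φp D.φm) y) := by
  have dM : MDifferentiableAt 𝓘(ℝ, Em × Ep) 𝓘(ℝ, EG) (fun z : Hm × Hp => D.φm z.1) y :=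
    (D.smooth_φm.comp contMDiff_fst').mdifferentiable (by simp) y
  have dP : MDifferentiableAt 𝓘(ℝ, Em × Ep) 𝓘(ℝ, EG) (fun z : Hm × Hp => D.φp z.2) y :=
    (D.smooth_φp.comp contMDiff_snd').mdifferentiable (by simp) y
  have dQ : MDifferentiableAt 𝓘(ℝ, Em × Ep) 𝓘(ℝ, EG) (mulMap D.φp D.φm) y := mdiffAt_mul dM dP
  have d1 : MDifferentiableAt 𝓘(ℝ, Em × Ep) 𝓘(ℝ, Em) (Prod.fst : Hm × Hp → Hm) y :=
    contMDiff_fst'.mdifferentiable (by simp) y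
  have d2 : MDifferentiableAt 𝓘(ℝ, Em × Ep) 𝓘(ℝ, Ep) (Prod.snd : Hm × Hp → Hp) y :=
    contMDiff_snd'.mdifferentiable (by simp) y
  have hinj : Function.Injective (tder (Em × Ep) EG (mulMap D.φp D.φm) y) := by
    refine (injective_iff_map_eq_zero _).2 fun w hw => ?_
    -- translate `y` to the unit
    have h1 : tder (Em × Ep) EG (fun z : Hm × Hp =>
        (D.φm y.1)⁻¹ * D.φm z.1 * (D.φp z.2 * (D.φp y.2)⁻¹)) y w = 0 := by
      have e : (fun z : Hm × Hp => (D.φm y.1)⁻¹ * D.φm z.1 * (D.φp z.2 * (D.φp y.2)⁻¹)) =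
          fun z => (fun g => (D.φm y.1)⁻¹ * g * (D.φp y.2)⁻¹) (mulMap D.φp D.φm z) := by
        funext z
        simp only [mulMap, mul_assoc]
      rw [e, tder_comp rfl (mdiffAt_mul (mdiffAt_mul_left _ _) mdifferentiableAt_const) dQ]
      exact (congrArg (tder EG EG _ _) hw).trans (ContinuousLinearMap.map_zero _)
    rw [tder_mul_of_eq_one (mdiffAt_mul mdifferentiableAt_const dM)
      (mdiffAt_mul dP mdifferentiableAt_const) (by simp) (by simp)] at h1
    have h2 := congrArg (fun L : Em × Ep →L[ℝ] EG => L w)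
      (lLog_hom D.φm (D.smooth_φm.mdifferentiable (by simp) 1) d1)
    have h3 := congrArg (fun L : Em × Ep →L[ℝ] EG => L w)
      (rLog_hom D.φp (D.smooth_φp.mdifferentiable (by simp) 1) d2)
    have h4 : D.incM (lLog (Em × Ep) Em (Prod.fst : Hm × Hp → Hm) y w) +
        D.incP (rLog (Em × Ep) Ep (Prod.snd : Hm × Hp → Hp) y w) = 0 :=
      (congrArg₂ (· + ·) h2 h3).symm.trans h1
    obtain ⟨h5, h6⟩ := D.eq_zero_of_incM_add_incP h4
    rw [lLog_eq_zero_iff d1, tder_fst] at h5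
    rw [rLog_eq_adj_lLog d2, ContinuousLinearMap.comp_apply] at h6
    have h7 := (adj_inv_adj _ _).symm.trans ((congrArg (adj Ep y.2⁻¹) h6).trans (map_zero _))
    rw [lLog_eq_zero_iff d2, tder_snd] at h7
    exact Prod.ext h5 h7
  refine ⟨hinj, ?_⟩
  exact (LinearMap.injective_iff_surjective_of_finrank_eq_finrank
    (f := (tder (Em × Ep) EG (mulMap D.φp D.φm) y).toLinearMap) D.finrank_eq).1 hinj

theorem isLocalDouble : IsLocalDouble EG Ep Em D.φp D.φm where
  smooth_p := D.smooth_φp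
  smooth_m := D.smooth_φm
  localDiffeo y := isLocalDiffeomorphAt_of_bijective
    ((D.smooth_φm.comp contMDiff_fst').mul (D.smooth_φp.comp contMDiff_snd'))
    (D.tder_mulMap_bijective y)

end Integration

end Integration

/-! ### The symplectic form and the Polyakov–Wiegmann form -/

section Identity

variable {EX X EG G : Type*}
  [NormedAddCommGroup EX] [NormedSpace ℝ EX] [TopologicalSpace X] [ChartedSpace EX X]
  [NormedAddCommGroup EG] [NormedSpace ℝ EG] [CompleteSpace EG]
  [TopologicalSpace G] [ChartedSpace EG G] [Group G] [LieGroup 𝓘(ℝ, EG) ∞ G]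
  (κ : EG →L[ℝ] EG →L[ℝ] ℝ)

/-- For maps with `m p m' p' = M P`, the form of the square `p m' = (m⁻¹ M) (P p'⁻¹)` is the
Polyakov–Wiegmann form of `m p` and `m' p'`, up to the coboundary of `⟨m^* θ^l, p^* θ^r⟩`. -/
theorem pwForm_square (hκ : ∀ (a : G) (v w : EG), κ (adj EG a v) (adj EG a w) = κ v w)
    {m p m' p' M P : X → G} {x : X}
    (hm : MDifferentiableAt 𝓘(ℝ, EX) 𝓘(ℝ, EG) m x) (hp : MDifferentiableAt 𝓘(ℝ, EX) 𝓘(ℝ, EG) p x)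
    (hm' : MDifferentiableAt 𝓘(ℝ, EX) 𝓘(ℝ, EG) m' x)
    (hp' : MDifferentiableAt 𝓘(ℝ, EX) 𝓘(ℝ, EG) p' x)
    (hM : MDifferentiableAt 𝓘(ℝ, EX) 𝓘(ℝ, EG) M x) (hP : MDifferentiableAt 𝓘(ℝ, EX) 𝓘(ℝ, EG) P x)
    (h : ∀ z, m z * p z * (m' z * p' z) = M z * P z)
    (h1 : pwForm EX κ m (fun z => (m z)⁻¹ * M z) x = 0)
    (h2 : pwForm EX κ (fun z => P z * (p' z)⁻¹) p' x = 0) :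
    pwForm EX κ p m' x - pwForm EX κ (fun z => (m z)⁻¹ * M z) (fun z => P z * (p' z)⁻¹) x =
      pwForm EX κ (fun z => m z * p z) (fun z => m' z * p' z) x + pwForm EX κ m p x +
        pwForm EX κ m' p' x - pwForm EX κ M P x := by
  have hq := mdiffAt_mul hm' hp'
  have ht := mdiffAt_mul (mdiffAt_inv hm) hM
  have hr := mdiffAt_mul hP (mdiffAt_inv hp')
  have e1 := pwForm_cocycle κ hκ hm hp hq
  have e2 := pwForm_cocycle κ hκ hp hm' hp'
  have e3 := pwForm_cocycle κ hκ ht hr hp'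
  have e4 := pwForm_cocycle κ hκ hm ht hP
  have s1 : (fun z => p z * m' z) = fun z => (m z)⁻¹ * M z * (P z * (p' z)⁻¹) := by
    funext z
    rw [mul_assoc, ← mul_assoc (M z), ← h]
    group
  have s2 : (fun z => p z * (m' z * p' z)) = fun z => (m z)⁻¹ * M z * P z := by
    funext z
    rw [mul_assoc, ← h]
    group
  have s3 : (fun z => P z * (p' z)⁻¹ * p' z) = P := by
    funext z
    group
  have s4 : (fun z => m z * ((m z)⁻¹ * M z)) = M := by
    funext z
    group
  rw [s2] at e1
  rw [s1] at e2
  rw [s3, h2, add_zero] at e3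
  rw [s4, h1, zero_add] at e4
  -- the cocycle identities of `(p, m', p')`, `(m, p, m' p')`, `(t, r, p')` and `(m, t, P)`, where
  -- `t = m⁻¹ M` and `r = P p'⁻¹`
  linear_combination (norm := module) e2 - e1 - e3 + e4

end Identity

/-! ### The form of a triangle -/

section Forms

variable {𝔤 : Type*} [LieRing 𝔤] [LieAlgebra ℝ 𝔤] {T : ManinTriple 𝔤}
  {EG G : Type*} [NormedAddCommGroup EG] [NormedSpace ℝ EG] [FiniteDimensional ℝ EG]
  [CompleteSpace EG]
  [TopologicalSpace G] [ChartedSpace EG G] [Group G] [LieGroup 𝓘(ℝ, EG) ∞ G]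
  {Ep Em : Type v} {Hp Hm : Type u}
  [NormedAddCommGroup Ep] [NormedSpace ℝ Ep] [FiniteDimensional ℝ Ep] [CompleteSpace Ep]
  [TopologicalSpace Hp] [ChartedSpace Ep Hp] [Group Hp] [LieGroup 𝓘(ℝ, Ep) ∞ Hp] [T2Space Hp]
  [NormedAddCommGroup Em] [NormedSpace ℝ Em] [FiniteDimensional ℝ Em] [CompleteSpace Em]
  [TopologicalSpace Hm] [ChartedSpace Em Hm] [Group Hm] [LieGroup 𝓘(ℝ, Em) ∞ Hm] [T2Space Hm]
  (D : Integration T EG G Ep Hp Em Hm)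

namespace Integration

section Maps

variable {EX X : Type*} [NormedAddCommGroup EX] [NormedSpace ℝ EX] [TopologicalSpace X]
  [ChartedSpace EX X] {x : X} {f f' : X → Hp} {g g' : X → Hm}

theorem mdiffAt_φp (hf : MDifferentiableAt 𝓘(ℝ, EX) 𝓘(ℝ, Ep) f x) :
    MDifferentiableAt 𝓘(ℝ, EX) 𝓘(ℝ, EG) (fun z => D.φp (f z)) x :=
  MDifferentiableAt.comp (g := D.φp) x (D.smooth_φp.mdifferentiable (by simp) _) hf

theorem mdiffAt_φm (hg : MDifferentiableAt 𝓘(ℝ, EX) 𝓘(ℝ, Em) g x) :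
    MDifferentiableAt 𝓘(ℝ, EX) 𝓘(ℝ, EG) (fun z => D.φm (g z)) x :=
  MDifferentiableAt.comp (g := D.φm) x (D.smooth_φm.mdifferentiable (by simp) _) hg

theorem lLog_φp (hf : MDifferentiableAt 𝓘(ℝ, EX) 𝓘(ℝ, Ep) f x) :
    lLog EX EG (fun z => D.φp (f z)) x = D.incP.comp (lLog EX Ep f x) :=
  lLog_hom D.φp (D.smooth_φp.mdifferentiable (by simp) _) hf

theorem rLog_φp (hf : MDifferentiableAt 𝓘(ℝ, EX) 𝓘(ℝ, Ep) f x) :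
    rLog EX EG (fun z => D.φp (f z)) x = D.incP.comp (rLog EX Ep f x) :=
  rLog_hom D.φp (D.smooth_φp.mdifferentiable (by simp) _) hf

theorem lLog_φm (hg : MDifferentiableAt 𝓘(ℝ, EX) 𝓘(ℝ, Em) g x) :
    lLog EX EG (fun z => D.φm (g z)) x = D.incM.comp (lLog EX Em g x) :=
  lLog_hom D.φm (D.smooth_φm.mdifferentiable (by simp) _) hg

theorem rLog_φm (hg : MDifferentiableAt 𝓘(ℝ, EX) 𝓘(ℝ, Em) g x) :
    rLog EX EG (fun z => D.φm (g z)) x = D.incM.comp (rLog EX Em g x) :=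
  rLog_hom D.φm (D.smooth_φm.mdifferentiable (by simp) _) hg

/-- `H₊` is isotropic. -/
theorem pwForm_φp_φp (hf : MDifferentiableAt 𝓘(ℝ, EX) 𝓘(ℝ, Ep) f x)
    (hf' : MDifferentiableAt 𝓘(ℝ, EX) 𝓘(ℝ, Ep) f' x) :
    pwForm EX D.form (fun z => D.φp (f z)) (fun z => D.φp (f' z)) x = 0 := by
  ext m
  rw [pwForm, D.lLog_φp hf, D.rLog_φp hf', wedge_apply]
  simp [form_incP_incP]

/-- `H₋` is isotropic. -/
theorem pwForm_φm_φm (hg : MDifferentiableAt 𝓘(ℝ, EX) 𝓘(ℝ, Em) g x)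
    (hg' : MDifferentiableAt 𝓘(ℝ, EX) 𝓘(ℝ, Em) g' x) :
    pwForm EX D.form (fun z => D.φm (g z)) (fun z => D.φm (g' z)) x = 0 := by
  ext m
  rw [pwForm, D.lLog_φm hg, D.rLog_φm hg', wedge_apply]
  simp [form_incM_incM]

theorem pwForm_φp_φm (hf : MDifferentiableAt 𝓘(ℝ, EX) 𝓘(ℝ, Ep) f x)
    (hg : MDifferentiableAt 𝓘(ℝ, EX) 𝓘(ℝ, Em) g x) :
    pwForm EX D.form (fun z => D.φp (f z)) (fun z => D.φm (g z)) x =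
      wedge D.pair (lLog EX Ep f x) (rLog EX Em g x) := by
  ext m
  rw [pwForm, D.lLog_φp hf, D.rLog_φm hg, wedge_apply, wedge_apply]
  simp [form_incP_incM]

theorem pwForm_φm_φp (hg : MDifferentiableAt 𝓘(ℝ, EX) 𝓘(ℝ, Em) g x)
    (hf : MDifferentiableAt 𝓘(ℝ, EX) 𝓘(ℝ, Ep) f x) :
    pwForm EX D.form (fun z => D.φm (g z)) (fun z => D.φp (f z)) x =
      wedge D.pair.flip (lLog EX Em g x) (rLog EX Ep f x) := by
  ext m
  rw [pwForm, D.lLog_φm hg, D.rLog_φp hf, wedge_apply, wedge_apply]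
  simp [D.form_symm (D.incM _) (D.incP _), form_incP_incM]

end Maps

/-- The manifold `Γ̄_n`. -/
abbrev level (n : ℕ) : ManifoldStr.{u, v} ((GammaBar D.φp D.φm).obj (op ⦋n⦌)) :=
  D.isLocalDouble.levelStr n

/-- The `H₋`-component of an edge. -/
def compM (n : ℕ) (i j : Fin (n + 1)) (x : (D.level n).Carrier) : Hm :=
  (D.isLocalDouble.edgeFun n i j x).1

/-- The `H₊`-component of an edge. -/
def compP (n : ℕ) (i j : Fin (n + 1)) (x : (D.level n).Carrier) : Hp :=
  (D.isLocalDouble.edgeFun n i j x).2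

variable (n : ℕ) (i j k : Fin (n + 1))

theorem contMDiff_compM : ContMDiff 𝓘(ℝ, (D.level n).E) 𝓘(ℝ, Em) ∞ (D.compM n i j) :=
  contMDiff_fst'.comp (D.isLocalDouble.contMDiff_edgeFun n i j)

theorem contMDiff_compP : ContMDiff 𝓘(ℝ, (D.level n).E) 𝓘(ℝ, Ep) ∞ (D.compP n i j) :=
  contMDiff_snd'.comp (D.isLocalDouble.contMDiff_edgeFun n i j)

/-- The top edge of the square with left edge `i ≤ j` and bottom edge `j ≤ k`. -/
def compTop (x : (D.level n).Carrier) : Hm := (D.compM n i j x)⁻¹ * D.compM n i k x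

/-- The right edge of the square with left edge `i ≤ j` and bottom edge `j ≤ k`. -/
def compRight (x : (D.level n).Carrier) : Hp := D.compP n i k x * (D.compP n j k x)⁻¹

theorem contMDiff_compTop : ContMDiff 𝓘(ℝ, (D.level n).E) 𝓘(ℝ, Em) ∞ (D.compTop n i j k) :=
  (D.contMDiff_compM n i j).inv.mul (D.contMDiff_compM n i k)

theorem contMDiff_compRight : ContMDiff 𝓘(ℝ, (D.level n).E) 𝓘(ℝ, Ep) ∞ (D.compRight n i j k) :=
  (D.contMDiff_compP n i k).mul (D.contMDiff_compP n j k).inv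

/-- The pullback of the form of `Γ` along the square of the triangle `i ≤ j ≤ k`. -/
def squareForm : DForm (D.level n) 2 := fun x =>
  pwForm (D.level n).E D.form (fun z => D.φp (D.compP n i j z))
      (fun z => D.φm (D.compM n j k z)) x -
    pwForm (D.level n).E D.form (fun z => D.φm (D.compTop n i j k z))
      (fun z => D.φp (D.compRight n i j k z)) x

/-- The form `ω` of `Γ` as a difference of two forms `⟨f^* θ^l, g^* θ^r⟩` of maps to `G`. -/
theorem omegaGamma_eq (ξ : D.isLocalDouble.squareStr.Carrier) :
    omegaGamma D D.isLocalDouble.squareStr ξ =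
      pwForm D.isLocalDouble.squareStr.E D.form
          (fun z => D.φp (D.isLocalDouble.squareStr.mapTo LWSquare.left z))
          (fun z => D.φm (D.isLocalDouble.squareStr.mapTo LWSquare.bottom z)) ξ -
        pwForm D.isLocalDouble.squareStr.E D.form
          (fun z => D.φm (D.isLocalDouble.squareStr.mapTo LWSquare.top z))
          (fun z => D.φp (D.isLocalDouble.squareStr.mapTo LWSquare.right z)) ξ := by
  have d1 := D.isLocalDouble.contMDiff_left.mdifferentiable (by simp) ξ
  have d2 := D.isLocalDouble.contMDiff_bottom.mdifferentiable (by simp) ξ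
  have d3 := D.isLocalDouble.contMDiff_top.mdifferentiable (by simp) ξ
  have d4 := D.isLocalDouble.contMDiff_right.mdifferentiable (by simp) ξ
  refine Eq.trans ?_ (congrArg₂ (· - ·) (D.pwForm_φp_φm d1 d2) (D.pwForm_φm_φp d3 d4)).symm
  rw [← thetaL_comp_tder d1, ← thetaR_comp_tder d2, ← thetaL_comp_tder d3, ← thetaR_comp_tder d4]
  rfl

/-- The form `ω̄` on `Γ̄_2` is the form of the triangle `0 ≤ 1 ≤ 2`. -/
theorem pullback_omegaGamma :
    DForm.pullback ((D.level 2).mapOf D.isLocalDouble.squareStr fun x => (level2 x).2.1)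
      (omegaGamma D D.isLocalDouble.squareStr) = D.squareForm 2 0 1 2 := by
  funext x
  have hs := (D.isLocalDouble.contMDiff_entry 2 ⟨1, ⟨((0 : Fin 2), (1 : Fin 2)), by decide⟩,
      ⟨((0 : Fin 2), (1 : Fin 2)), by decide⟩⟩).mdifferentiable (by simp) x
  have d1 := D.mdiffAt_φp (D.isLocalDouble.contMDiff_left.mdifferentiable (by simp)
    ((D.level 2).mapOf D.isLocalDouble.squareStr (fun x => (level2 x).2.1) x))
  have d2 := D.mdiffAt_φm (D.isLocalDouble.contMDiff_bottom.mdifferentiable (by simp)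
    ((D.level 2).mapOf D.isLocalDouble.squareStr (fun x => (level2 x).2.1) x))
  have d3 := D.mdiffAt_φm (D.isLocalDouble.contMDiff_top.mdifferentiable (by simp)
    ((D.level 2).mapOf D.isLocalDouble.squareStr (fun x => (level2 x).2.1) x))
  have d4 := D.mdiffAt_φp (D.isLocalDouble.contMDiff_right.mdifferentiable (by simp)
    ((D.level 2).mapOf D.isLocalDouble.squareStr (fun x => (level2 x).2.1) x))
  have e1 := pwForm_comp D.form rfl d1 d2 hs
  have e2 := pwForm_comp D.form rfl d3 d4 hs
  rw [DForm.pullback, D.omegaGamma_eq]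
  refine Eq.trans (congrArg₂ (· - ·) e1.symm e2.symm) ?_
  have hm (z : (D.level 2).Carrier) : (level2 z).2.1 = midSquare z :=
    congrArg (fun y : Hm × LWSquare D.φp D.φm × Hp => y.2.1) (level2_eq z)
  have s1 (z : (D.level 2).Carrier) : (level2 z).2.1.left = D.compP 2 0 1 z := by
    rw [hm]; exact midSquare_left z
  have s2 (z : (D.level 2).Carrier) : (level2 z).2.1.bottom = D.compM 2 1 2 z := by
    rw [hm]; exact midSquare_bottom z
  have s3 (z : (D.level 2).Carrier) : (level2 z).2.1.top = D.compTop 2 0 1 2 z := by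
    rw [hm]; exact midSquare_top z
  have s4 (z : (D.level 2).Carrier) : (level2 z).2.1.right = D.compRight 2 0 1 2 z := by
    rw [hm]; exact midSquare_right z
  rw [squareForm]
  simp only [← s1, ← s2, ← s3, ← s4]
  rfl

variable {n} {i j k}

theorem compP_map {m : ℕ} (f : ⦋m⦌ ⟶ ⦋n⦌) (i j : Fin (m + 1)) (x : (D.level n).Carrier) :
    D.compP m i j ((D.level n).mapOf (D.level m) ((GammaBar D.φp D.φm).map f.op) x) =
      D.compP n (f.toOrderHom i) (f.toOrderHom j) x :=
  congrArg (fun y : Hm × Hp => y.2) (edge_map_apply f x i j)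

theorem compM_map {m : ℕ} (f : ⦋m⦌ ⟶ ⦋n⦌) (i j : Fin (m + 1)) (x : (D.level n).Carrier) :
    D.compM m i j ((D.level n).mapOf (D.level m) ((GammaBar D.φp D.φm).map f.op) x) =
      D.compM n (f.toOrderHom i) (f.toOrderHom j) x :=
  congrArg (fun y : Hm × Hp => y.1) (edge_map_apply f x i j)

theorem pullback_squareForm {m : ℕ} (f : ⦋m⦌ ⟶ ⦋n⦌) (i j k : Fin (m + 1)) :
    DForm.pullback ((D.level n).mapOf (D.level m) ((GammaBar D.φp D.φm).map f.op))
      (D.squareForm m i j k) =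
      D.squareForm n (f.toOrderHom i) (f.toOrderHom j) (f.toOrderHom k) := by
  funext x
  have hs := (D.isLocalDouble.contMDiff_map f).mdifferentiable (by simp) x
  set y := (D.level n).mapOf (D.level m) ((GammaBar D.φp D.φm).map f.op) x with hy
  have d1 := D.mdiffAt_φp ((D.contMDiff_compP m i j).mdifferentiable (by simp) y)
  have d2 := D.mdiffAt_φm ((D.contMDiff_compM m j k).mdifferentiable (by simp) y)
  have d3 := D.mdiffAt_φm ((D.contMDiff_compTop m i j k).mdifferentiable (by simp) y)
  have d4 := D.mdiffAt_φp ((D.contMDiff_compRight m i j k).mdifferentiable (by simp) y)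
  have e1 := pwForm_comp D.form rfl d1 d2 hs
  have e2 := pwForm_comp D.form rfl d3 d4 hs
  refine Eq.trans (congrArg₂ (· - ·) e1.symm e2.symm) ?_
  simp only [compTop, compRight, compP_map, compM_map]
  rfl

theorem comp_eq_one (h : j ≤ i) (x : (D.level n).Carrier) :
    D.compM n i j x = 1 ∧ D.compP n i j x = 1 := by
  have h1 := (edge_isCocycle (φp := D.φp) (φm := D.φm) (n := n) x).eq_one i j h
  exact ⟨congrArg (fun y : Hm × Hp => y.1) h1, congrArg (fun y : Hm × Hp => y.2) h1⟩

/-- The form `ω̄` is normalized: the squares of degenerate triangles have two constant sides. -/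
theorem squareForm_eq_zero (hi : i = j ∨ j = k) : D.squareForm n i j k = 0 := by
  funext x
  rcases hi with rfl | rfl
  · have h1 (z : (D.level n).Carrier) : D.compP n i i z = 1 := (D.comp_eq_one le_rfl z).2
    have h2 (z : (D.level n).Carrier) : D.compRight n i i k z = 1 := mul_inv_cancel _
    simp only [squareForm, h1, h2, map_one]
    rw [pwForm_const_left, pwForm_const_right, sub_zero]
    rfl
  · have h1 (z : (D.level n).Carrier) : D.compM n j j z = 1 := (D.comp_eq_one le_rfl z).1
    have h2 (z : (D.level n).Carrier) : D.compTop n i j j z = 1 := inv_mul_cancel _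
    simp only [squareForm, h1, h2, map_one]
    rw [pwForm_const_left, pwForm_const_right, sub_zero]
    rfl

section Connected

variable [PreconnectedSpace G]

theorem mul_edges (hij : i ≤ j) (hjk : j ≤ k) (z : (D.level n).Carrier) :
    D.φm (D.compM n i j z) * D.φp (D.compP n i j z) *
      (D.φm (D.compM n j k z) * D.φp (D.compP n j k z)) =
      D.φm (D.compM n i k z) * D.φp (D.compP n i k z) :=
  (edge_isCocycle (φp := D.φp) (φm := D.φm) (n := n) z).mul i j k hij hjk

/-- With `g i j = φ₋(m i j) φ₊(p i j)`, the form of the triangle `i ≤ j ≤ k` is `⟨(g i j)^* θ^l, (g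
j k)^* θ^r⟩`, up to the coboundary of `⟨(m i j)^* θ^l, (p i j)^* θ^r⟩`. -/
theorem squareForm_eq (hij : i ≤ j) (hjk : j ≤ k) (x : (D.level n).Carrier) :
    D.squareForm n i j k x =
      pwForm (D.level n).E D.form (fun z => D.φm (D.compM n i j z) * D.φp (D.compP n i j z))
        (fun z => D.φm (D.compM n j k z) * D.φp (D.compP n j k z)) x +
      pwForm (D.level n).E D.form (fun z => D.φm (D.compM n i j z))
        (fun z => D.φp (D.compP n i j z)) x +
      pwForm (D.level n).E D.form (fun z => D.φm (D.compM n j k z))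
        (fun z => D.φp (D.compP n j k z)) x -
      pwForm (D.level n).E D.form (fun z => D.φm (D.compM n i k z))
        (fun z => D.φp (D.compP n i k z)) x := by
  have dM (a b) := (D.contMDiff_compM n a b).mdifferentiable (by simp) x
  have dP (a b) := (D.contMDiff_compP n a b).mdifferentiable (by simp) x
  have dT := (D.contMDiff_compTop n i j k).mdifferentiable (by simp) x
  have dR := (D.contMDiff_compRight n i j k).mdifferentiable (by simp) x
  have h1 := D.pwForm_φm_φm (dM i j) dT
  have h2 := D.pwForm_φp_φp dR (dP j k)
  rw [squareForm]
  simp only [compTop, compRight, map_mul, map_inv] at h1 h2 ⊢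
  exact pwForm_square D.form D.form_adj (D.mdiffAt_φm (dM i j)) (D.mdiffAt_φp (dP i j))
    (D.mdiffAt_φm (dM j k)) (D.mdiffAt_φp (dP j k)) (D.mdiffAt_φm (dM i k))
    (D.mdiffAt_φp (dP i k)) (D.mul_edges hij hjk) h1 h2

/-- The form `ω̄` is simplicially closed, by the Polyakov–Wiegmann identity for `g i j`, `g j k`,
`g k l`. -/
theorem squareForm_cocycle {l : Fin (n + 1)} (hij : i ≤ j) (hjk : j ≤ k) (hkl : k ≤ l)
    (x : (D.level n).Carrier) :
    D.squareForm n j k l x - D.squareForm n i k l x + D.squareForm n i j l x -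
      D.squareForm n i j k x = 0 := by
  have dq (a b) := mdiffAt_mul
    (D.mdiffAt_φm ((D.contMDiff_compM n a b).mdifferentiable (by simp) x))
    (D.mdiffAt_φp ((D.contMDiff_compP n a b).mdifferentiable (by simp) x))
  have h1 := pwForm_cocycle D.form D.form_adj (dq i j) (dq j k) (dq k l)
  simp only [D.mul_edges hij hjk, D.mul_edges hjk hkl] at h1
  rw [D.squareForm_eq hjk hkl, D.squareForm_eq (hij.trans hjk) hkl,
    D.squareForm_eq hij (hjk.trans hkl), D.squareForm_eq hij hjk]
  -- the coboundary terms `r` cancel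
  have key {V : Type _} [AddCommGroup V] {a b c d r₁ r₂ r₃ r₄ r₅ r₆ : V} (h : a + b = c + d) :
      (d + r₁ + r₂ - r₃) - (b + r₄ + r₂ - r₅) + (c + r₆ + r₃ - r₅) - (a + r₆ + r₁ - r₄) = 0 := by
    rw [← sub_eq_zero] at h
    rw [← neg_eq_zero, ← h]
    abel
  exact key h1

end Connected

end Integration

end Forms

/-! ### Smoothness and closedness of `ω̄` -/

section Forms

variable {𝔤 : Type*} [LieRing 𝔤] [LieAlgebra ℝ 𝔤] {T : ManinTriple 𝔤}
  {EG G : Type*} [NormedAddCommGroup EG] [NormedSpace ℝ EG] [FiniteDimensional ℝ EG]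
  [CompleteSpace EG]
  [TopologicalSpace G] [ChartedSpace EG G] [Group G] [LieGroup 𝓘(ℝ, EG) ∞ G]
  {Ep Em : Type v} {Hp Hm : Type u}
  [NormedAddCommGroup Ep] [NormedSpace ℝ Ep] [FiniteDimensional ℝ Ep] [CompleteSpace Ep]
  [TopologicalSpace Hp] [ChartedSpace Ep Hp] [Group Hp] [LieGroup 𝓘(ℝ, Ep) ∞ Hp] [T2Space Hp]
  [NormedAddCommGroup Em] [NormedSpace ℝ Em] [FiniteDimensional ℝ Em] [CompleteSpace Em]
  [TopologicalSpace Hm] [ChartedSpace Em Hm] [Group Hm] [LieGroup 𝓘(ℝ, Em) ∞ Hm] [T2Space Hm]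
  (D : Integration T EG G Ep Hp Em Hm)

namespace Integration

variable {n : ℕ} {i j k : Fin (n + 1)}

theorem contMDiffAt_chart_symm {x : (D.level n).Carrier} {y : (D.level n).E}
    (hy : y ∈ (chartAt (D.level n).E x).target) :
    ContMDiffAt 𝓘(ℝ, (D.level n).E) 𝓘(ℝ, (D.level n).E) ∞ (chartAt (D.level n).E x).symm y :=
  (contMDiffOn_chart_symm (I := 𝓘(ℝ, (D.level n).E)) (n := ∞) y hy).contMDiffAt
    ((chartAt (D.level n).E x).open_target.mem_nhds hy)

/-- The form `ω̄` in a chart is again a difference of two forms `⟨f^* θ^l, g^* θ^r⟩`. -/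
theorem inChart_squareForm {x : (D.level n).Carrier} {y : (D.level n).E}
    (hy : y ∈ (chartAt (D.level n).E x).target) :
    (D.squareForm n i j k).inChart x y =
      (pwForm (D.level n).E D.form
          (fun z => D.φp (D.compP n i j ((chartAt (D.level n).E x).symm z)))
          (fun z => D.φm (D.compM n j k ((chartAt (D.level n).E x).symm z))) -
        pwForm (D.level n).E D.form
          (fun z => D.φm (D.compTop n i j k ((chartAt (D.level n).E x).symm z)))
          (fun z => D.φp (D.compRight n i j k ((chartAt (D.level n).E x).symm z)))) y := by
  have hs := (D.contMDiffAt_chart_symm hy).mdifferentiableAt (by simp)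
  set w := (chartAt (D.level n).E x).symm y with hw
  have d1 := D.mdiffAt_φp ((D.contMDiff_compP n i j).mdifferentiable (by simp) w)
  have d2 := D.mdiffAt_φm ((D.contMDiff_compM n j k).mdifferentiable (by simp) w)
  have d3 := D.mdiffAt_φm ((D.contMDiff_compTop n i j k).mdifferentiable (by simp) w)
  have d4 := D.mdiffAt_φp ((D.contMDiff_compRight n i j k).mdifferentiable (by simp) w)
  have e1 := pwForm_comp (k := (chartAt (D.level n).E x).symm) (y := w) D.form rfl d1 d2 hs
  have e2 := pwForm_comp (k := (chartAt (D.level n).E x).symm) (y := w) D.form rfl d3 d4 hs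
  exact congrArg₂ (· - ·) e1.symm e2.symm

theorem smoothNear_chart {F : (D.level n).Carrier → G}
    (hF : ContMDiff 𝓘(ℝ, (D.level n).E) 𝓘(ℝ, EG) ∞ F) {x : (D.level n).Carrier}
    {y : (D.level n).E} (hy : y ∈ (chartAt (D.level n).E x).target) :
    SmoothNear (EG := EG) (fun z => F ((chartAt (D.level n).E x).symm z)) y := by
  filter_upwards [(chartAt (D.level n).E x).open_target.mem_nhds hy] with z hz
  exact hF.contMDiffAt.comp z (D.contMDiffAt_chart_symm hz)

variable (n i j k) in
theorem smooth_components :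
    ContMDiff 𝓘(ℝ, (D.level n).E) 𝓘(ℝ, EG) ∞ (fun z => D.φp (D.compP n i j z)) ∧
    ContMDiff 𝓘(ℝ, (D.level n).E) 𝓘(ℝ, EG) ∞ (fun z => D.φm (D.compM n j k z)) ∧
    ContMDiff 𝓘(ℝ, (D.level n).E) 𝓘(ℝ, EG) ∞ (fun z => D.φm (D.compTop n i j k z)) ∧
    ContMDiff 𝓘(ℝ, (D.level n).E) 𝓘(ℝ, EG) ∞ (fun z => D.φp (D.compRight n i j k z)) :=
  ⟨D.smooth_φp.comp (D.contMDiff_compP n i j), D.smooth_φm.comp (D.contMDiff_compM n j k),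
    D.smooth_φm.comp (D.contMDiff_compTop n i j k),
    D.smooth_φp.comp (D.contMDiff_compRight n i j k)⟩

theorem isSmooth_squareForm : (D.squareForm n i j k).IsSmooth := by
  intro x
  refine ContDiffOn.congr ?_ fun y hy => D.inChart_squareForm hy
  intro y hy
  obtain ⟨h1, h2, h3, h4⟩ := D.smooth_components n i j k
  exact ((contDiffAt_pwForm D.form (D.smoothNear_chart h1 hy) (D.smoothNear_chart h2 hy)).sub
    (contDiffAt_pwForm D.form (D.smoothNear_chart h3 hy)
      (D.smoothNear_chart h4 hy))).contDiffWithinAt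

/-- The form of a triangle is closed: its two summands belong to two factorizations of the same map
to `G` into maps with values in `H₊` and `H₋`. -/
theorem d_squareForm [PreconnectedSpace G] (hij : i ≤ j) (hjk : j ≤ k) :
    (D.squareForm n i j k).d = 0 := by
  funext x
  have hy := mem_chart_target (D.level n).E x
  set φ := chartAt (D.level n).E x
  obtain ⟨h1, h2, h3, h4⟩ := D.smooth_components n i j k
  have hsymm := D.contMDiffAt_chart_symm hy
  have dP (a b) : MDifferentiableAt 𝓘(ℝ, (D.level n).E) 𝓘(ℝ, Ep) (fun z => D.compP n a b (φ.symm z))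
      (φ x) := ((D.contMDiff_compP n a b).contMDiffAt.comp _ hsymm).mdifferentiableAt (by simp)
  have dM (a b) : MDifferentiableAt 𝓘(ℝ, (D.level n).E) 𝓘(ℝ, Em) (fun z => D.compM n a b (φ.symm z))
      (φ x) := ((D.contMDiff_compM n a b).contMDiffAt.comp _ hsymm).mdifferentiableAt (by simp)
  have dT : MDifferentiableAt 𝓘(ℝ, (D.level n).E) 𝓘(ℝ, Em)
      (fun z => D.compTop n i j k (φ.symm z)) (φ x) :=
    ((D.contMDiff_compTop n i j k).contMDiffAt.comp _ hsymm).mdifferentiableAt (by simp)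
  have dR : MDifferentiableAt 𝓘(ℝ, (D.level n).E) 𝓘(ℝ, Ep)
      (fun z => D.compRight n i j k (φ.symm z)) (φ x) :=
    ((D.contMDiff_compRight n i j k).contMDiffAt.comp _ hsymm).mdifferentiableAt (by simp)
  have key := extDeriv_pwForm_sub D.form D.form_symm D.form_invariant D.form_adj
    (D.smoothNear_chart h1 hy) (D.smoothNear_chart h2 hy) (D.smoothNear_chart h3 hy)
    (D.smoothNear_chart h4 hy)
    (fun u v w => by rw [D.lLog_φp (dP i j)]; exact D.form_brk_incP _ _ _)
    (fun u v w => by rw [D.rLog_φm (dM j k)]; exact D.form_brk_incM _ _ _)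
    (fun u v w => by rw [D.lLog_φm dT]; exact D.form_brk_incM _ _ _)
    (fun u v w => by rw [D.rLog_φp dR]; exact D.form_brk_incP _ _ _)
    (Filter.Eventually.of_forall fun z => by
      have e := D.mul_edges hij hjk ((chartAt (D.level n).E x).symm z)
      simp only [compTop, compRight, map_mul, map_inv]
      rw [mul_assoc, ← mul_assoc (D.φm (D.compM n i k _)), ← e]
      group)
  have hev : (D.squareForm n i j k).inChart x =ᶠ[𝓝 (φ x)] _ :=
    Filter.eventually_of_mem (φ.open_target.mem_nhds hy) fun y hy => D.inChart_squareForm hy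
  have h5 : extDeriv ((D.squareForm n i j k).inChart x) (φ x) = 0 := hev.extDeriv_eq.trans key
  rw [DForm.d, h5]
  rfl

end Integration

end Forms

/-! ### Bisimplicial forms with a single component -/

section Single

variable {X : SSet.{u}} (S : SimplicialManifold.{u, v} X)

theorem inChart_zero {M : Type u} (R : ManifoldStr.{u, v} M) {k : ℕ} (x : R.Carrier) :
    (0 : DForm R k).inChart x = 0 := by
  funext y
  exact ContinuousAlternatingMap.ext fun _ => rfl

theorem isSmooth_zero {M : Type u} (R : ManifoldStr.{u, v} M) {k : ℕ} :
    (0 : DForm R k).IsSmooth := fun x => by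
  rw [inChart_zero]
  exact contDiffOn_const

theorem d_zero {M : Type u} (R : ManifoldStr.{u, v} M) {k : ℕ} : (0 : DForm R k).d = 0 := by
  funext x
  have h : extDeriv (0 : R.E → R.E [⋀^Fin k]→L[ℝ] ℝ) (chartAt R.E x x) = 0 := by
    rw [extDeriv, fderiv_zero]
    exact map_zero (ContinuousAlternatingMap.alternatizeUncurryFinCLM ℝ R.E ℝ)
  rw [DForm.d, inChart_zero, h]
  rfl

theorem pullback_zero {M N : Type u} {R : ManifoldStr.{u, v} M} {R' : ManifoldStr.{u, v} N} {k : ℕ}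
    (f : R.Carrier → R'.Carrier) : DForm.pullback f (0 : DForm R' k) = 0 := rfl

namespace SimplicialManifold

variable (η : DForm (S.lvl 2) 2)

theorem single22_of_ne {p q : ℕ} (h : ¬(p = 2 ∧ q = 2)) : S.single22 η p q = 0 := by
  unfold single22
  split
  · exact absurd ⟨rfl, rfl⟩ h
  · rfl

theorem isShiftedForm_single22 (hη : η.IsSmooth)
    (hn : ∀ i : Fin 2, DForm.pullback ((S.lvl 1).mapOf (S.lvl 2) (X.σ i)) η = 0) :
    S.IsShiftedForm 2 2 (S.single22 η) where
  smooth p q := by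
    by_cases h : p = 2 ∧ q = 2
    · obtain ⟨rfl, rfl⟩ := h
      exact hη
    · rw [S.single22_of_ne η h]
      exact isSmooth_zero _
  support p q h := S.single22_of_ne η fun h' => h (by omega)
  normalized p q i := by
    by_cases h : p + 1 = 2 ∧ q = 2
    · obtain ⟨h1, rfl⟩ := h
      obtain rfl : p = 1 := by omega
      exact hn i
    · rw [S.single22_of_ne η h, pullback_zero]

theorem simplicialDiff_zero (p q : ℕ) :
    S.simplicialDiff (0 : DForm (S.lvl p) q) = 0 := by
  simp only [simplicialDiff, pullback_zero, smul_zero, Finset.sum_const_zero]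

theorem isClosedForm_single22 (hd : η.d = 0) (hδ : S.simplicialDiff η = 0) :
    S.IsClosedForm (S.single22 η) := by
  intro p q
  have h1 : S.deltaPart (S.single22 η) p q = 0 := by
    unfold deltaPart
    split
    · rfl
    · rename_i p
      by_cases h : p = 2 ∧ q = 2
      · obtain ⟨rfl, rfl⟩ := h
        exact hδ
      · rw [S.single22_of_ne η h, simplicialDiff_zero]
  have h2 : S.dPart (S.single22 η) p q = 0 := by
    unfold dPart
    split
    · rfl
    · rename_i q
      by_cases h : p = 2 ∧ q = 2
      · obtain ⟨rfl, rfl⟩ := h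
        exact hd
      · rw [S.single22_of_ne η h, d_zero]
  rw [totalDiff, h1, h2, smul_zero, add_zero]

end SimplicialManifold

end Single

/-! ### The form `ω̄` is normalized and closed -/

section Codiagonal

variable {𝔤 : Type*} [LieRing 𝔤] [LieAlgebra ℝ 𝔤] {T : ManinTriple 𝔤}
  {EG G : Type*} [NormedAddCommGroup EG] [NormedSpace ℝ EG] [FiniteDimensional ℝ EG]
  [CompleteSpace EG]
  [TopologicalSpace G] [ChartedSpace EG G] [Group G] [LieGroup 𝓘(ℝ, EG) ∞ G]
  {Ep Em : Type v} {Hp Hm : Type u}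
  [NormedAddCommGroup Ep] [NormedSpace ℝ Ep] [FiniteDimensional ℝ Ep] [CompleteSpace Ep]
  [TopologicalSpace Hp] [ChartedSpace Ep Hp] [Group Hp] [LieGroup 𝓘(ℝ, Ep) ∞ Hp] [T2Space Hp]
  [NormedAddCommGroup Em] [NormedSpace ℝ Em] [FiniteDimensional ℝ Em] [CompleteSpace Em]
  [TopologicalSpace Hm] [ChartedSpace Em Hm] [Group Hm] [LieGroup 𝓘(ℝ, Em) ∞ Hm] [T2Space Hm]
  (D : Integration T EG G Ep Hp Em Hm)

namespace Integration

/-- The simplicial manifold `Γ̄`. -/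
abbrev gammaBar : SimplicialManifold.{u, v} (GammaBar D.φp D.φm) :=
  D.isLocalDouble.simplicialManifold

/-- The form `ω̄`, as a form on the simplicial manifold `Γ̄`. -/
abbrev omega : D.gammaBar.BiForm := omegaBar D D.isLocalDouble.squareStr D.gammaBar

theorem omega_eq : D.omega = D.gammaBar.single22 (D.squareForm 2 0 1 2) :=
  congrArg D.gammaBar.single22 D.pullback_omegaGamma

theorem isShiftedForm_omega : D.gammaBar.IsShiftedForm 2 2 D.omega := by
  rw [omega_eq]
  refine D.gammaBar.isShiftedForm_single22 _ D.isSmooth_squareForm fun i => ?_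
  refine (D.pullback_squareForm (SimplexCategory.σ i) 0 1 2).trans (D.squareForm_eq_zero ?_)
  fin_cases i
  · exact Or.inl rfl
  · exact Or.inr rfl

theorem isClosedForm_omega [PreconnectedSpace G] : D.gammaBar.IsClosedForm D.omega := by
  rw [omega_eq]
  refine D.gammaBar.isClosedForm_single22 _ (D.d_squareForm (by decide) (by decide)) ?_
  have h (i : Fin 4) : DForm.pullback ((D.level 3).mapOf (D.level 2) ((GammaBar D.φp D.φm).δ i))
      (D.squareForm 2 0 1 2) =
      D.squareForm 3 (i.succAbove 0) (i.succAbove 1) (i.succAbove 2) :=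
    D.pullback_squareForm (SimplexCategory.δ i) 0 1 2
  have h' : D.gammaBar.simplicialDiff (D.squareForm 2 0 1 2) =
      ∑ i : Fin 4, (-1 : ℝ) ^ (i : ℕ) •
        D.squareForm 3 (i.succAbove 0) (i.succAbove 1) (i.succAbove 2) :=
    Finset.sum_congr rfl fun i _ => congrArg _ (h i)
  rw [h', Fin.sum_univ_four]
  funext x
  have h0 := D.squareForm_cocycle (n := 3) (i := 0) (j := 1) (k := 2) (l := 3) (by decide)
    (by decide) (by decide) x
  have key {V : Type _} [AddCommGroup V] [Module ℝ V] {a b c d : V} (h : a - b + c - d = 0) :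
      (-1 : ℝ) ^ 0 • a + (-1 : ℝ) ^ 1 • b + (-1 : ℝ) ^ 2 • c + (-1 : ℝ) ^ 3 • d = 0 := by
    rw [← h]
    module
  exact key h0

end Integration

end Codiagonal

/-! ### The tangent complex -/

section TangentComplex

open SimplicialManifold

variable {EG G : Type*} [NormedAddCommGroup EG] [NormedSpace ℝ EG]
  [TopologicalSpace G] [ChartedSpace EG G] [Group G] [LieGroup 𝓘(ℝ, EG) ∞ G]
  {Ep Em : Type v} {Hp Hm : Type u}
  [NormedAddCommGroup Ep] [NormedSpace ℝ Ep] [FiniteDimensional ℝ Ep] [CompleteSpace Ep]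
  [TopologicalSpace Hp] [ChartedSpace Ep Hp] [Group Hp] [LieGroup 𝓘(ℝ, Ep) ∞ Hp] [T2Space Hp]
  [NormedAddCommGroup Em] [NormedSpace ℝ Em] [FiniteDimensional ℝ Em] [CompleteSpace Em]
  [TopologicalSpace Hm] [ChartedSpace Em Hm] [Group Hm] [LieGroup 𝓘(ℝ, Em) ∞ Hm] [T2Space Hm]

namespace IsLocalDouble

variable {φp : Hp →* G} {φm : Hm →* G} (h : IsLocalDouble EG Ep Em φp φm)
  (x : (GammaBar φp φm).obj (op ⦋0⦌))
include h

theorem subsingleton_level_zero : Subsingleton (h.simplicialManifold.lvl 0).E :=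
  inferInstanceAs (Subsingleton (Fin 0 → Em × Ep))

theorem tangentCx_one : h.simplicialManifold.tangentCx x 1 = ⊤ := by
  have := h.subsingleton_level_zero
  refine eq_top_iff.2 fun v _ => (Submodule.mem_iInf _).2 fun i => ?_
  exact LinearMap.mem_ker.2 (Subsingleton.elim _ _)

/-- The tangent complex of `Γ̄` is concentrated in degree one: the edges `(i, l)` of a simplex of
dimension `l ≥ 2` are edges of faces `d_k` with `k < l`. -/
theorem tangentCx_add_two (l : ℕ) : h.simplicialManifold.tangentCx x (l + 2) = ⊥ := by
  refine (Submodule.eq_bot_iff _).2 fun v hv => ?_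
  have hv' := (Submodule.mem_iInf _).1 hv
  refine h.eq_zero_of_tder_edgeFun (basePt _ _ x) v fun i => ?_
  obtain ⟨k, hk⟩ : ∃ k : Fin (l + 2), i ≠ k := by
    obtain ⟨k, hk⟩ := exists_ne i
    exact ⟨k, hk.symm⟩
  refine h.tder_edgeFun_eq_zero (k := k.castSucc) (fun h' => hk (Fin.castSucc_injective _ h'))
    (Fin.castSucc_lt_last k).ne' ?_
  exact LinearMap.mem_ker.1 (hv' k)

theorem eq_zero_of_level_zero (v : (h.simplicialManifold.lvl 0).E) : v = 0 := by
  have := h.subsingleton_level_zero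
  exact Subsingleton.elim _ _

theorem cycles_one : h.simplicialManifold.cycles x 1 = ⊤ := by
  have := h.subsingleton_level_zero
  refine eq_top_iff.2 fun v _ => Submodule.mem_inf.2
    ⟨?_, LinearMap.mem_ker.2 (Subsingleton.elim _ _)⟩
  rw [h.tangentCx_one]
  trivial

theorem cycles_add_two (l : ℕ) : h.simplicialManifold.cycles x (l + 2) = ⊥ := by
  refine eq_bot_iff.2 (inf_le_left.trans (h.tangentCx_add_two x l).le)

theorem boundaries_succ (l : ℕ) : h.simplicialManifold.boundaries x (l + 1) = ⊥ := by
  rw [SimplicialManifold.boundaries, h.tangentCx_add_two, Submodule.map_bot]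

/-- The simplicial operators on tangent vectors, in terms of edges. -/
theorem tder_edgeFun_tangentMap {m n : ℕ} (f : ⦋m⦌ ⟶ ⦋n⦌) (i j : Fin (m + 1))
    (v : (h.levelStr n).E) :
    tder (h.levelStr m).E (Em × Ep) (h.edgeFun m i j) (basePt (GammaBar φp φm) m x)
      (h.simplicialManifold.tangentMap f x v) =
    tder (h.levelStr n).E (Em × Ep) (h.edgeFun n (f.toOrderHom i) (f.toOrderHom j))
      (basePt (GammaBar φp φm) n x) v := by
  have hb : (GammaBar φp φm).map f.op (basePt (GammaBar φp φm) n x) =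
      basePt (GammaBar φp φm) m x := by
    have h1 := (GammaBar φp φm).map_comp (SimplexCategory.const ⦋n⦌ ⦋0⦌ 0).op f.op
    exact (ConcreteCategory.congr_hom h1 x).symm
  have h2 : h.edgeFun n (f.toOrderHom i) (f.toOrderHom j) = fun z => h.edgeFun m i j
      ((h.levelStr n).mapOf (h.levelStr m) ((GammaBar φp φm).map f.op) z) :=
    funext fun z => (edge_map_apply f z i j).symm
  rw [h2, tder_comp (g := h.edgeFun m i j)
    (f := (h.levelStr n).mapOf (h.levelStr m) ((GammaBar φp φm).map f.op))
    (x := basePt (GammaBar φp φm) n x) (y := basePt (GammaBar φp φm) m x) hb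
    ((h.contMDiff_edgeFun m i j).mdifferentiable (by simp) _)
    ((h.contMDiff_map f).mdifferentiable (by simp) _)]
  rfl

theorem edgeFun_basePt (n : ℕ) (i j : Fin (n + 1)) :
    h.edgeFun n i j (basePt (GammaBar φp φm) n x) = 1 := by
  refine (edge_map_apply (φp := φp) (φm := φm) (SimplexCategory.const ⦋n⦌ ⦋0⦌ 0) x i j).trans ?_
  exact (edge_isCocycle (φp := φp) (φm := φm) (n := 0) x).eq_one _ _ le_rfl

theorem tder_edgeFun_refl (n : ℕ) (i : Fin (n + 1)) (y : (h.levelStr n).Carrier) :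
    tder (h.levelStr n).E (Em × Ep) (h.edgeFun n i i) y = 0 := by
  have h1 : h.edgeFun n i i = fun _ => 1 := funext fun z =>
    (edge_isCocycle (φp := φp) (φm := φm) (n := n) z).eq_one i i le_rfl
  rw [h1, tder_const]

end IsLocalDouble

end TangentComplex

/-! ### The IM-form -/

section IMForm

open SimplicialManifold

variable {𝔤 : Type*} [LieRing 𝔤] [LieAlgebra ℝ 𝔤] {T : ManinTriple 𝔤}
  {EG G : Type*} [NormedAddCommGroup EG] [NormedSpace ℝ EG] [FiniteDimensional ℝ EG]
  [CompleteSpace EG]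
  [TopologicalSpace G] [ChartedSpace EG G] [Group G] [LieGroup 𝓘(ℝ, EG) ∞ G]
  {Ep Em : Type v} {Hp Hm : Type u}
  [NormedAddCommGroup Ep] [NormedSpace ℝ Ep] [FiniteDimensional ℝ Ep] [CompleteSpace Ep]
  [TopologicalSpace Hp] [ChartedSpace Ep Hp] [Group Hp] [LieGroup 𝓘(ℝ, Ep) ∞ Hp] [T2Space Hp]
  [NormedAddCommGroup Em] [NormedSpace ℝ Em] [FiniteDimensional ℝ Em] [CompleteSpace Em]
  [TopologicalSpace Hm] [ChartedSpace Em Hm] [Group Hm] [LieGroup 𝓘(ℝ, Em) ∞ Hm] [T2Space Hm]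
  (D : Integration T EG G Ep Hp Em Hm)

theorem tder_inv_of_eq_one {EX X EH H : Type*} [NormedAddCommGroup EX] [NormedSpace ℝ EX]
    [TopologicalSpace X] [ChartedSpace EX X] [NormedAddCommGroup EH] [NormedSpace ℝ EH]
    [TopologicalSpace H] [ChartedSpace EH H] [Group H] [LieGroup 𝓘(ℝ, EH) ∞ H] {f : X → H} {x : X}
    (hf : MDifferentiableAt 𝓘(ℝ, EX) 𝓘(ℝ, EH) f x) (h : f x = 1) :
    tder EX EH (fun z => (f z)⁻¹) x = -tder EX EH f x := by
  rw [← rLog_of_eq_one h, rLog_eq_neg_lLog_inv hf, neg_neg, lLog_of_eq_one (by rw [h, inv_one])]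

namespace Integration

variable (x : (GammaBar D.φp D.φm).obj (op ⦋0⦌)) {n : ℕ}

/-- The degenerate `n`-simplex, as a point of the manifold `Γ̄_n`. -/
def unitPt (n : ℕ) : (D.level n).Carrier := basePt (GammaBar D.φp D.φm) n x

/-- The differential of an edge at the degenerate simplex. -/
def dEdge (n : ℕ) (i j : Fin (n + 1)) : (D.level n).E →L[ℝ] Em × Ep :=
  tder (D.level n).E (Em × Ep) (D.isLocalDouble.edgeFun n i j) (D.unitPt x n)

theorem dEdge_self (i : Fin (n + 1)) : D.dEdge x n i i = 0 :=
  D.isLocalDouble.tder_edgeFun_refl n i _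

theorem dEdge_tangentMap {m n : ℕ} (f : ⦋m⦌ ⟶ ⦋n⦌) (i j : Fin (m + 1))
    (v : (D.level n).E) :
    D.dEdge x m i j (D.gammaBar.tangentMap f x v) =
      D.dEdge x n (f.toOrderHom i) (f.toOrderHom j) v :=
  D.isLocalDouble.tder_edgeFun_tangentMap x f i j v

theorem compM_basePt (i j : Fin (n + 1)) : D.compM n i j (D.unitPt x n) = 1 :=
  congrArg Prod.fst (D.isLocalDouble.edgeFun_basePt x n i j)

theorem compP_basePt (i j : Fin (n + 1)) : D.compP n i j (D.unitPt x n) = 1 :=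
  congrArg Prod.snd (D.isLocalDouble.edgeFun_basePt x n i j)

theorem tder_compM (i j : Fin (n + 1)) (v : (D.level n).E) :
    tder (D.level n).E Em (D.compM n i j) (D.unitPt x n) v =
      (D.dEdge x n i j v).1 :=
  (congrArg (fun L : (D.level n).E →L[ℝ] Em => L v)
    (tder_comp (g := (Prod.fst : Hm × Hp → Hm)) (f := D.isLocalDouble.edgeFun n i j) rfl
      (contMDiff_fst'.mdifferentiable (by simp) _)
      ((D.isLocalDouble.contMDiff_edgeFun n i j).mdifferentiable (by simp)
        (D.unitPt x n)))).trans
    (congrArg (fun L : Em × Ep →L[ℝ] Em => L (D.dEdge x n i j v)) (tder_fst _))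

theorem tder_compP (i j : Fin (n + 1)) (v : (D.level n).E) :
    tder (D.level n).E Ep (D.compP n i j) (D.unitPt x n) v =
      (D.dEdge x n i j v).2 :=
  (congrArg (fun L : (D.level n).E →L[ℝ] Ep => L v)
    (tder_comp (g := (Prod.snd : Hm × Hp → Hp)) (f := D.isLocalDouble.edgeFun n i j) rfl
      (contMDiff_snd'.mdifferentiable (by simp) _)
      ((D.isLocalDouble.contMDiff_edgeFun n i j).mdifferentiable (by simp)
        (D.unitPt x n)))).trans
    (congrArg (fun L : Em × Ep →L[ℝ] Ep => L (D.dEdge x n i j v)) (tder_snd _))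

theorem tder_compTop (i j k : Fin (n + 1)) (v : (D.level n).E) :
    tder (D.level n).E Em (D.compTop n i j k) (D.unitPt x n) v =
      (D.dEdge x n i k v).1 - (D.dEdge x n i j v).1 := by
  have hd (a b) := (D.contMDiff_compM n a b).mdifferentiable (by simp)
    (D.unitPt x n)
  have h1 := tder_mul_of_eq_one (mdiffAt_inv (hd i j)) (hd i k)
    (by rw [compM_basePt, inv_one]) (D.compM_basePt x i k)
  rw [tder_inv_of_eq_one (hd i j) (D.compM_basePt x i j)] at h1
  refine (congrArg (fun L : (D.level n).E →L[ℝ] Em => L v) h1).trans ?_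
  rw [← D.tder_compM, ← D.tder_compM, sub_eq_neg_add]
  rfl

theorem tder_compRight (i j k : Fin (n + 1)) (v : (D.level n).E) :
    tder (D.level n).E Ep (D.compRight n i j k) (D.unitPt x n) v =
      (D.dEdge x n i k v).2 - (D.dEdge x n j k v).2 := by
  have hd (a b) := (D.contMDiff_compP n a b).mdifferentiable (by simp)
    (D.unitPt x n)
  have h1 := tder_mul_of_eq_one (hd i k) (mdiffAt_inv (hd j k)) (D.compP_basePt x i k)
    (by rw [compP_basePt, inv_one])
  rw [tder_inv_of_eq_one (hd j k) (D.compP_basePt x j k)] at h1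
  refine (congrArg (fun L : (D.level n).E →L[ℝ] Ep => L v) h1).trans ?_
  rw [← D.tder_compP, ← D.tder_compP, sub_eq_add_neg]
  rfl

/-- The form `ω̄` at the unit, in terms of the differentials of the three edges. -/
theorem squareForm_basePt (v w : (D.level 2).E) :
    D.squareForm 2 0 1 2 (D.unitPt x 2) ![v, w] =
      D.pair (D.dEdge x 2 0 1 v).2 (D.dEdge x 2 1 2 w).1 -
        D.pair (D.dEdge x 2 0 1 w).2 (D.dEdge x 2 1 2 v).1 -
      (D.pair ((D.dEdge x 2 0 2 w).2 - (D.dEdge x 2 1 2 w).2)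
          ((D.dEdge x 2 0 2 v).1 - (D.dEdge x 2 0 1 v).1) -
        D.pair ((D.dEdge x 2 0 2 v).2 - (D.dEdge x 2 1 2 v).2)
          ((D.dEdge x 2 0 2 w).1 - (D.dEdge x 2 0 1 w).1)) := by
  set b := D.unitPt x 2
  have dM := (D.contMDiff_compM 2 1 2).mdifferentiable (by simp) b
  have dP := (D.contMDiff_compP 2 0 1).mdifferentiable (by simp) b
  have dT := (D.contMDiff_compTop 2 0 1 2).mdifferentiable (by simp) b
  have dR := (D.contMDiff_compRight 2 0 1 2).mdifferentiable (by simp) b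
  have hT : D.compTop 2 0 1 2 b = 1 := by
    change (D.compM 2 0 1 _)⁻¹ * D.compM 2 0 2 _ = 1
    rw [D.compM_basePt, D.compM_basePt, inv_one, one_mul]
  have hR : D.compRight 2 0 1 2 b = 1 := by
    change D.compP 2 0 2 _ * (D.compP 2 1 2 _)⁻¹ = 1
    rw [D.compP_basePt, D.compP_basePt, inv_one, one_mul]
  have h1 := D.pwForm_φp_φm dP dM
  have h2 := D.pwForm_φm_φp dT dR
  rw [lLog_of_eq_one (D.compP_basePt x 0 1), rLog_of_eq_one (D.compM_basePt x 1 2)] at h1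
  rw [lLog_of_eq_one hT, rLog_of_eq_one hR] at h2
  have h3 := congrArg₂ (fun A B : (D.level 2).E [⋀^Fin 2]→L[ℝ] ℝ => (A - B) ![v, w]) h1 h2
  refine h3.trans ?_
  simp only [ContinuousAlternatingMap.sub_apply, wedge_apply, ContinuousLinearMap.flip_apply,
    Matrix.cons_val_zero, Matrix.cons_val_one, b, tder_compM, tder_compP, tder_compTop,
    tder_compRight]

/-- The IM-form in degrees `(1, 1)` is twice the pairing of `𝔤 = 𝔥₋ ⊕ 𝔥₊`. -/
theorem imForm_one_one (v w : (D.level 1).E) :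
    D.gammaBar.imForm D.omega x 1 1 v w =
      2 * (D.pair (D.dEdge x 1 0 1 v).2 (D.dEdge x 1 0 1 w).1 +
        D.pair (D.dEdge x 1 0 1 w).2 (D.dEdge x 1 0 1 v).1) := by
  -- each of the two shuffles contributes one of these terms, up to the order of `v` and `w`; in
  -- `squareForm_basePt` both summands give the same pairing, whence the factor `2`
  have key (g g' : Fin 1 → Fin 2) (hg : g 0 = 0) (hg' : g' 0 = 1) (v w : (D.level 1).E) :
      D.squareForm 2 0 1 2 (D.unitPt x 2)
        ![D.gammaBar.tangentMap (countMap g) x v, D.gammaBar.tangentMap (countMap g') x w] =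
      2 * D.pair (D.dEdge x 1 0 1 v).2 (D.dEdge x 1 0 1 w).1 := by
    obtain rfl : g = fun _ => 0 := funext fun i => by rw [Subsingleton.elim i 0, hg]
    obtain rfl : g' = fun _ => 1 := funext fun i => by rw [Subsingleton.elim i 0, hg']
    refine (D.squareForm_basePt x _ _).trans ?_
    have e0 : (countMap fun _ : Fin 1 => (0 : Fin 2)).toOrderHom (0 : Fin 3) = (0 : Fin 2) := by
      decide
    have e1 : (countMap fun _ : Fin 1 => (0 : Fin 2)).toOrderHom (1 : Fin 3) = (1 : Fin 2) := by
      decide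
    have e2 : (countMap fun _ : Fin 1 => (0 : Fin 2)).toOrderHom (2 : Fin 3) = (1 : Fin 2) := by
      decide
    have f0 : (countMap fun _ : Fin 1 => (1 : Fin 2)).toOrderHom (0 : Fin 3) = (0 : Fin 2) := by
      decide
    have f1 : (countMap fun _ : Fin 1 => (1 : Fin 2)).toOrderHom (1 : Fin 3) = (0 : Fin 2) := by
      decide
    have f2 : (countMap fun _ : Fin 1 => (1 : Fin 2)).toOrderHom (2 : Fin 3) = (1 : Fin 2) := by
      decide
    simp only [D.dEdge_tangentMap, e0, e1, e2, f0, f1, f2, D.dEdge_self]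
    simp
    ring
  have hsh (σ : Equiv.Perm (Fin (1 + 1))) : IsShuffle 1 1 σ :=
    ⟨Subsingleton.strictMono _, Subsingleton.strictMono _⟩
  have hω (b : (D.level 2).Carrier) : D.omega 2 2 b = D.squareForm 2 0 1 2 b := by
    rw [omega_eq]; rfl
  have hu : (Finset.univ : Finset (Equiv.Perm (Fin (1 + 1)))) = {1, Equiv.swap 0 1} := by decide
  have hsum : D.gammaBar.imForm D.omega x 1 1 v w = ∑ σ : Equiv.Perm (Fin (1 + 1)),
      ((Equiv.Perm.sign σ : ℤ) : ℝ) * D.squareForm 2 0 1 2 (D.unitPt x 2)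
        ![D.gammaBar.tangentMap (countMap fun r => σ (Fin.castAdd 1 r)) x v,
          D.gammaBar.tangentMap (countMap fun r => σ (Fin.natAdd 1 r)) x w] := by
    refine Finset.sum_congr rfl fun σ _ => ?_
    rw [if_pos (hsh σ)]
    exact congrArg (fun A : (D.level 2).E [⋀^Fin 2]→L[ℝ] ℝ => _ * A _) (hω _)
  rw [hsum, hu, Finset.sum_pair (by decide)]
  have hswap (A : (D.level 2).E [⋀^Fin 2]→L[ℝ] ℝ) (a b : (D.level 2).E) :
      A ![a, b] = -A ![b, a] := by
    have h1 := A.toAlternatingMap.map_swap ![b, a] (i := 0) (j := 1) (by decide)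
    have h2 : ![b, a] ∘ Equiv.swap (0 : Fin 2) 1 = ![a, b] := by
      funext i
      fin_cases i <;> rfl
    rw [h2] at h1
    exact h1
  have k1 := key (fun r => (1 : Equiv.Perm (Fin (1 + 1))) (Fin.castAdd 1 r))
    (fun r => (1 : Equiv.Perm (Fin (1 + 1))) (Fin.natAdd 1 r)) rfl rfl v w
  have k2 := key (fun r => (Equiv.swap 0 1 : Equiv.Perm (Fin (1 + 1))) (Fin.natAdd 1 r))
    (fun r => (Equiv.swap 0 1 : Equiv.Perm (Fin (1 + 1))) (Fin.castAdd 1 r)) (by decide)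
    (by decide) w v
  have s2 : Equiv.Perm.sign (Equiv.swap 0 1 : Equiv.Perm (Fin (1 + 1))) = -1 := by decide
  replace k2 := (hswap (D.squareForm 2 0 1 2 (D.unitPt x 2)) _ _).symm.trans k2
  have e1 : (((1 : ℤˣ) : ℤ) : ℝ) = 1 := by simp
  have e2 : (((-1 : ℤˣ) : ℤ) : ℝ) = -1 := by simp
  rw [s2, Equiv.Perm.sign_one, e1, e2, one_mul, neg_one_mul, mul_add]
  exact congrArg₂ (· + ·) k1 k2

end Integration

end IMForm

/-! ### Non-degeneracy of `ω̄` -/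

section Nondegenerate

open SimplicialManifold

variable {𝔤 : Type*} [LieRing 𝔤] [LieAlgebra ℝ 𝔤] {T : ManinTriple 𝔤}
  {EG G : Type*} [NormedAddCommGroup EG] [NormedSpace ℝ EG] [FiniteDimensional ℝ EG]
  [CompleteSpace EG]
  [TopologicalSpace G] [ChartedSpace EG G] [Group G] [LieGroup 𝓘(ℝ, EG) ∞ G]
  {Ep Em : Type v} {Hp Hm : Type u}
  [NormedAddCommGroup Ep] [NormedSpace ℝ Ep] [FiniteDimensional ℝ Ep] [CompleteSpace Ep]
  [TopologicalSpace Hp] [ChartedSpace Ep Hp] [Group Hp] [LieGroup 𝓘(ℝ, Ep) ∞ Hp] [T2Space Hp]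
  [NormedAddCommGroup Em] [NormedSpace ℝ Em] [FiniteDimensional ℝ Em] [CompleteSpace Em]
  [TopologicalSpace Hm] [ChartedSpace Em Hm] [Group Hm] [LieGroup 𝓘(ℝ, Em) ∞ Hm] [T2Space Hm]
  (D : Integration T EG G Ep Hp Em Hm)

namespace Integration

variable (x : (GammaBar D.φp D.φm).obj (op ⦋0⦌))

theorem form_eq_pair (y z : Em × Ep) :
    D.form (D.incM y.1 + D.incP y.2) (D.incM z.1 + D.incP z.2) =
      D.pair y.2 z.1 + D.pair z.2 y.1 := by
  simp only [map_add, add_apply, form_incM_incM, form_incP_incP,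
    form_incP_incM, D.form_symm (D.incM y.1), zero_add, add_zero]

/-- The pairing of `𝔤 = 𝔥₋ ⊕ 𝔥₊` is non-degenerate. -/
theorem eq_zero_of_pair {y : Em × Ep} (hy : ∀ z : Em × Ep, D.pair y.2 z.1 + D.pair z.2 y.1 = 0) :
    y = 0 := by
  have h1 : D.toG (D.incM y.1 + D.incP y.2) = 0 := by
    refine T.nondegenerate.1 _ fun a => ?_
    obtain ⟨p, hp, m, hm, rfl⟩ := Submodule.mem_sup.1
      (T.isCompl.sup_eq_top ▸ (Submodule.mem_top : a ∈ ⊤))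
    have h2 := hy (D.toM.symm ⟨m, hm⟩, D.toP.symm ⟨p, hp⟩)
    rw [← D.form_eq_pair y, form_apply, map_add D.toG (D.incM _) (D.incP _),
      map_add D.toG (D.incM (D.toM.symm _)) (D.incP _), D.toG_incM (D.toM.symm _),
      D.toG_incP (D.toP.symm _), D.toM.apply_symm_apply, D.toP.apply_symm_apply, add_comm m p] at h2
    rw [map_add D.toG]
    exact h2
  obtain ⟨h3, h4⟩ := D.eq_zero_of_incM_add_incP (D.toG.map_eq_zero_iff.1 h1)
  exact Prod.ext h3 h4

theorem dEdge_bijective : Function.Bijective (D.dEdge x 1 0 1) :=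
  (D.isLocalDouble.diffeoOne.isLocalDiffeomorph _).mfderivToContinuousLinearEquiv
    (by simp) |>.bijective

theorem imForm_symm (v w : (D.level 1).E) : D.gammaBar.imForm D.omega x 1 1 v w =
    D.gammaBar.imForm D.omega x 1 1 w v := by
  rw [D.imForm_one_one x v w, D.imForm_one_one x w v, add_comm]

theorem eq_zero_of_imForm {v : (D.level 1).E}
    (hv : ∀ w, D.gammaBar.imForm D.omega x 1 1 v w = 0) : v = 0 := by
  refine (D.dEdge_bijective x).1 ((D.eq_zero_of_pair fun z => ?_).trans (map_zero _).symm)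
  obtain ⟨w, rfl⟩ := (D.dEdge_bijective x).2 z
  have h1 := hv w
  rw [D.imForm_one_one x v w] at h1
  exact (mul_eq_zero.1 h1).resolve_left two_ne_zero

theorem imForm_zero_left {X : SSet.{u}} (S : SimplicialManifold.{u, v} X) (α : S.BiForm)
    (x : X.obj (op ⦋0⦌)) (a b : ℕ) (w : (S.lvl b).E) : S.imForm α x a b 0 w = 0 := by
  refine Finset.sum_eq_zero fun σ _ => ?_
  have h (A : (S.lvl (a + b)).E [⋀^Fin 2]→L[ℝ] ℝ) (y : (S.lvl (a + b)).E) : A ![0, y] = 0 :=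
    A.map_coord_zero 0 rfl
  rw [map_zero]
  split_ifs
  · exact mul_eq_zero_of_right _ (h _ _)
  · rfl

theorem imForm_zero_right {X : SSet.{u}} (S : SimplicialManifold.{u, v} X) (α : S.BiForm)
    (x : X.obj (op ⦋0⦌)) (a b : ℕ) (v : (S.lvl a).E) : S.imForm α x a b v 0 = 0 := by
  refine Finset.sum_eq_zero fun σ _ => ?_
  have h (A : (S.lvl (a + b)).E [⋀^Fin 2]→L[ℝ] ℝ) (y : (S.lvl (a + b)).E) : A ![y, 0] = 0 :=
    A.map_coord_zero 1 rfl
  rw [map_zero]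
  split_ifs
  · exact mul_eq_zero_of_right _ (h _ _)
  · rfl

/-- A cycle outside degree one vanishes. -/
theorem eq_zero_of_mem_cycles {l : ℕ} (hl : l ≠ 1) {v : (D.level l).E}
    (hv : v ∈ D.gammaBar.cycles x l) : v = 0 := by
  match l, hl with
  | 0, _ => exact D.isLocalDouble.eq_zero_of_level_zero v
  | l + 2, _ =>
    rw [D.isLocalDouble.cycles_add_two x l] at hv
    exact (Submodule.mem_bot ℝ).1 hv

theorem eq_zero_of_mem_boundaries {l : ℕ} {v : (D.level l).E}
    (hv : v ∈ D.gammaBar.boundaries x l) : v = 0 := by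
  match l with
  | 0 => exact D.isLocalDouble.eq_zero_of_level_zero v
  | l + 1 =>
    rw [D.isLocalDouble.boundaries_succ x l] at hv
    exact (Submodule.mem_bot ℝ).1 hv

theorem mem_cycles_one (v : (D.level 1).E) : v ∈ D.gammaBar.cycles x 1 := by
  rw [D.isLocalDouble.cycles_one x]
  trivial

/-- Outside degree one the cycles vanish; in degree one all tangent vectors are cycles, the
boundaries vanish, and the IM-form is non-degenerate. -/
theorem isNondegenerate_omega : D.gammaBar.IsNondegenerate 2 D.omega where
  descends_left x a b _ v hv w _ := by
    obtain rfl := D.eq_zero_of_mem_boundaries x hv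
    exact imForm_zero_left _ _ x a b w
  descends_right x a b _ v _ w hw := by
    obtain rfl := D.eq_zero_of_mem_boundaries x hw
    exact imForm_zero_right _ _ x a b v
  left x a b hab v hv h := by
    rcases eq_or_ne a 1 with rfl | ha
    · obtain rfl : b = 1 := by omega
      rw [D.eq_zero_of_imForm x fun w => h w (D.mem_cycles_one x w)]
      exact Submodule.zero_mem _
    · rw [D.eq_zero_of_mem_cycles x ha hv]
      exact Submodule.zero_mem _
  right x a b hab w hw h := by
    rcases eq_or_ne b 1 with rfl | hb
    · obtain rfl : a = 1 := by omega
      rw [D.eq_zero_of_imForm x fun v =>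
        (D.imForm_symm x w v).trans (h v (D.mem_cycles_one x v))]
      exact Submodule.zero_mem _
    · rw [D.eq_zero_of_mem_cycles x hb hw]
      exact Submodule.zero_mem _
  above x l hl v hv := by
    rw [D.eq_zero_of_mem_cycles x (by omega) hv]
    exact Submodule.zero_mem _

theorem isShiftedSymplecticLocalLieGroup [PreconnectedSpace G] :
    D.gammaBar.IsShiftedSymplecticLocalLieGroup 2 2 D.omega where
  localLieGroup := D.isLocalDouble.isLocalLieGroup
  shiftedForm := D.isShiftedForm_omega
  closed := D.isClosedForm_omega
  nondegenerate := D.isNondegenerate_omega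

theorem toTangent_bijective : Function.Bijective D.toTangent :=
  (D.lieM.symm.toLinearEquiv.prodCongr D.lieP.symm.toLinearEquiv).bijective

end Integration

end Nondegenerate

/-! ### The Lie algebra `𝔥₋ ⊕ 𝔥₊` as tangent space of `Γ̄_1` -/

section LowLevels

open SimplicialManifold

variable {𝔤 : Type*} [LieRing 𝔤] [LieAlgebra ℝ 𝔤] {T : ManinTriple 𝔤}
  {EG G : Type*} [NormedAddCommGroup EG] [NormedSpace ℝ EG] [FiniteDimensional ℝ EG]
  [CompleteSpace EG]
  [TopologicalSpace G] [ChartedSpace EG G] [Group G] [LieGroup 𝓘(ℝ, EG) ∞ G]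
  {Ep Em : Type v} {Hp Hm : Type u}
  [NormedAddCommGroup Ep] [NormedSpace ℝ Ep] [FiniteDimensional ℝ Ep] [CompleteSpace Ep]
  [TopologicalSpace Hp] [ChartedSpace Ep Hp] [Group Hp] [LieGroup 𝓘(ℝ, Ep) ∞ Hp] [T2Space Hp]
  [NormedAddCommGroup Em] [NormedSpace ℝ Em] [FiniteDimensional ℝ Em] [CompleteSpace Em]
  [TopologicalSpace Hm] [ChartedSpace Em Hm] [Group Hm] [LieGroup 𝓘(ℝ, Em) ∞ Hm] [T2Space Hm]
  (D : Integration T EG G Ep Hp Em Hm)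

theorem mfderiv_prod_model {EY Y : Type*} [NormedAddCommGroup EY] [NormedSpace ℝ EY]
    [TopologicalSpace Y] [ChartedSpace EY Y] (f : Hm × Hp → Y) (y : Hm × Hp) (w : Em × Ep) :
    mfderiv (𝓘(ℝ, Em).prod 𝓘(ℝ, Ep)) 𝓘(ℝ, EY) f y w = tder (Em × Ep) EY f y w := by
  have key (I : ModelWithCorners ℝ (Em × Ep) (ModelProd Em Ep)) (hI : I = 𝓘(ℝ, Em × Ep)) :
      mfderiv I 𝓘(ℝ, EY) f y w = tder (Em × Ep) EY f y w := by
    subst hI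
    rfl
  exact key _ modelWithCornersSelf_prod.symm

namespace Integration

/-- The diffeomorphism `Γ̄_1 → H₋ × H₊`, for the product model. -/
def levelOne : Diffeomorph 𝓘(ℝ, (D.gammaBar.lvl 1).E) (𝓘(ℝ, Em).prod 𝓘(ℝ, Ep))
    (D.gammaBar.lvl 1).Carrier (Hm × Hp) ∞ where
  toEquiv := D.isLocalDouble.diffeoOne.toEquiv
  contMDiff_toFun := by
    rw [← modelWithCornersSelf_prod]
    exact D.isLocalDouble.diffeoOne.contMDiff_toFun
  contMDiff_invFun := by
    rw [← modelWithCornersSelf_prod]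
    exact D.isLocalDouble.diffeoOne.contMDiff_invFun

/-- The diffeomorphism `Γ̄_2 → H₋ × Γ × H₊`, for the product model. -/
def levelTwo : Diffeomorph 𝓘(ℝ, (D.gammaBar.lvl 2).E)
    (𝓘(ℝ, Em).prod (𝓘(ℝ, D.isLocalDouble.squareStr.E).prod 𝓘(ℝ, Ep)))
    (D.gammaBar.lvl 2).Carrier (Hm × D.isLocalDouble.squareStr.Carrier × Hp) ∞ where
  toEquiv := D.isLocalDouble.diffeoTwo.toEquiv
  contMDiff_toFun := by
    rw [← modelWithCornersSelf_prod, ← modelWithCornersSelf_prod]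
    exact D.isLocalDouble.diffeoTwo.contMDiff_toFun
  contMDiff_invFun := by
    rw [← modelWithCornersSelf_prod, ← modelWithCornersSelf_prod]
    exact D.isLocalDouble.diffeoTwo.contMDiff_invFun

theorem levelOne_apply (y : (D.gammaBar.lvl 1).Carrier) : D.levelOne y = level1 y :=
  (level1_eq_edge y).symm

variable (x : (GammaBar D.φp D.φm).obj (op ⦋0⦌))

theorem levelOne_symm_one : D.levelOne.symm (1, 1) = D.unitPt x 1 := by
  rw [← D.levelOne.symm_apply_apply (D.unitPt x 1)]
  exact congrArg D.levelOne.symm (D.isLocalDouble.edgeFun_basePt x 1 0 1).symm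

theorem dEdge_levelOne_symm (w : Em × Ep) : D.dEdge x 1 0 1
    (mfderiv (𝓘(ℝ, Em).prod 𝓘(ℝ, Ep)) 𝓘(ℝ, (D.gammaBar.lvl 1).E) D.levelOne.symm (1, 1) w) = w := by
  have hs : MDifferentiableAt 𝓘(ℝ, Em × Ep) 𝓘(ℝ, (D.level 1).E)
      (D.isLocalDouble.diffeoOne.symm : Hm × Hp → (D.level 1).Carrier) 1 :=
    D.isLocalDouble.diffeoOne.symm.contMDiff.mdifferentiable (by simp) 1
  have h1 := tder_comp (f := (D.isLocalDouble.diffeoOne.symm : Hm × Hp → (D.level 1).Carrier))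
    (g := D.isLocalDouble.edgeFun 1 0 1) (D.levelOne_symm_one x)
    ((D.isLocalDouble.contMDiff_edgeFun 1 0 1).mdifferentiable (by simp) _) hs
  have h2 : (fun z : Hm × Hp => D.isLocalDouble.edgeFun 1 0 1 (D.isLocalDouble.diffeoOne.symm z)) =
      fun z => z := funext fun z => D.isLocalDouble.diffeoOne.apply_symm_apply z
  rw [h2, tder_id] at h1
  have h3 : tder (Em × Ep) (D.level 1).E D.isLocalDouble.diffeoOne.symm (1 : Hm × Hp) w =
      mfderiv (𝓘(ℝ, Em).prod 𝓘(ℝ, Ep)) 𝓘(ℝ, (D.gammaBar.lvl 1).E) D.levelOne.symm (1, 1) w := by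
    exact (mfderiv_prod_model _ _ _).symm
  rw [← h3]
  exact (congrArg (fun L : Em × Ep →L[ℝ] Em × Ep => L w) h1).symm

theorem imForm_levelOne_symm {w : T.minus × T.plus}
    (hw : ∀ w' : T.minus × T.plus, D.gammaBar.imForm D.omega x 1 1
      (mfderiv (𝓘(ℝ, Em).prod 𝓘(ℝ, Ep)) 𝓘(ℝ, (D.gammaBar.lvl 1).E) D.levelOne.symm (1, 1)
        (D.toTangent w))
      (mfderiv (𝓘(ℝ, Em).prod 𝓘(ℝ, Ep)) 𝓘(ℝ, (D.gammaBar.lvl 1).E) D.levelOne.symm (1, 1)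
        (D.toTangent w')) = 0) : w = 0 := by
  refine D.toTangent_bijective.1 ((D.eq_zero_of_pair fun z => ?_).trans
    (D.lieM.symm.toLinearEquiv.prodCongr D.lieP.symm.toLinearEquiv).map_zero.symm)
  obtain ⟨w', rfl⟩ := D.toTangent_bijective.2 z
  have h1 := (D.imForm_one_one x _ _).symm.trans (hw w')
  rw [D.dEdge_levelOne_symm x, D.dEdge_levelOne_symm x] at h1
  exact (mul_eq_zero.1 h1).resolve_left two_ne_zero

end Integration

end LowLevels

end ManinCodiagonal

end

theorem mainTheorem5
    {𝔤 : Type*} [LieRing 𝔤] [LieAlgebra ℝ 𝔤] (T : ManinTriple 𝔤)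
    {EG G : Type*} [NormedAddCommGroup EG] [NormedSpace ℝ EG]
    [FiniteDimensional ℝ EG] [CompleteSpace EG]
    [TopologicalSpace G] [ChartedSpace EG G] [Group G] [LieGroup 𝓘(ℝ, EG) ∞ G]
    [T2Space G] [SimplyConnectedSpace G]
    {Ep Em : Type v} {Hp Hm : Type u}
    [NormedAddCommGroup Ep] [NormedSpace ℝ Ep] [FiniteDimensional ℝ Ep] [CompleteSpace Ep]
    [TopologicalSpace Hp] [ChartedSpace Ep Hp] [Group Hp] [LieGroup 𝓘(ℝ, Ep) ∞ Hp]
    [T2Space Hp] [SimplyConnectedSpace Hp]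
    [NormedAddCommGroup Em] [NormedSpace ℝ Em] [FiniteDimensional ℝ Em] [CompleteSpace Em]
    [TopologicalSpace Hm] [ChartedSpace Em Hm] [Group Hm] [LieGroup 𝓘(ℝ, Em) ∞ Hm]
    [T2Space Hm] [SimplyConnectedSpace Hm]
    (D : Integration T EG G Ep Hp Em Hm) :
    -- `Γ` is an embedded submanifold of `H₊ × H₋ × H₋ × H₊`, and `Γ̄` is a simplicial manifold,
    -- each level being embedded by its entries
    ∃ (MΓ : ManifoldStr.{u, v} (LWSquare D.φp D.φm))
      (S : SimplicialManifold.{u, v} (GammaBar D.φp D.φm)),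
      IsSmoothEmbedding 𝓘(ℝ, MΓ.E)
        (𝓘(ℝ, Ep).prod (𝓘(ℝ, Em).prod (𝓘(ℝ, Em).prod 𝓘(ℝ, Ep)))) ∞
        (MΓ.mapTo LWSquare.toProd) ∧
      (∀ n : ℕ, IsJointSmoothEmbedding (S.lvl n) MΓ
        fun i : EntryIdx n => (S.lvl n).mapOf MΓ (entry n i)) ∧
      -- the description of the first levels, faces and degeneracies
      (∃ (e₁ : Diffeomorph 𝓘(ℝ, (S.lvl 1).E) (𝓘(ℝ, Em).prod 𝓘(ℝ, Ep))
            (S.lvl 1).Carrier (Hm × Hp) ∞)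
          (e₂ : Diffeomorph 𝓘(ℝ, (S.lvl 2).E) (𝓘(ℝ, Em).prod (𝓘(ℝ, MΓ.E).prod 𝓘(ℝ, Ep)))
            (S.lvl 2).Carrier (Hm × MΓ.Carrier × Hp) ∞),
        (∀ y, e₁ y = level1 y) ∧ (∀ y, e₂ y = level2 y) ∧
        (∀ (a₃ a₂ a₁ : Hm) (h₃ h₂ h₁ : Hp) (hc : D.φp h₃ * D.φm a₁ = D.φm a₂ * D.φp h₂)
            (y : (GammaBar D.φp D.φm).obj (op ⦋2⦌)), level2 y = (a₃, ⟨h₃, a₂, a₁, h₂, hc⟩, h₁) →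
          level1 ((GammaBar D.φp D.φm).δ (0 : Fin 3) y) = (a₁, h₁) ∧
          level1 ((GammaBar D.φp D.φm).δ (1 : Fin 3) y) = (a₃ * a₂, h₂ * h₁) ∧
          level1 ((GammaBar D.φp D.φm).δ (2 : Fin 3) y) = (a₃, h₃)) ∧
        (∀ (a : Hm) (h : Hp) (y : (GammaBar D.φp D.φm).obj (op ⦋1⦌)), level1 y = (a, h) →
          level2 ((GammaBar D.φp D.φm).σ (0 : Fin 2) y) = (1, ⟨1, a, a, 1, by simp⟩, h) ∧
          level2 ((GammaBar D.φp D.φm).σ (1 : Fin 2) y) = (a, ⟨h, 1, 1, h, by simp⟩, 1)) ∧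
        -- the IM-form on `𝔥₋ ⊕ 𝔥₊ = T_e Γ̄_1`
        (∀ x : (GammaBar D.φp D.φm).obj (op ⦋0⦌),
          S.tangentCx x 1 = ⊤ ∧
          (let ι : T.minus × T.plus → (S.lvl 1).E := fun w =>
              mfderiv (𝓘(ℝ, Em).prod 𝓘(ℝ, Ep)) 𝓘(ℝ, (S.lvl 1).E) e₁.symm (1, 1) (D.toTangent w);
            (∀ w, (∀ w', S.imForm (omegaBar D MΓ S) x 1 1 (ι w) (ι w') = 0) → w = 0) ∧
            (∀ w', (∀ w, S.imForm (omegaBar D MΓ S) x 1 1 (ι w) (ι w') = 0) → w' = 0)))) ∧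
      -- the main claim
      S.IsShiftedSymplecticLocalLieGroup 2 2 (omegaBar D MΓ S) := by
  have : PreconnectedSpace G := inferInstance
  refine ⟨D.isLocalDouble.squareStr, D.gammaBar, D.isLocalDouble.isSmoothEmbedding_toProd,
    D.isLocalDouble.isJointSmoothEmbedding_entry, ⟨D.levelOne, D.levelTwo, D.levelOne_apply,
    fun _ => rfl, level1_δ, level2_σ, fun x => ⟨D.isLocalDouble.tangentCx_one x, ?_, ?_⟩⟩,
    D.isShiftedSymplecticLocalLieGroup⟩
  · exact fun w hw => D.imForm_levelOne_symm x hw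
  · exact fun w hw => D.imForm_levelOne_symm x fun w' => (D.imForm_symm x _ _).trans (hw w')
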